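/- Notation. Let $\mathbb B=\{z_1e_1+z_2e_2: z_1,z_2\in\mathbb C\}$ be the biharmonic algebra: the commutative associative algebra over $\mathbb C$ with unit $e_1$ and $e_2^2=e_1+2ie_2$, with norm $\|z_1e_1+z_2e_2\|=\sqrt{|z_1|^2+|z_2|^2}$. Put $\mu=\{xe_1+ye_2: x,y\in\mathbb R\}$; nonzero elements of $\mu$ are invertible. For $a=U_1e_1+U_2ie_1+U_3e_2+U_4ie_2$ with real $U_k$ write $\mathrm U_k[a]=U_k$. A function $\Phi:G\to\mathbb B$ on a domain $G\subset\mu$ is monogenic if $\lim_{h\to0,\,h\in\mu}(\Phi(\zeta+h)-\Phi(\zeta))h^{-1}$ exists for every $\zeta\in G$. Let $\mathcal U$ be the open unit disk, $\Gamma$ the unit circle, $\sigma=\sigma_1+i\sigma_2$ ($\sigma_1=\operatorname{Re}\sigma$, $\sigma_2=\operatorname{Im}\sigma$) a conformal map of $\mathcal U$ onto a bounded domain $D_z\subset\mathbb C$ that extends to a homeomorphism $\overline{\mathcal U}\to\overline{D_z}$, and $\widetilde\sigma=\sigma_1e_1+\sigma_2e_2$. Put $D_\zeta=\widetilde\sigma(\mathcal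 U)$, $\partial D_\zeta=\widetilde\sigma(\Gamma)$ (positively oriented). Let $\mathcal X=\{X_1,\dots,X_m\}\subset\Gamma$ be a set of $m\ge1$ distinct points, $\zeta_j=\widetilde\sigma(X_j)$, $\Upsilon_\zeta=\{\zeta_1,\dots,\zeta_m\}$. Put $\mathcal R(Z)=\min_j|Z-X_j|$, $\mathcal R_0=\min_{k\ne j}|X_k-X_j|$ if $m>1$, $\mathcal R_0=1$ if $m=1$; for $E\subset\mathbb C$ put $E_r(T)=\{Z\in E:|Z-T|\le r\}$, $E_r\langle\mathcal X\rangle=\bigcup_jE_r(X_j)$; let $[0,Z_0]$ be the segment. For $f$ on $\Gamma$ the contour derivative is $f'(T)=\lim_{S\to T,\,S\in\Gamma}\frac{f(S)-f(T)}{S-T}$; $\sigma'(Z)$ is the complex derivative for $Z\in\mathcal U$ and the contour derivative for $Z\in\Gamma\setminus\mathcal X$. Put $d(S,Z)=\frac{\sigma(S)-\sigma(Z)}{S-Z}$, $d_2(S,Z)=\frac{\sigma_2(S)-\sigma_2(Z)}{S-Z}$. Let $\beta_j\in(-1,1]$, $j=1,\dots,m$. Assumptions. a) The contour derivative $\sigma'$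 exists, is continuous and does not vanish on $\Gamma\setminus\mathcal X$, and $|\sigma'(Z)|\le c\prod_{j=1}^m|Z-X_j|^{\beta_j}$ for all $Z\in\overline{\mathcal U}\setminus\mathcal X$. b) For some $r_0\in(0,\mathcal R_0/4)$ there are nondecreasing, bounded, semiadditive functions $\omega_1,\omega_1^*:(0,\infty)\to(0,\infty)$ with $\int_0^2\frac{\omega_1(\eta)}\eta d\eta<\infty$ and, for some constant $c$, $\int_0^\varepsilon\frac{\omega_1^*(\eta)}\eta d\eta<c\,\omega_1^*(\varepsilon)$ for all $\varepsilon\in(0,r_0/2)$, such that $$|\sigma'(Z)-\sigma'(Z_0)|\le c\,\frac{\omega(|Z-Z_0|)}{\omega(\mathcal R(Z_0)/2)}\prod_{j=1}^m|Z-X_j|^{\beta_j}\qquad\forall\,Z\in(\Gamma\cup[0,Z_0])_{\mathcal R(Z_0)/2}(Z_0),\ Z\ne Z_0,$$ with $\omega=\omega_1^*$ for all $Z_0\in\Gamma_{r_0}\langle\mathcal X\rangle\setminus\mathcal X$ and with $\omega=\omega_1$ for all $Z_0\in\Gamma\setminus\Gamma_{r_0}\langle\mathcal X\rangle$; and for each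 $j$ there is $c>0$ with $|d(S,Z)|\ge c(|S-X_j|+|Z-X_j|)^{\beta_j}$ for all $Z\in\overline{\mathcal U}_{r_0}(X_j)\setminus\mathcal X$, $S\in\Gamma_{2r_0}(X_j)\setminus\mathcal X$, $S\ne Z$. (All $c$ are independent of the points.) Let $\alpha_j>0$ with $\alpha_j<1$ if $\beta_j<0$ and $\alpha_j<1/(\beta_j+1)$ if $\beta_j\ge0$, and put $\gamma_j=(\beta_j+1)\alpha_j<1$. Let $\mathcal A$ be the class of continuous $\varphi:\partial D_\zeta\setminus\Upsilon_\zeta\to\mathbb R$ with $|\varphi(\zeta)|\le c\prod_j\|\zeta-\zeta_j\|^{-\alpha_j}$, and $\mathcal K\{\gamma_j\}$ the class of continuous $\psi:\Gamma\setminus\mathcal X\to\mathbb R$ with $|\psi(S)|\le c\prod_j|S-X_j|^{-\gamma_j}$. Let $u_1,u_3\in\mathcal A$. For $\varphi:\partial D_\zeta\setminus\Upsilon_\zeta\to\mathbb R$ put $\widetilde\varphi=\varphi\circ\widetilde\sigma$ on $\Gamma\setminus\mathcal X$, and likewise $\widetilde u_l=u_l\circ\widetilde\sigma$. The (1-3)-problem: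 find $\Phi$ monogenic in $D_\zeta$ with $\lim_{\zeta\to\zeta_0,\,\zeta\in D_\zeta}\mathrm U_l[\Phi(\zeta)]=u_l(\zeta_0)$ for all $\zeta_0\in\partial D_\zeta\setminus\Upsilon_\zeta$, $l\in\{1,3\}$, and $|\mathrm U_l[\Phi(\zeta)]|\le c\|\zeta-\zeta_j\|^{-\alpha_j}$ as $\zeta\to\zeta_j$, $\zeta\in D_\zeta$, for $l\in\{1,3\}$ and all $j$. For real functions $\psi$ on $\Gamma\setminus\mathcal X$ and $S\ne Z$ put $$\Omega_1^\psi(S,Z)=\psi(S)\Big(\frac{\sigma'(S)}{d(S,Z)}-1\Big),\quad \Omega_2^\psi(S,Z)=\frac{\psi(S)}2\Big(\frac{\sigma'(S)d_2(S,Z)}{d(S,Z)^2}-\frac{\sigma_2'(S)}{d(S,Z)}\Big),\quad C_\psi=\frac1{4\pi i}\int_\Gamma\frac{\psi(S)}S\,dS,$$ and $\mathcal I[\Omega](Z_0)=\frac1{2\pi i}\int_\Gamma\frac{\Omega(S,Z_0)}{S-Z_0}dS$ for $Z_0\in\Gamma\setminus\mathcal X$, a Cauchy principal value (limit as $\delta\to0+$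 of the integrals over $\{S\in\Gamma:|S-Z_0|>\delta\}$). Theorem. Then: (i) $\varphi\in\mathcal A$ if and only if $\widetilde\varphi\in\mathcal K\{\gamma_j\}$, and every element of $\mathcal K\{\gamma_j\}$ is $\widetilde\varphi$ for some $\varphi\in\mathcal A$; in particular $\widetilde u_1,\widetilde u_3\in\mathcal K\{\gamma_j\}$. (ii) For $\varphi_1,\varphi_3\in\mathcal A$ the integral $\frac1{2\pi i}\int_{\partial D_\zeta}(\varphi_1(\tau)e_1+\varphi_3(\tau)e_2)(\tau-\zeta)^{-1}d\tau$ converges absolutely for every $\zeta\in D_\zeta$; and for $\psi\in\mathcal K\{\gamma_j\}$ the integral $C_\psi$ converges absolutely and the principal values $\mathcal I[\Omega_1^\psi](Z_0)$, $\mathcal I[\Omega_2^\psi](Z_0)$ exist for every $Z_0\in\Gamma\setminus\mathcal X$. (iii) For all $\varphi_1,\varphi_3\in\mathcal A$, the function $$\Phi(\zeta)=\frac1{2\pi i}\int_{\partial D_\zeta}(\varphi_1(\tau)e_1+\varphi_3(\tau)e_2)(\tau-\zeta)^{-1}d\tau,\qquad \zeta\in D_\zeta,$$ solves the (1-3)-problem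 if and only if $\widetilde\varphi_1,\widetilde\varphi_3$ satisfy, for all $Z_0\in\Gamma\setminus\mathcal X$, the system $$\tfrac12\widetilde\varphi_1(Z_0)+\operatorname{Re}\mathcal I[\Omega_1^{\widetilde\varphi_1}](Z_0)-2\operatorname{Im}\mathcal I[\Omega_2^{\widetilde\varphi_1}](Z_0)-2\operatorname{Re}\mathcal I[\Omega_2^{\widetilde\varphi_3}](Z_0)+C_{\widetilde\varphi_1}=\widetilde u_1(Z_0),$$ $$\tfrac12\widetilde\varphi_3(Z_0)+\operatorname{Re}\mathcal I[\Omega_1^{\widetilde\varphi_3}](Z_0)+2\operatorname{Im}\mathcal I[\Omega_2^{\widetilde\varphi_3}](Z_0)-2\operatorname{Re}\mathcal I[\Omega_2^{\widetilde\varphi_1}](Z_0)+C_{\widetilde\varphi_3}=\widetilde u_3(Z_0).$$ Consequently, solving the (1-3)-problem among Cauchy-type integrals with densities in $\mathcal A$ is equivalent to solving this system in $\mathcal K\{\gamma_j\}$. -/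

import Mathlib

open Set Filter Topology MeasureTheory

noncomputable section

namespace BiharmonicSchwarz

/-! ### The biharmonic algebra -/

/-- The biharmonic algebra `𝔹 = {z₁ e₁ + z₂ e₂ : z₁, z₂ ∈ ℂ}`, with the Euclidean norm
`‖z₁ e₁ + z₂ e₂‖ = (|z₁|² + |z₂|²)^(1/2)`. -/
def Biharm : Type := WithLp 2 (ℂ × ℂ)

namespace Biharm

instance : NormedAddCommGroup Biharm := inferInstanceAs (NormedAddCommGroup (WithLp 2 (ℂ × ℂ)))

instance : NormedSpace ℂ Biharm := inferInstanceAs (NormedSpace ℂ (WithLp 2 (ℂ × ℂ)))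

instance : CompleteSpace Biharm := inferInstanceAs (CompleteSpace (WithLp 2 (ℂ × ℂ)))

/-- The element `z₁ e₁ + z₂ e₂`. -/
def mk (z₁ z₂ : ℂ) : Biharm := WithLp.toLp 2 (z₁, z₂)

/-- The complex coordinate along `e₁`. -/
def c₁ (a : Biharm) : ℂ := (WithLp.ofLp a).1

/-- The complex coordinate along `e₂`. -/
def c₂ (a : Biharm) : ℂ := (WithLp.ofLp a).2

@[simp] theorem c₁_mk (z w : ℂ) : (mk z w).c₁ = z := rfl
@[simp] theorem c₂_mk (z w : ℂ) : (mk z w).c₂ = w := rfl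
@[simp] theorem c₁_add (a b : Biharm) : (a + b).c₁ = a.c₁ + b.c₁ := rfl
@[simp] theorem c₂_add (a b : Biharm) : (a + b).c₂ = a.c₂ + b.c₂ := rfl
@[simp] theorem c₁_zero : (0 : Biharm).c₁ = 0 := rfl
@[simp] theorem c₂_zero : (0 : Biharm).c₂ = 0 := rfl
@[simp] theorem c₁_smul (z : ℂ) (a : Biharm) : (z • a).c₁ = z * a.c₁ := rfl
@[simp] theorem c₂_smul (z : ℂ) (a : Biharm) : (z • a).c₂ = z * a.c₂ := rfl

theorem ext {a b : Biharm} (h₁ : a.c₁ = b.c₁) (h₂ : a.c₂ = b.c₂) : a = b :=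
  WithLp.ofLp_injective 2 (Prod.ext h₁ h₂)

theorem norm_eq (a : Biharm) : ‖a‖ = Real.sqrt (‖a.c₁‖ ^ 2 + ‖a.c₂‖ ^ 2) :=
  WithLp.prod_norm_eq_of_L2 (α := ℂ) (β := ℂ) a

/-- `e₁`, the unit of the algebra. -/
def e₁ : Biharm := mk 1 0

/-- `e₂`. -/
def e₂ : Biharm := mk 0 1

instance : One Biharm := ⟨e₁⟩

/-- The product given by `e₁² = e₁`, `e₂ e₁ = e₁ e₂ = e₂`, `e₂² = e₁ + 2 i e₂`. -/
instance : Mul Biharm :=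
  ⟨fun a b => mk (a.c₁ * b.c₁ + a.c₂ * b.c₂)
    (a.c₁ * b.c₂ + a.c₂ * b.c₁ + 2 * Complex.I * (a.c₂ * b.c₂))⟩

@[simp] theorem c₁_one : (1 : Biharm).c₁ = 1 := rfl
@[simp] theorem c₂_one : (1 : Biharm).c₂ = 0 := rfl
@[simp] theorem c₁_mul (a b : Biharm) : (a * b).c₁ = a.c₁ * b.c₁ + a.c₂ * b.c₂ := rfl
@[simp] theorem c₂_mul (a b : Biharm) :
    (a * b).c₂ = a.c₁ * b.c₂ + a.c₂ * b.c₁ + 2 * Complex.I * (a.c₂ * b.c₂) := rfl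

instance : CommRing Biharm :=
  { (inferInstance : AddCommGroup Biharm) with
    mul := (· * ·)
    one := 1
    left_distrib := fun a b c => by apply ext <;> simp <;> ring
    right_distrib := fun a b c => by apply ext <;> simp <;> ring
    zero_mul := fun a => by apply ext <;> simp
    mul_zero := fun a => by apply ext <;> simp
    mul_assoc := fun a b c => by apply ext <;> simp <;> ring
    one_mul := fun a => by apply ext <;> simp
    mul_one := fun a => by apply ext <;> simp
    mul_comm := fun a b => by apply ext <;> simp <;> ring }

instance : Algebra ℂ Biharm :=
  Algebra.ofModule (fun z a b => by apply ext <;> simp <;> ring)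
    (fun z a b => by apply ext <;> simp <;> ring)

theorem e₂_mul_e₂ : e₂ * e₂ = e₁ + (2 * Complex.I) • e₂ := by
  apply ext <;> simp [e₁, e₂]

theorem basis_sq : (e₁ ^ 2 + e₂ ^ 2) ^ 2 = 0 := by
  apply ext <;> simp [e₁, e₂, pow_two] <;> ring_nf <;> simp

theorem basis_ne : e₁ ^ 2 + e₂ ^ 2 ≠ 0 := by
  intro h
  have h2 := congrArg c₁ h
  simp [e₁, e₂, pow_two] at h2

end Biharm

open Biharm

/-- The point `x e₁ + y e₂` of the biharmonic plane that corresponds to `z = x + i y`. -/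
def emb (z : ℂ) : Biharm := Biharm.mk (z.re : ℂ) (z.im : ℂ)

/-- The biharmonic plane `μ = {x e₁ + y e₂ : x, y ∈ ℝ}`. -/
def biharmonicPlane : Set Biharm := range emb

/-- The real component `U₁` in `Φ = U₁ e₁ + U₂ i e₁ + U₃ e₂ + U₄ i e₂`. -/
def U₁ (a : Biharm) : ℝ := a.c₁.re

/-- The real component `U₃` in `Φ = U₁ e₁ + U₂ i e₁ + U₃ e₂ + U₄ i e₂`. -/
def U₃ (a : Biharm) : ℝ := a.c₂.re

/-- `Φ` is monogenic in `G`: at each `ζ ∈ G` the limit of `(Φ(ζ + h) - Φ(ζ)) h⁻¹` as `h → 0`,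
`h ∈ μ`, exists. (Nonzero elements of `μ` are invertible.) -/
def IsMonogenicOn (Φ : Biharm → Biharm) (G : Set Biharm) : Prop :=
  ∀ ζ ∈ G, ∃ Φ' : Biharm,
    Tendsto (fun h : Biharm => (Φ (ζ + h) - Φ ζ) * Ring.inverse h)
      (𝓝[biharmonicPlane \ {0}] 0) (𝓝 Φ')

/-! ### The domain, its conformal parametrization, and the points `X_j` -/

/-- The unit circle `Γ`. -/
def Γ : Set ℂ := Metric.sphere 0 1

/-- The open unit disk `𝒰`. -/
def 𝒰 : Set ℂ := Metric.ball 0 1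

/-- The closed unit disk. -/
def 𝒰c : Set ℂ := Metric.closedBall 0 1

/-- `σ` maps the unit disk conformally onto `D`, and is extended to a homeomorphism of the closed
disk onto the closure of `D` (the inverse is continuous by compactness). -/
structure IsConformalParam (σ : ℂ → ℂ) (D : Set ℂ) : Prop where
  differentiableOn : DifferentiableOn ℂ σ 𝒰
  image_disk : σ '' 𝒰 = D
  continuousOn : ContinuousOn σ 𝒰c
  injOn : InjOn σ 𝒰c

/-- `D_ζ`. -/
def domZeta (D : Set ℂ) : Set Biharm := emb '' D

/-- The boundary `∂D_ζ`, taken in the biharmonic plane. -/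
def bdryZeta (D : Set ℂ) : Set Biharm := emb '' frontier D

/-- The corner point `ζ_j`, the image of `X_j`. -/
def corner {m : ℕ} (σ : ℂ → ℂ) (X : Fin m → ℂ) (j : Fin m) : Biharm := emb (σ (X j))

/-- `∂D_ζ` without the corner points. -/
def regBdryZeta {m : ℕ} (D : Set ℂ) (σ : ℂ → ℂ) (X : Fin m → ℂ) : Set Biharm :=
  bdryZeta D \ range (corner σ X)

/-- `𝓡₀`: the least distance between distinct points `X_j` if `m > 1`, and `1` if `m = 1`. -/
def R₀ {m : ℕ} (X : Fin m → ℂ) : ℝ :=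
  if 1 < m then ⨅ p : {p : Fin m × Fin m // p.1 ≠ p.2}, ‖X p.1.1 - X p.1.2‖ else 1

/-- `𝓡(Z) = min_j |Z - X_j|`. -/
def R {m : ℕ} (X : Fin m → ℂ) (Z : ℂ) : ℝ := ⨅ j, ‖Z - X j‖

/-- `E_r(T₀) = {T ∈ E : |T - T₀| ≤ r}`. -/
def near (E : Set ℂ) (r : ℝ) (T₀ : ℂ) : Set ℂ := {T ∈ E | ‖T - T₀‖ ≤ r}

/-- `E_r⟨𝒳⟩`, the union of the sets `E_r(X_j)`. -/
def nearAll {m : ℕ} (E : Set ℂ) (r : ℝ) (X : Fin m → ℂ) : Set ℂ := ⋃ j, near E r (X j)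

/-- The contour derivative on `Γ`: the limit of `(f(S) - f(T)) / (S - T)` as `S → T`, `S ∈ Γ`. -/
def contourDeriv (f : ℂ → ℂ) (T : ℂ) : ℂ := derivWithin f Γ T

/-- `σ'` on the closed disk without `𝒳`: the complex derivative inside the disk and the contour
derivative on the circle. (Where the latter is continuous, this is the limit of the difference
quotient taken over the whole closed disk.) -/
def sigmaDeriv (σ : ℂ → ℂ) (Z : ℂ) : ℂ := if ‖Z‖ < 1 then deriv σ Z else contourDeriv σ Z

/-- `σ₂ = Im σ`. -/
def sigma₂ (σ : ℂ → ℂ) (Z : ℂ) : ℂ := ((σ Z).im : ℂ)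

/-- `d(S, Z)`. -/
def d (σ : ℂ → ℂ) (S Z : ℂ) : ℂ := (σ S - σ Z) / (S - Z)

/-- `d₂(S, Z)`. -/
def d₂ (σ : ℂ → ℂ) (S Z : ℂ) : ℂ := (sigma₂ σ S - sigma₂ σ Z) / (S - Z)

/-! ### Conditions a) and b) -/

/-- A positive, nondecreasing, bounded, semiadditive function on `(0, ∞)`. -/
structure IsModulus (ω : ℝ → ℝ) : Prop where
  pos : ∀ η, 0 < η → 0 < ω η
  mono : MonotoneOn ω (Ioi 0)
  bounded : ∃ M, ∀ η, 0 < η → ω η ≤ M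
  semiadd : ∀ η₁ η₂, 0 < η₁ → 0 < η₂ → ω (η₁ + η₂) ≤ ω η₁ + ω η₂

/-- The Dini condition `∫₀² ω(η)/η dη < ∞`. -/
def Dini (ω : ℝ → ℝ) : Prop := IntegrableOn (fun η => ω η / η) (Ioc 0 2)

/-- `∫₀^ε ω(η)/η dη < c ω(ε)` for all `0 < ε < r₀/2`, with `c` independent of `ε`. -/
def StrongDini (r₀ : ℝ) (ω : ℝ → ℝ) : Prop :=
  ∃ c : ℝ, ∀ ε, 0 < ε → ε < r₀ / 2 →
    IntegrableOn (fun η => ω η / η) (Ioc 0 ε) ∧ ∫ η in Ioc 0 ε, ω η / η < c * ω ε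

/-- Condition a): the contour derivative of `σ` exists, is continuous and does not vanish on
`Γ ∖ 𝒳`, and `|σ'(Z)| ≤ c ∏ |Z - X_j|^{β_j}` on the closed disk without `𝒳`. -/
structure ConditionA {m : ℕ} (σ : ℂ → ℂ) (X : Fin m → ℂ) (β : Fin m → ℝ) : Prop where
  exists_deriv : ∀ T ∈ Γ \ range X, DifferentiableWithinAt ℂ σ Γ T
  continuousOn : ContinuousOn (contourDeriv σ) (Γ \ range X)
  ne_zero : ∀ T ∈ Γ \ range X, contourDeriv σ T ≠ 0
  bound : ∃ c : ℝ, ∀ Z ∈ 𝒰c \ range X, ‖sigmaDeriv σ Z‖ ≤ c * ∏ j, ‖Z - X j‖ ^ β j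

/-- `|σ'(Z) - σ'(Z₀)| ≤ c (ω(|Z - Z₀|) / ω(𝓡(Z₀)/2)) ∏ |Z - X_j|^{β_j}` for `Z₀ ∈ A` and
`Z ∈ Γ ∪ [0, Z₀]` with `0 < |Z - Z₀| ≤ 𝓡(Z₀)/2`. -/
def DerivModulusOn {m : ℕ} (σ : ℂ → ℂ) (X : Fin m → ℂ) (β : Fin m → ℝ) (ω : ℝ → ℝ)
    (A : Set ℂ) : Prop :=
  ∃ c : ℝ, ∀ Z₀ ∈ A, ∀ Z ∈ near (Γ ∪ segment ℝ 0 Z₀) (R X Z₀ / 2) Z₀, Z ≠ Z₀ →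
    ‖sigmaDeriv σ Z - sigmaDeriv σ Z₀‖ ≤
      c * (ω ‖Z - Z₀‖ / ω (R X Z₀ / 2)) * ∏ j, ‖Z - X j‖ ^ β j

/-- Condition b). -/
def ConditionB {m : ℕ} (σ : ℂ → ℂ) (X : Fin m → ℂ) (β : Fin m → ℝ) : Prop :=
  ∃ r₀ : ℝ, 0 < r₀ ∧ r₀ < R₀ X / 4 ∧
    (∃ ω₁s : ℝ → ℝ, IsModulus ω₁s ∧ StrongDini r₀ ω₁s ∧
      DerivModulusOn σ X β ω₁s (nearAll Γ r₀ X \ range X)) ∧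
    (∃ ω₁ : ℝ → ℝ, IsModulus ω₁ ∧ Dini ω₁ ∧
      DerivModulusOn σ X β ω₁ (Γ \ nearAll Γ r₀ X)) ∧
    (∀ j, ∃ c : ℝ, 0 < c ∧ ∀ Z ∈ near 𝒰c r₀ (X j) \ range X,
      ∀ S ∈ near Γ (2 * r₀) (X j) \ range X, S ≠ Z →
        c * (‖S - X j‖ + ‖Z - X j‖) ^ β j ≤ ‖d σ S Z‖)

/-! ### The boundary value problem -/

/-- Real functions continuous on `∂D_ζ` without the corner points that satisfy there
`|φ(ζ)| ≤ c ∏ ‖ζ - ζ_j‖^{-α_j}`. -/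
def BoundaryClass {m : ℕ} (D : Set ℂ) (σ : ℂ → ℂ) (X : Fin m → ℂ) (α : Fin m → ℝ)
    (φ : Biharm → ℝ) : Prop :=
  ContinuousOn φ (regBdryZeta D σ X) ∧
    ∃ c : ℝ, ∀ ζ ∈ regBdryZeta D σ X, |φ ζ| ≤ c * ∏ j, ‖ζ - corner σ X j‖ ^ (-α j)

/-- `Φ` solves the piecewise continuous (1-3)-problem with data `u₁`, `u₃` and growth exponents
`α_j` at the corner points. -/
structure IsSolution13 {m : ℕ} (D : Set ℂ) (σ : ℂ → ℂ) (X : Fin m → ℂ) (α : Fin m → ℝ)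
    (u₁ u₃ : Biharm → ℝ) (Φ : Biharm → Biharm) : Prop where
  monogenic : IsMonogenicOn Φ (domZeta D)
  limit₁ : ∀ ζ₀ ∈ regBdryZeta D σ X,
    Tendsto (fun ζ => U₁ (Φ ζ)) (𝓝[domZeta D] ζ₀) (𝓝 (u₁ ζ₀))
  limit₃ : ∀ ζ₀ ∈ regBdryZeta D σ X,
    Tendsto (fun ζ => U₃ (Φ ζ)) (𝓝[domZeta D] ζ₀) (𝓝 (u₃ ζ₀))
  growth₁ : ∀ j, ∃ c : ℝ, ∀ᶠ ζ in 𝓝[domZeta D] (corner σ X j),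
    |U₁ (Φ ζ)| ≤ c * ‖ζ - corner σ X j‖ ^ (-α j)
  growth₃ : ∀ j, ∃ c : ℝ, ∀ᶠ ζ in 𝓝[domZeta D] (corner σ X j),
    |U₃ (Φ ζ)| ≤ c * ‖ζ - corner σ X j‖ ^ (-α j)

/-- The positively oriented parametrization `θ ↦ σ̃(e^{iθ})`, `0 ≤ θ ≤ 2π`, of `∂D_ζ`. -/
def bdryParam (σ : ℂ → ℂ) (θ : ℝ) : Biharm := emb (σ (circleMap 0 1 θ))

/-- The integrand of `∫ φ(τ) (τ - ζ)⁻¹ dτ` over `∂D_ζ`, pulled back by `bdryParam`; here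
`φ = φ₁ e₁ + φ₃ e₂`. -/
def cauchyIntegrand (σ : ℂ → ℂ) (φ₁ φ₃ : Biharm → ℝ) (ζ : Biharm) (θ : ℝ) : Biharm :=
  Biharm.mk (φ₁ (bdryParam σ θ) : ℂ) (φ₃ (bdryParam σ θ) : ℂ) *
    Ring.inverse (bdryParam σ θ - ζ) * deriv (bdryParam σ) θ

/-- The biharmonic Cauchy-type integral `(1/2πi) ∫_{∂D_ζ} φ(τ) (τ - ζ)⁻¹ dτ`. -/
def cauchyIntegral (σ : ℂ → ℂ) (φ₁ φ₃ : Biharm → ℝ) (ζ : Biharm) : Biharm :=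
  (2 * (Real.pi : ℂ) * Complex.I)⁻¹ •
    ∫ θ in (0 : ℝ)..(2 * Real.pi), cauchyIntegrand σ φ₁ φ₃ ζ θ

/-! ### The system of integral equations -/

/-- The function `S ↦ f(σ̃(S))` on the circle. -/
def pull (σ : ℂ → ℂ) (f : Biharm → ℝ) (S : ℂ) : ℝ := f (emb (σ S))

/-- The weighted class `𝒦{γ_j}`. -/
def WeightedClass {m : ℕ} (X : Fin m → ℂ) (γ : Fin m → ℝ) (ψ : ℂ → ℝ) : Prop :=
  (∀ j, γ j < 1) ∧ ContinuousOn ψ (Γ \ range X) ∧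
    ∃ c : ℝ, ∀ S ∈ Γ \ range X, |ψ S| ≤ c * ∏ j, ‖S - X j‖ ^ (-γ j)

/-- `Ω₁^ψ(S, Z) = ψ(S) (σ'(S)/d(S, Z) - 1)`, extended by `0` to `Z = S`. -/
def Ω₁ (σ : ℂ → ℂ) (ψ : ℂ → ℝ) (S Z : ℂ) : ℂ :=
  if S = Z then 0 else (ψ S : ℂ) * (contourDeriv σ S / d σ S Z - 1)

/-- `Ω₂^ψ(S, Z) = (ψ(S)/2) (σ'(S) d₂(S, Z)/d(S, Z)² - σ₂'(S)/d(S, Z))`, extended by `0` to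
`Z = S`. -/
def Ω₂ (σ : ℂ → ℂ) (ψ : ℂ → ℝ) (S Z : ℂ) : ℂ :=
  if S = Z then 0 else
    (ψ S : ℂ) / 2 * (contourDeriv σ S * d₂ σ S Z / d σ S Z ^ 2 -
      contourDeriv (sigma₂ σ) S / d σ S Z)

/-- For `T ∈ Γ`, the singular integral `𝓘[Ω](T) = (1/2πi) ∫_Γ Ω(S, T)/(S - T) dS` exists as a
Cauchy principal value and equals `A`. -/
def HasSingularIntegral (Ω : ℂ → ℂ → ℂ) (T A : ℂ) : Prop :=
  (∀ δ : ℝ, 0 < δ →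
    CircleIntegrable (fun S => if δ < ‖S - T‖ then Ω S T / (S - T) else 0) 0 1) ∧
  Tendsto (fun δ : ℝ => (2 * (Real.pi : ℂ) * Complex.I)⁻¹ *
      ∮ S in C(0, 1), (if δ < ‖S - T‖ then Ω S T / (S - T) else 0))
    (𝓝[>] 0) (𝓝 A)

/-- `C_ψ = (1/4πi) ∫_Γ ψ(S)/S dS`. -/
def constC (ψ : ℂ → ℝ) : ℂ :=
  (4 * (Real.pi : ℂ) * Complex.I)⁻¹ * ∮ S in C(0, 1), (ψ S : ℂ) / S

/-- The system of two integral equations on `Γ ∖ 𝒳` for `ψ₁`, `ψ₃` with right-hand sides `v₁`,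
`v₃`; the existence of the singular integrals is part of it. -/
def SolvesSystem {m : ℕ} (σ : ℂ → ℂ) (X : Fin m → ℂ) (v₁ v₃ ψ₁ ψ₃ : ℂ → ℝ) : Prop :=
  ∀ Z₀ ∈ Γ \ range X, ∃ A₁ A₃ B₁ B₃ : ℂ,
    HasSingularIntegral (Ω₁ σ ψ₁) Z₀ A₁ ∧ HasSingularIntegral (Ω₁ σ ψ₃) Z₀ A₃ ∧
    HasSingularIntegral (Ω₂ σ ψ₁) Z₀ B₁ ∧ HasSingularIntegral (Ω₂ σ ψ₃) Z₀ B₃ ∧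
    ((1 / 2 * ψ₁ Z₀ + A₁.re - 2 * B₁.im - 2 * B₃.re : ℝ) : ℂ) + constC ψ₁ = (v₁ Z₀ : ℂ) ∧
    ((1 / 2 * ψ₃ Z₀ + A₃.re + 2 * B₃.im - 2 * B₁.re : ℝ) : ℂ) + constC ψ₃ = (v₃ Z₀ : ℂ)

end BiharmonicSchwarz

end

open BiharmonicSchwarz

noncomputable section

namespace BiharmonicSchwarz

/-! ### Integrals over the unit circle -/

/-! A Cauchy-type integral with admissible densities is always monogenic, always has the required
growth, and `U₁`, `U₃` of it always have limits at the regular boundary points. The left-hand sides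
of the system are these limits. So the boundary condition and the system say the same thing, and the
work lies in the existence and form of the limits and in the growth.

Algebra. The element `n = e₂ - i e₁` satisfies `n² = 0`, and the point of the plane attached to `w`
is `w + (Im w) n`. Its inverse is therefore explicit (`emb_mul_eq_one`). Pulled back to the circle,
each coordinate of the Cauchy integrand becomes a combination of three scalar kernels
(`mk_mul_inverse_mul_emb`): the Cauchy kernel of the disk, `ker₁`, and `ker₂`. On the circle the
last two are `Ω₁/(S - Z)` and `Ω₂/(S - Z)` without the density.

Limits. The real part of the Cauchy kernel is half of one plus the Poisson kernel, which yields
`ψ/2` and the constant `C_ψ`. The kernel `ker₁` is weakly singular: `σ'(S)` and the divided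
difference of `σ` differ by a multiple of the modulus `ω`, so the kernel is controlled by `ω(s)/s`,
which is integrable by the Dini condition. The kernel `ker₂` is not controlled in this way inside
the disk. It contains a bounded multiple of `poissonPhase`, a kernel with the modulus of the Poisson
kernel and zero mean (`ker₂_sub_identity`, `integral_poissonPhase`). Against a continuous density
that part tends to zero, and the remainder `ker₂'` is again weakly singular. The estimates shared by
`ker₁` and `ker₂'` are collected in `IsKernel`, and `IsKernel.tendsto_kerIntegral` gives continuity
up to the circle. There the integrals converge absolutely, so the principal values are ordinary
integrals.

Growth. Near `X_j` the distance `|S - Z|` is comparable with `|S - X_j| + |Z - X_j|`, except on an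
arc around the radial projection of `Z`. Off the arc the kernels are bounded by powers. On it the
density is `O(|Z - X_j|^{-γ_j})` and the kernel has bounded integral by the strong Dini condition
(`IsKernel.exists_lintegral_arc_le`). `Setup.exists_lintegral_growth` combines these; it also covers
the Poisson kernel, whose total mass is bounded. Finally `|σ(Z) - σ(X_j)|` is comparable with `|Z -
X_j|^{β_j + 1}` on the circle, and bounded by it in the disk, which converts exponents `γ_j` into
`α_j`. -/

theorem norm_circleMap_one (θ : ℝ) : ‖circleMap 0 1 θ‖ = 1 := by
  simp [circleMap]

theorem circleMap_mem_Γ (θ : ℝ) : circleMap 0 1 θ ∈ Γ := by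
  simp [Γ, circleMap]

theorem exists_circleMap_eq {T : ℂ} (hT : ‖T‖ = 1) : ∃ t : ℝ, circleMap 0 1 t = T :=
  ⟨T.arg, by simpa [circleMap, hT] using Complex.norm_mul_exp_arg_mul_I T⟩

/-- Any interval of length `2π` is a fundamental domain for the period of `circleMap`, so the
singular point `T` can be moved to angle zero, in the middle of the interval. -/
theorem lintegral_circle_rotate {T : ℂ} (hT : ‖T‖ = 1) (f : ℂ → ENNReal) :
    ∫⁻ θ in Ioc 0 (2 * Real.pi), f (circleMap 0 1 θ) =
      ∫⁻ θ in Ioc (-Real.pi) Real.pi, f (T * circleMap 0 1 θ) := by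
  obtain ⟨t, rfl⟩ := exists_circleMap_eq hT
  have h1 : ∀ θ, circleMap 0 1 t * circleMap 0 1 θ = circleMap 0 1 (t + θ) := by
    intro θ; simp [circleMap, ← Complex.exp_add]; ring_nf
  simp only [h1]
  have h2 := (measurePreserving_add_left volume t).setLIntegral_comp_preimage_emb
    (MeasurableEquiv.addLeft t).measurableEmbedding (fun θ => f (circleMap 0 1 θ))
    (Ioc (t - Real.pi) (t + Real.pi))
  have h3 : (fun x => t + x) ⁻¹' Ioc (t - Real.pi) (t + Real.pi) = Ioc (-Real.pi) Real.pi := by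
    ext x; simp only [mem_preimage, mem_Ioc]; constructor <;> rintro ⟨a, b⟩ <;> constructor <;> linarith
  rw [h3] at h2
  rw [h2]
  have h4 := isAddFundamentalDomain_Ioc Real.two_pi_pos 0 volume
  have h5 := isAddFundamentalDomain_Ioc Real.two_pi_pos (t - Real.pi) volume
  rw [zero_add] at h4
  rw [show t - Real.pi + 2 * Real.pi = t + Real.pi by ring] at h5
  refine h4.setLIntegral_eq h5 _ ?_
  rintro ⟨g, hg⟩ x
  obtain ⟨n, rfl⟩ := AddSubgroup.mem_zmultiples_iff.1 hg
  have := (periodic_circleMap 0 1).zsmul n x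
  simp only [AddSubgroup.mk_vadd, vadd_eq_add]
  rw [add_comm, this]

theorem norm_mul_circleMap_sub {T : ℂ} (hT : ‖T‖ = 1) (θ : ℝ) :
    ‖T * circleMap 0 1 θ - T‖ = 2 * |Real.sin (θ / 2)| := by
  have h : T * circleMap 0 1 θ - T = T * (Complex.exp (Complex.I * θ) - 1) := by
    simp [circleMap]; ring_nf
  rw [h, norm_mul, hT, one_mul, Complex.norm_exp_I_mul_ofReal_sub_one, norm_mul]
  simp

/-- Jordan's inequality for the half angle: chords are comparable with arcs. -/
theorem two_div_pi_mul_abs_le {T : ℂ} (hT : ‖T‖ = 1) {θ : ℝ} (hθ : |θ| ≤ Real.pi) :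
    2 / Real.pi * |θ| ≤ ‖T * circleMap 0 1 θ - T‖ := by
  rw [norm_mul_circleMap_sub hT]
  have := Real.mul_abs_le_abs_sin (x := θ / 2) (by rw [abs_div, abs_two]; linarith)
  rw [abs_div, abs_two] at this
  linarith

/-- Integrals over arcs of an almost decreasing function of the distance to `T`. -/
theorem lintegral_circle_le {g : ℝ → ENNReal} {C : ENNReal} (hC : C ≠ ⊤)
    (hg : ∀ a b, 0 < a → a ≤ b → g b ≤ C * g a) {T : ℂ} (hT : ‖T‖ = 1) (δ : ℝ) :
    ∫⁻ θ in Ioc 0 (2 * Real.pi),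
        indicator {S : ℂ | ‖S - T‖ ≤ δ} (fun S => g ‖S - T‖) (circleMap 0 1 θ) ≤
      C * ENNReal.ofReal Real.pi * ∫⁻ η in Ioc 0 δ, g η := by
  have hpi := Real.pi_pos
  rw [lintegral_circle_rotate hT]
  set h : ℝ → ENNReal := indicator (Ioc 0 δ) g with hh
  -- The chord is at least `2|θ|/π`, so almost monotonicity trades `g` of the chord for `g` of a
  -- linear function of `θ`.
  have key : ∀ θ : ℝ, θ ≠ 0 → |θ| ≤ Real.pi →
      indicator {S : ℂ | ‖S - T‖ ≤ δ} (fun S => g ‖S - T‖) (T * circleMap 0 1 θ) ≤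
        C * h (2 / Real.pi * |θ|) := by
    intro θ hθ0 hθ
    have h1 := two_div_pi_mul_abs_le hT hθ
    have h2 : 0 < 2 / Real.pi * |θ| := by positivity
    by_cases hd : ‖T * circleMap 0 1 θ - T‖ ≤ δ
    · rw [indicator_of_mem (by exact hd), hh, indicator_of_mem (by exact ⟨h2, h1.trans hd⟩)]
      exact hg _ _ h2 h1
    · rw [indicator_of_notMem (by exact hd)]; exact zero_le
  have hscale : ∀ a : ℝ, a ≠ 0 → ∫⁻ θ, h (a * θ) = ENNReal.ofReal |a⁻¹| * ∫⁻ η, h η := by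
    intro a ha
    have := lintegral_map_equiv (μ := volume) h (Homeomorph.mulLeft₀ a ha).toMeasurableEquiv
    simp only [Homeomorph.toMeasurableEquiv_coe, Homeomorph.coe_mulLeft₀] at this
    rw [← this, Real.map_volume_mul_left ha, lintegral_smul_measure, smul_eq_mul]
  have hint : ∫⁻ η, h η = ∫⁻ η in Ioc 0 δ, g η := lintegral_indicator measurableSet_Ioc _
  have hsub : Ioc (-Real.pi) Real.pi ⊆ (Ioo (-Real.pi) 0 ∪ {0}) ∪ Ioc 0 Real.pi := by
    intro x hx
    rcases lt_trichotomy x 0 with h0 | h0 | h0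
    · exact Or.inl (Or.inl ⟨hx.1, h0⟩)
    · exact Or.inl (Or.inr h0)
    · exact Or.inr ⟨h0, hx.2⟩
  have hpos : ∫⁻ θ in Ioc 0 Real.pi,
      indicator {S : ℂ | ‖S - T‖ ≤ δ} (fun S => g ‖S - T‖) (T * circleMap 0 1 θ) ≤
      ∫⁻ θ, C * h (2 / Real.pi * θ) := by
    refine (setLIntegral_mono' measurableSet_Ioc fun θ hθ => ?_).trans (setLIntegral_le_lintegral _ _)
    have := key θ hθ.1.ne' (by rw [abs_of_pos hθ.1]; exact hθ.2)
    rwa [abs_of_pos hθ.1] at this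
  have hneg : ∫⁻ θ in Ioo (-Real.pi) 0,
      indicator {S : ℂ | ‖S - T‖ ≤ δ} (fun S => g ‖S - T‖) (T * circleMap 0 1 θ) ≤
      ∫⁻ θ, C * h (-(2 / Real.pi) * θ) := by
    refine (setLIntegral_mono' measurableSet_Ioo fun θ hθ => ?_).trans (setLIntegral_le_lintegral _ _)
    have := key θ hθ.2.ne (by rw [abs_of_neg hθ.2]; linarith [hθ.1])
    rw [abs_of_neg hθ.2] at this
    convert this using 3; ring
  -- Rescaling costs `π/2` on each half circle, hence the factor `π` in total.
  have e1 : ∀ a : ℝ, |a| = 2 / Real.pi →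
      ∫⁻ θ, C * h (a * θ) = C * (ENNReal.ofReal (Real.pi / 2) * ∫⁻ η, h η) := by
    intro a ha
    have ha0 : a ≠ 0 := abs_pos.1 (ha ▸ by positivity)
    rw [lintegral_const_mul' _ _ hC, hscale _ ha0, abs_inv, ha, inv_div]
  rw [e1 _ (abs_of_pos (by positivity))] at hpos
  rw [e1 _ (by rw [abs_neg, abs_of_pos (by positivity)])] at hneg
  refine (lintegral_mono_set hsub).trans ((lintegral_union_le _ _ _).trans ?_)
  refine (add_le_add ((lintegral_union_le _ _ _).trans (add_le_add hneg le_rfl)) hpos).trans ?_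
  rw [setLIntegral_measure_zero _ _ (by simp), add_zero, ← two_mul, hint]
  have : ENNReal.ofReal Real.pi = 2 * ENNReal.ofReal (Real.pi / 2) := by
    rw [← ENNReal.ofReal_ofNat, ← ENNReal.ofReal_mul (by norm_num)]; congr 1; ring
  rw [this]
  apply le_of_eq; ring

/-! ### Moduli and powers -/

/-- Semiadditivity gives `ω(na) ≤ n ω(a)`; take `n = ⌊b/a⌋ + 1`, which is at most `2b/a`. This makes
`ω(η)/η` almost decreasing, as `lintegral_circle_le` requires. -/
theorem IsModulus.div_le {ω : ℝ → ℝ} (h : IsModulus ω) {a b : ℝ} (ha : 0 < a) (hab : a ≤ b) :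
    ω b / b ≤ 2 * (ω a / a) := by
  have hb : 0 < b := ha.trans_le hab
  have key : ∀ n : ℕ, ω ((n + 1 : ℕ) * a) ≤ (n + 1 : ℕ) * ω a := by
    intro n
    induction n with
    | zero => simp
    | succ n ih =>
      have := h.semiadd ((n + 1 : ℕ) * a) a (by positivity) ha
      push_cast at *
      calc ω ((n + 1 + 1) * a) = ω ((n + 1) * a + a) := by ring_nf
        _ ≤ _ := this
        _ ≤ (n + 1 + 1) * ω a := by linarith
  have h1 := Nat.lt_floor_add_one (b / a)
  have h2 := Nat.floor_le (a := b / a) (by positivity)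
  have h3 : 1 ≤ b / a := (one_le_div ha).2 hab
  have h4 : b ≤ ((⌊b / a⌋₊ + 1 : ℕ) : ℝ) * a := by
    push_cast; exact ((div_lt_iff₀ ha).1 h1).le
  have h5 : ω b ≤ ω (((⌊b / a⌋₊ + 1 : ℕ) : ℝ) * a) := h.mono hb (hb.trans_le h4) h4
  have h6 : ω b ≤ 2 * (b / a) * ω a := by
    refine h5.trans ((key _).trans ?_)
    gcongr
    · exact (h.pos a ha).le
    · push_cast; linarith
  rw [div_le_iff₀ hb]
  calc ω b ≤ _ := h6
    _ = _ := by ring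

theorem IsModulus.le_two_mul {ω : ℝ → ℝ} (h : IsModulus ω) {a : ℝ} (ha : 0 < a) :
    ω (2 * a) ≤ 2 * ω a := by
  have := h.semiadd a a ha ha
  rw [two_mul, two_mul]; exact this

theorem IsModulus.add {ω ω' : ℝ → ℝ} (h : IsModulus ω) (h' : IsModulus ω') :
    IsModulus (fun η => ω η + ω' η) where
  pos η hη := add_pos (h.pos η hη) (h'.pos η hη)
  mono := h.mono.add h'.mono
  bounded := by
    obtain ⟨M, hM⟩ := h.bounded
    obtain ⟨M', hM'⟩ := h'.bounded
    exact ⟨M + M', fun η hη => add_le_add (hM η hη) (hM' η hη)⟩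
  semiadd a b ha hb := by linarith [h.semiadd a b ha hb, h'.semiadd a b ha hb]

/-- The sum of the endpoint values serves both signs of the exponent, as the `β_j` may have either
sign. -/
theorem rpow_le_add_of_mem_Icc {a b t : ℝ} (ha : 0 < a) (h1 : a ≤ t) (h2 : t ≤ b) (e : ℝ) :
    t ^ e ≤ a ^ e + b ^ e := by
  have ht := ha.trans_le h1
  rcases le_total 0 e with he | he
  · linarith [Real.rpow_le_rpow ht.le h2 he, Real.rpow_nonneg ha.le e]
  · linarith [Real.rpow_le_rpow_of_nonpos ha h1 he, Real.rpow_nonneg (ht.le.trans h2) e]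

theorem rpow_le_mul_rpow {s t K : ℝ} (hs : 0 < s) (hK : 0 < K) (h1 : t ≤ K * s) (h2 : s ≤ K * t)
    (e : ℝ) : t ^ e ≤ ((K⁻¹) ^ e + K ^ e) * s ^ e := by
  have ht : 0 < t := pos_of_mul_pos_right (hs.trans_le h2) hK.le
  have : t = t / s * s := by field_simp
  rw [this, Real.mul_rpow (by positivity) hs.le]
  gcongr
  refine rpow_le_add_of_mem_Icc (by positivity) ?_ ?_ e
  · rw [le_div_iff₀ hs, inv_mul_le_iff₀ hK]; exact h2
  · rw [div_le_iff₀ hs]; exact h1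

/-- The exponent of `η + ρ` is negative, so `η + ρ` may be replaced by `ρ` below `ρ` and by `η`
above it. The two elementary integrals converge because `p < 1` and `q > 0`, and both scale as
`ρ^{-q}`. -/
theorem lintegral_rpow_mul_add_rpow_le {p q ρ : ℝ} (hp : p < 1) (hq : 0 < q)
    (hρ : 0 < ρ) :
    ∫⁻ η in Ioi 0, ENNReal.ofReal (η ^ (-p) * (η + ρ) ^ (p - q - 1)) ≤
      ENNReal.ofReal ((1 / (1 - p) + 1 / q) * ρ ^ (-q)) := by
  have hsub : Ioi (0 : ℝ) ⊆ Ioc 0 ρ ∪ Ioi ρ := fun x hx => by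
    rcases le_or_gt x ρ with h | h
    · exact Or.inl ⟨hx, h⟩
    · exact Or.inr h
  refine (lintegral_mono_set hsub).trans ((lintegral_union_le _ _ _).trans ?_)
  rw [add_mul, ENNReal.ofReal_add (mul_nonneg (by rw [one_div_nonneg]; linarith) (by positivity))
    (by positivity)]
  refine add_le_add ?_ ?_
  · have hi : IntegrableOn (fun η : ℝ => η ^ (-p) * ρ ^ (p - q - 1)) (Ioc 0 ρ) := by
      refine Integrable.mul_const ?_ _
      have := intervalIntegral.intervalIntegrable_rpow' (a := 0) (b := ρ) (r := -p) (by linarith)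
      exact (intervalIntegrable_iff_integrableOn_Ioc_of_le hρ.le).1 this
    calc _ ≤ ∫⁻ η in Ioc 0 ρ, ENNReal.ofReal (η ^ (-p) * ρ ^ (p - q - 1)) := by
          refine setLIntegral_mono' measurableSet_Ioc fun η hη => ENNReal.ofReal_le_ofReal ?_
          have : 0 ≤ η ^ (-p) := Real.rpow_nonneg hη.1.le _
          refine mul_le_mul_of_nonneg_left ?_ this
          exact Real.rpow_le_rpow_of_nonpos hρ (by linarith [hη.1]) (by linarith)
      _ = ENNReal.ofReal (∫ η in Ioc 0 ρ, η ^ (-p) * ρ ^ (p - q - 1)) := by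
          rw [ofReal_integral_eq_lintegral_ofReal hi]
          refine (ae_restrict_mem measurableSet_Ioc).mono fun η hη => ?_
          have : 0 ≤ η ^ (-p) := Real.rpow_nonneg hη.1.le _
          positivity
      _ = _ := by
          congr 1
          rw [integral_mul_const, ← intervalIntegral.integral_of_le hρ.le,
            integral_rpow (Or.inl (by linarith)), Real.zero_rpow (by linarith), sub_zero,
            div_mul_eq_mul_div, ← Real.rpow_add hρ]
          rw [show -p + 1 + (p - q - 1) = -q by ring, show -p + 1 = 1 - p by ring]
          ring
  · have hi : IntegrableOn (fun η : ℝ => η ^ (-q - 1)) (Ioi ρ) :=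
      integrableOn_Ioi_rpow_of_lt (by linarith) hρ
    calc _ ≤ ∫⁻ η in Ioi ρ, ENNReal.ofReal (η ^ (-q - 1)) := by
          refine setLIntegral_mono' measurableSet_Ioi fun η hη => ENNReal.ofReal_le_ofReal ?_
          have h0 : 0 < η := hρ.trans hη
          have : 0 ≤ η ^ (-p) := Real.rpow_nonneg h0.le _
          calc η ^ (-p) * (η + ρ) ^ (p - q - 1) ≤ η ^ (-p) * η ^ (p - q - 1) := by
                refine mul_le_mul_of_nonneg_left ?_ this
                exact Real.rpow_le_rpow_of_nonpos h0 (by linarith) (by linarith)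
            _ = _ := by rw [← Real.rpow_add h0]; congr 1; ring
      _ = ENNReal.ofReal (∫ η in Ioi ρ, η ^ (-q - 1)) := by
          rw [ofReal_integral_eq_lintegral_ofReal hi]
          refine (ae_restrict_mem measurableSet_Ioi).mono fun η hη => ?_
          exact Real.rpow_nonneg (hρ.trans hη).le _
      _ = _ := by
          congr 1
          rw [integral_Ioi_rpow_of_lt (by linarith) hρ, show -q - 1 + 1 = -q by ring]
          ring

theorem norm_circleMap_sub_le {T : ℂ} (hT : ‖T‖ ≤ 1) (θ : ℝ) : ‖circleMap 0 1 θ - T‖ ≤ 2 := by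
  have := norm_sub_le (circleMap 0 1 θ) T
  rw [norm_circleMap_one] at this
  linarith

theorem lintegral_circle_rpow_mul_add_rpow_le {p q ρ : ℝ} (hp0 : 0 ≤ p) (hp : p < 1) (hq : 0 < q)
    (hρ : 0 < ρ) {T : ℂ} (hT : ‖T‖ = 1) :
    ∫⁻ θ in Ioc 0 (2 * Real.pi), ENNReal.ofReal
        (‖circleMap 0 1 θ - T‖ ^ (-p) * (‖circleMap 0 1 θ - T‖ + ρ) ^ (p - q - 1)) ≤
      ENNReal.ofReal (Real.pi * (1 / (1 - p) + 1 / q) * ρ ^ (-q)) := by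
  have h := lintegral_circle_le (C := 1) (by simp)
    (g := fun η => ENNReal.ofReal (η ^ (-p) * (η + ρ) ^ (p - q - 1))) (fun a b ha hab => by
      rw [one_mul]
      refine ENNReal.ofReal_le_ofReal ?_
      have hb := ha.trans_le hab
      exact mul_le_mul (Real.rpow_le_rpow_of_nonpos ha hab (by linarith))
        (Real.rpow_le_rpow_of_nonpos (by linarith) (by linarith) (by linarith))
        (by positivity) (by positivity)) hT 2
  simp only [indicator, mem_ofPred_eq, norm_circleMap_sub_le hT.le, if_true, one_mul] at h
  refine h.trans ?_
  rw [mul_assoc, ENNReal.ofReal_mul Real.pi_pos.le]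
  gcongr
  exact (lintegral_mono_set Ioc_subset_Ioi_self).trans
    (lintegral_rpow_mul_add_rpow_le hp hq hρ)

theorem lintegral_circle_rpow_lt_top {e : ℝ} (he : -1 < e) {T : ℂ} (hT : ‖T‖ = 1) :
    ∫⁻ θ in Ioc 0 (2 * Real.pi), ENNReal.ofReal (‖circleMap 0 1 θ - T‖ ^ e) < ⊤ := by
  rcases le_total 0 e with h0 | h0
  · refine (lintegral_mono (g := fun _ => ENNReal.ofReal (2 ^ e)) fun θ => ?_).trans_lt ?_
    · exact ENNReal.ofReal_le_ofReal
        (Real.rpow_le_rpow (norm_nonneg _) (norm_circleMap_sub_le hT.le θ) h0)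
    · rw [lintegral_const]
      exact ENNReal.mul_lt_top ENNReal.ofReal_lt_top (by rw [Measure.restrict_apply_univ]; exact measure_Ioc_lt_top)
  · have h := lintegral_circle_le (C := 1) (by simp)
      (g := fun η => ENNReal.ofReal (η ^ e)) (fun a b ha hab => by
        rw [one_mul]
        exact ENNReal.ofReal_le_ofReal (Real.rpow_le_rpow_of_nonpos ha hab h0)) hT 2
    simp only [indicator, mem_ofPred_eq, norm_circleMap_sub_le hT.le, if_true, one_mul] at h
    refine h.trans_lt (ENNReal.mul_lt_top (by simp) ?_)
    have := intervalIntegral.intervalIntegrable_rpow' (a := 0) (b := 2) (r := e) he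
    rw [intervalIntegrable_iff_integrableOn_Ioc_of_le (by norm_num)] at this
    exact Integrable.lintegral_lt_top this

/-! ### Products of powers of the distances to the points `X_j` -/

section Products

variable {m : ℕ} {X : Fin m → ℂ}

theorem Γ_subset : Γ ⊆ 𝒰c := Metric.sphere_subset_closedBall

theorem 𝒰_subset : 𝒰 ⊆ 𝒰c := Metric.ball_subset_closedBall

theorem mem_Γ {z : ℂ} : z ∈ Γ ↔ ‖z‖ = 1 := by simp [Γ]

theorem mem_𝒰 {z : ℂ} : z ∈ 𝒰 ↔ ‖z‖ < 1 := by simp [𝒰]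

theorem mem_𝒰c {z : ℂ} : z ∈ 𝒰c ↔ ‖z‖ ≤ 1 := by simp [𝒰c]

theorem R_le (Z : ℂ) (j : Fin m) : R X Z ≤ ‖Z - X j‖ :=
  ciInf_le (Set.finite_range _).bddBelow j

theorem exists_R_eq (hm : 0 < m) (Z : ℂ) : ∃ j, R X Z = ‖Z - X j‖ := by
  have : Nonempty (Fin m) := ⟨⟨0, hm⟩⟩
  obtain ⟨j, hj⟩ := exists_eq_ciInf_of_finite (f := fun j => ‖Z - X j‖)
  exact ⟨j, hj.symm⟩

theorem R_pos (hm : 0 < m) {Z : ℂ} (hZ : Z ∉ range X) : 0 < R X Z := by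
  obtain ⟨j, hj⟩ := exists_R_eq (X := X) hm Z
  rw [hj, norm_pos_iff, sub_ne_zero]
  rintro rfl
  exact hZ ⟨j, rfl⟩

theorem R₀_le {j k : Fin m} (h : j ≠ k) : R₀ X ≤ ‖X j - X k‖ := by
  have hm : 1 < m := by
    by_contra hm
    exact h (Fin.ext (by omega))
  rw [R₀, if_pos hm]
  exact ciInf_le (f := fun p : {p : Fin m × Fin m // p.1 ≠ p.2} => ‖X p.1.1 - X p.1.2‖)
    (Set.finite_range _).bddBelow ⟨(j, k), h⟩

/-- Near `X_j` a product of powers is controlled by its `j`-th factor. -/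
theorem exists_prod_rpow_le (hX : ∀ j, X j ∈ Γ) (e : Fin m → ℝ) {c : ℝ} (hc : 0 < c) (j : Fin m) :
    ∃ C, 0 < C ∧ ∀ S ∈ 𝒰c, (∀ k, k ≠ j → c ≤ ‖S - X k‖) →
      ∏ k, ‖S - X k‖ ^ e k ≤ C * ‖S - X j‖ ^ e j := by
  refine ⟨∏ k ∈ Finset.univ.erase j, (c ^ e k + 2 ^ e k), ?_, fun S hS h => ?_⟩
  · exact Finset.prod_pos fun k _ => by positivity
  · rw [← Finset.mul_prod_erase _ _ (Finset.mem_univ j), mul_comm]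
    refine mul_le_mul_of_nonneg_right (Finset.prod_le_prod (fun k _ => by positivity)
      fun k hk => ?_) (by positivity)
    refine rpow_le_add_of_mem_Icc hc (h k (Finset.ne_of_mem_erase hk)) ?_ _
    have := norm_sub_le S (X k)
    rw [mem_Γ.1 (hX k)] at this
    linarith [mem_𝒰c.1 hS]

theorem exists_pos_le_norm_sub (hXinj : Function.Injective X) :
    ∃ c, 0 < c ∧ ∀ j k, j ≠ k → c ≤ ‖X j - X k‖ := by
  have : ∀ p : Fin m × Fin m, ∃ c, 0 < c ∧ (p.1 ≠ p.2 → c ≤ ‖X p.1 - X p.2‖) := by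
    intro p
    by_cases h : p.1 = p.2
    · exact ⟨1, one_pos, fun h' => (h' h).elim⟩
    · exact ⟨_, norm_pos_iff.2 (sub_ne_zero.2 fun h' => h (hXinj h')), fun _ => le_rfl⟩
  choose c hc hc' using this
  by_cases hm : Nonempty (Fin m)
  · obtain ⟨p, hp⟩ := exists_eq_ciInf_of_finite (f := c)
    exact ⟨c p, hc p, fun j k h =>
      (hp.trans_le (ciInf_le (Set.finite_range _).bddBelow (j, k))).trans (hc' (j, k) h)⟩
  · exact ⟨1, one_pos, fun j => (hm ⟨j⟩).elim⟩

/-- If `X_j` is the nearest of the points to `S`, the others stay at least half the minimal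
separation away, so only the `j`-th factor matters. The sum removes the dependence on which point is
nearest. -/
theorem exists_prod_rpow_le_sum (hm : 0 < m) (hX : ∀ j, X j ∈ Γ) (hXinj : Function.Injective X)
    (e : Fin m → ℝ) : ∃ C, 0 < C ∧ ∀ S ∈ 𝒰c,
      ∏ k, ‖S - X k‖ ^ e k ≤ ∑ k, C * ‖S - X k‖ ^ e k := by
  obtain ⟨c, hc, hcX⟩ := exists_pos_le_norm_sub hXinj
  choose C hC hCX using exists_prod_rpow_le hX e (half_pos hc)
  refine ⟨∑ j, C j, Finset.sum_pos (fun j _ => hC j) ⟨⟨0, hm⟩, Finset.mem_univ _⟩,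
    fun S hS => ?_⟩
  obtain ⟨j, hj⟩ := exists_R_eq (X := X) hm S
  have h1 := hCX j S hS fun k hk => by
    have h2 := hcX k j hk
    have h3 := R_le (X := X) S k
    have h4 := norm_sub_le (S - X j) (S - X k)
    rw [show S - X j - (S - X k) = X k - X j by ring] at h4
    linarith
  refine h1.trans ?_
  have h5 : C j ≤ ∑ j, C j := Finset.single_le_sum (fun k _ => (hC k).le) (Finset.mem_univ j)
  refine (mul_le_mul_of_nonneg_right h5 (by positivity)).trans ?_
  exact Finset.single_le_sum (f := fun k => (∑ j, C j) * ‖S - X k‖ ^ e k)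
    (fun k _ => mul_nonneg (Finset.sum_nonneg fun j _ => (hC j).le)
      (Real.rpow_nonneg (norm_nonneg _) _)) (Finset.mem_univ j)

theorem integrableOn_circle_prod_rpow (hm : 0 < m) (hX : ∀ j, X j ∈ Γ)
    (hXinj : Function.Injective X) {e : Fin m → ℝ} (he : ∀ j, -1 < e j) :
    IntegrableOn (fun θ => ∏ k, ‖circleMap 0 1 θ - X k‖ ^ e k) (Ioc 0 (2 * Real.pi)) := by
  obtain ⟨C, hC, hCX⟩ := exists_prod_rpow_le_sum hm hX hXinj e
  have hmeas : ∀ (r : ℝ) (T : ℂ), Measurable fun θ => ‖circleMap 0 1 θ - T‖ ^ r := fun r T =>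
    (((continuous_circleMap 0 1).sub continuous_const).norm.measurable).pow_const r
  have h1 : IntegrableOn (fun θ => ∑ k, C * ‖circleMap 0 1 θ - X k‖ ^ e k)
      (Ioc 0 (2 * Real.pi)) := by
    refine integrable_finsetSum _ fun k _ => Integrable.const_mul ?_ C
    refine ⟨(hmeas _ _).aestronglyMeasurable, ?_⟩
    rw [hasFiniteIntegral_iff_ofReal (Eventually.of_forall fun θ => by positivity)]
    exact lintegral_circle_rpow_lt_top (he k) (mem_Γ.1 (hX k))
  refine h1.mono' ?_ (Eventually.of_forall fun θ => ?_)
  · exact (Finset.measurable_prod _ fun k _ => hmeas _ _).aestronglyMeasurable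
  · rw [Real.norm_of_nonneg (Finset.prod_nonneg fun k _ => by positivity)]
    exact hCX _ (Γ_subset (circleMap_mem_Γ θ))

/-- Products of powers are comparable at points whose distance is small compared with `𝓡`. -/
theorem prod_rpow_le_of_norm_sub_le (hm : 0 < m) (e : Fin m → ℝ) {S T : ℂ} (hT : T ∉ range X)
    (h : ‖S - T‖ ≤ R X T / 2) :
    ∏ k, ‖S - X k‖ ^ e k ≤ (∏ k, ((2 : ℝ)⁻¹ ^ e k + 2 ^ e k)) * ∏ k, ‖T - X k‖ ^ e k := by
  rw [← Finset.prod_mul_distrib]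
  refine Finset.prod_le_prod (fun k _ => by positivity) fun k _ => ?_
  have h1 := R_le (X := X) T k
  have h2 := R_pos hm hT
  have h3 := norm_sub_le_norm_sub_add_norm_sub S T (X k)
  have h4 := norm_sub_le_norm_sub_add_norm_sub T S (X k)
  rw [norm_sub_rev T S] at h4
  exact rpow_le_mul_rpow (by linarith) two_pos (by linarith) (by linarith) _

theorem countable_circleMap_preimage (X : Fin m → ℂ) :
    ((circleMap 0 1) ⁻¹' range X).Countable :=
  (Set.finite_range X).countable.preimage_circleMap 0 one_ne_zero

theorem ae_circleMap_notMem (X : Fin m → ℂ) (s : Set ℝ) :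
    ∀ᵐ θ ∂(volume.restrict s), circleMap 0 1 θ ∈ Γ \ range X := by
  refine ae_restrict_of_ae ?_
  filter_upwards [(countable_circleMap_preimage X).ae_notMem volume] with θ hθ
  exact ⟨circleMap_mem_Γ θ, hθ⟩

/-- Only countably many angles lie over the finite exceptional set, so continuity off that set is
enough. -/
theorem aestronglyMeasurable_circle {E : Type*} [TopologicalSpace E]
    [TopologicalSpace.PseudoMetrizableSpace E] [SecondCountableTopology E]
    {f : ℂ → E} (hf : ContinuousOn f (Γ \ range X)) (s : Set ℝ) :
    AEStronglyMeasurable (fun θ => f (circleMap 0 1 θ)) (volume.restrict s) := by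
  have hms : MeasurableSet ((circleMap 0 1) ⁻¹' range X)ᶜ :=
    (countable_circleMap_preimage X).measurableSet.compl
  have h1 : ContinuousOn (fun θ => f (circleMap 0 1 θ)) ((circleMap 0 1) ⁻¹' range X)ᶜ :=
    hf.comp (continuous_circleMap 0 1).continuousOn fun θ hθ => ⟨circleMap_mem_Γ θ, hθ⟩
  have h2 := h1.aestronglyMeasurable (μ := volume) hms
  have h3 : volume.restrict ((circleMap 0 1) ⁻¹' range X)ᶜ = volume := by
    refine Measure.restrict_eq_self_of_ae_mem ?_
    exact (countable_circleMap_preimage X).ae_notMem volume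
  rw [h3] at h2
  exact h2.restrict

end Products

/-! ### The embedding of `ℂ` into the biharmonic plane -/

theorem emb_sub (z w : ℂ) : emb z - emb w = emb (z - w) := by
  have h : emb z = emb (z - w) + emb w := by
    apply Biharm.ext <;> simp [emb]
  rw [h, add_sub_cancel_right]

theorem norm_emb (z : ℂ) : ‖emb z‖ = ‖z‖ := by
  rw [Biharm.norm_eq, Complex.norm_def z, Complex.normSq_apply]
  simp only [emb, Biharm.c₁_mk, Biharm.c₂_mk, Complex.norm_real, Real.norm_eq_abs, sq, abs_mul_abs_self]

theorem norm_emb_sub (z w : ℂ) : ‖emb z - emb w‖ = ‖z - w‖ := by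
  rw [emb_sub, norm_emb]

theorem isometry_emb : Isometry emb :=
  Isometry.of_dist_eq fun z w => by rw [dist_eq_norm, dist_eq_norm, norm_emb_sub]

/-! ### The conformal parametrization -/

section Param

variable {D : Set ℂ} {σ : ℂ → ℂ}

theorem isOpen_𝒰 : IsOpen 𝒰 := Metric.isOpen_ball

theorem isCompact_𝒰c : IsCompact 𝒰c := isCompact_closedBall _ _

theorem closure_𝒰 : closure 𝒰 = 𝒰c := closure_ball _ one_ne_zero

theorem 𝒰c_diff : 𝒰c \ 𝒰 = Γ := by
  ext z; simp only [Set.mem_sdiff, mem_𝒰c, mem_𝒰, mem_Γ, not_lt]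
  exact ⟨fun h => le_antisymm h.1 h.2, fun h => ⟨h.le, h.ge⟩⟩

/-- The open mapping theorem; injectivity excludes the constant case. -/
theorem IsConformalParam.isOpen (hσ : IsConformalParam σ D) : IsOpen D := by
  have h1 := hσ.differentiableOn.analyticOnNhd isOpen_𝒰
  rcases h1.is_constant_or_isOpen (convex_ball _ _).isPreconnected with ⟨w, hw⟩ | h
  · exfalso
    have h0 : (0 : ℂ) ∈ 𝒰 := by simp [𝒰]
    have h2 : (1 / 2 : ℂ) ∈ 𝒰 := by rw [mem_𝒰]; norm_num
    have := hσ.injOn (𝒰_subset h0) (𝒰_subset h2) ((hw _ h0).trans (hw _ h2).symm)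
    norm_num at this
  · rw [← hσ.image_disk]
    exact h _ le_rfl isOpen_𝒰

theorem IsConformalParam.closure_eq (hσ : IsConformalParam σ D) : closure D = σ '' 𝒰c := by
  apply Subset.antisymm
  · refine closure_minimal ?_ (isCompact_𝒰c.image_of_continuousOn hσ.continuousOn).isClosed
    rw [← hσ.image_disk]; exact image_mono 𝒰_subset
  · rw [← hσ.image_disk, ← closure_𝒰]
    exact ContinuousOn.image_closure (by rw [closure_𝒰]; exact hσ.continuousOn)

theorem IsConformalParam.frontier_eq (hσ : IsConformalParam σ D) : frontier D = σ '' Γ := by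
  rw [hσ.isOpen.frontier_eq, hσ.closure_eq, ← hσ.image_disk,
    ← hσ.injOn.image_sdiff_subset 𝒰_subset, 𝒰c_diff]

theorem IsConformalParam.injOn_emb (hσ : IsConformalParam σ D) :
    InjOn (fun Z => emb (σ Z)) 𝒰c :=
  fun _ hz _ hw h => hσ.injOn hz hw (isometry_emb.injective h)

theorem IsConformalParam.regBdryZeta_eq (hσ : IsConformalParam σ D) {m : ℕ} {X : Fin m → ℂ}
    (hX : ∀ j, X j ∈ Γ) :
    regBdryZeta D σ X = (fun Z => emb (σ Z)) '' (Γ \ range X) := by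
  have h : range (corner σ X) = (fun Z => emb (σ Z)) '' range X := by
    ext; simp [corner]
  rw [regBdryZeta, bdryZeta, hσ.frontier_eq, image_image, h]
  refine ((hσ.injOn_emb.mono Γ_subset).image_sdiff_subset ?_).symm
  rintro _ ⟨j, rfl⟩; exact hX j

theorem IsConformalParam.domZeta_eq (hσ : IsConformalParam σ D) :
    domZeta D = (fun Z => emb (σ Z)) '' 𝒰 := by
  rw [domZeta, ← hσ.image_disk, image_image]

/-- A continuous injection of the compact closed disk is a closed embedding, so neighbourhood
filters correspond. All limits in `D_ζ` and along its boundary are transported to the disk in this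
way. -/
theorem IsConformalParam.map_nhdsWithin (hσ : IsConformalParam σ D) {s : Set ℂ} (hs : s ⊆ 𝒰c)
    {Z : ℂ} (hZ : Z ∈ 𝒰c) :
    map (fun Z => emb (σ Z)) (𝓝[s] Z) = 𝓝[(fun Z => emb (σ Z)) '' s] (emb (σ Z)) := by
  have : CompactSpace 𝒰c := isCompact_iff_compactSpace.1 isCompact_𝒰c
  have hc : Continuous (fun Z : 𝒰c => emb (σ Z)) :=
    isometry_emb.continuous.comp (continuousOn_iff_continuous_domRestrict.1 hσ.continuousOn)
  have he := hc.isClosedEmbedding fun z w h => Subtype.ext (hσ.injOn_emb z.2 w.2 h)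
  have h1 := he.isEmbedding.map_nhdsWithin_eq (Subtype.val ⁻¹' s) ⟨Z, hZ⟩
  have h2 : map (Subtype.val : 𝒰c → ℂ) (𝓝[Subtype.val ⁻¹' s] ⟨Z, hZ⟩) = 𝓝[s] Z := by
    rw [Topology.IsEmbedding.subtypeVal.map_nhdsWithin_eq, Subtype.image_preimage_coe,
      inter_eq_right.2 hs]
  rw [← h2, map_map]
  refine h1.trans ?_
  congr 1
  have : (fun Z : 𝒰c => emb (σ Z)) = (fun Z => emb (σ Z)) ∘ Subtype.val := rfl
  rw [this, image_comp, Subtype.image_preimage_coe, inter_eq_right.2 hs]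

/-- A quantitative form of the injectivity of `σ` on the closed disk. -/
theorem IsConformalParam.exists_le_norm_sub (hσ : IsConformalParam σ D) {δ : ℝ} (hδ : 0 < δ) :
    ∃ c, 0 < c ∧ ∀ S ∈ 𝒰c, ∀ Z ∈ 𝒰c, δ ≤ ‖S - Z‖ → c ≤ ‖σ S - σ Z‖ := by
  set K : Set (ℂ × ℂ) := {p ∈ 𝒰c ×ˢ 𝒰c | δ ≤ ‖p.1 - p.2‖} with hK
  have hKc : IsCompact K := (isCompact_𝒰c.prod isCompact_𝒰c).inter_right
    (isClosed_le continuous_const (continuous_fst.sub continuous_snd).norm)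
  have hcont : ContinuousOn (fun p : ℂ × ℂ => ‖σ p.1 - σ p.2‖) K :=
    ((hσ.continuousOn.comp continuousOn_fst fun p hp => hp.1.1).sub
      (hσ.continuousOn.comp continuousOn_snd fun p hp => hp.1.2)).norm
  rcases K.eq_empty_or_nonempty with h | h
  · refine ⟨1, one_pos, fun S hS Z hZ h1 => ?_⟩
    have : (S, Z) ∈ K := ⟨⟨hS, hZ⟩, h1⟩
    simp [h] at this
  · obtain ⟨p, hp, hmin⟩ := hKc.exists_isMinOn h hcont
    refine ⟨_, norm_pos_iff.2 (sub_ne_zero.2 fun h => ?_),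
      fun S hS Z hZ h1 => hmin (show (S, Z) ∈ K from ⟨⟨hS, hZ⟩, h1⟩)⟩
    have := hp.2
    rw [hσ.injOn hp.1.1 hp.1.2 h, sub_self, norm_zero] at this
    linarith

theorem IsConformalParam.exists_norm_le (hσ : IsConformalParam σ D) :
    ∃ M, 0 < M ∧ ∀ Z ∈ 𝒰c, ‖σ Z‖ ≤ M := by
  obtain ⟨M, hM⟩ := isCompact_𝒰c.exists_bound_of_continuousOn hσ.continuousOn
  exact ⟨max M 1, by positivity, fun Z hZ => (hM Z hZ).trans (le_max_left _ _)⟩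

end Param

/-! ### Growth of `σ` near the points `X_j` -/

section Growth

variable {D : Set ℂ} {σ : ℂ → ℂ} {m : ℕ} {X : Fin m → ℂ} {β : Fin m → ℝ}

theorem exists_norm_sigmaDeriv_le (hX : ∀ j, X j ∈ Γ) (hA : ConditionA σ X β) {r : ℝ}
    (hr : 0 < r) (hrR : 2 * r ≤ R₀ X) (j : Fin m) :
    ∃ C, 0 < C ∧ ∀ Z ∈ 𝒰c \ range X, ‖Z - X j‖ ≤ r → ‖sigmaDeriv σ Z‖ ≤ C * ‖Z - X j‖ ^ β j := by
  obtain ⟨c, hc⟩ := hA.bound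
  obtain ⟨C, hC, hCX⟩ := exists_prod_rpow_le hX β hr j
  refine ⟨(|c| + 1) * C, by positivity, fun Z hZ hZr => (hc Z hZ).trans ?_⟩
  rw [mul_assoc]
  have h1 := hCX Z hZ.1 fun k hk => by
    have h2 := R₀_le (X := X) hk
    have h3 := norm_sub_le_norm_sub_add_norm_sub (X k) Z (X j)
    rw [norm_sub_rev (X k) Z] at h3
    linarith
  have h2 : 0 ≤ ∏ k, ‖Z - X k‖ ^ β k := Finset.prod_nonneg fun k _ => by positivity
  exact mul_le_mul (by linarith [le_abs_self c]) h1 h2 (by positivity)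

/-- For `Z` near `X_j`, integrate `|σ'| ≤ C |· - X_j|^{β_j}` along the segment from `X_j`, whose
interior lies in the open disk by strict convexity; `β_j > -1` makes the integral converge. For the
other `Z` boundedness of `σ` suffices. -/
theorem IsConformalParam.exists_norm_sub_le (hσ : IsConformalParam σ D) (hX : ∀ j, X j ∈ Γ)
    (hA : ConditionA σ X β) {r : ℝ} (hr : 0 < r) (hrR : 2 * r ≤ R₀ X) (j : Fin m)
    (hβ : -1 < β j) :
    ∃ C, 0 < C ∧ ∀ Z ∈ 𝒰c, ‖σ Z - σ (X j)‖ ≤ C * ‖Z - X j‖ ^ (β j + 1) := by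
  obtain ⟨C, hC, hCX⟩ := exists_norm_sigmaDeriv_le hX hA hr hrR j
  obtain ⟨M, hM, hMσ⟩ := hσ.exists_norm_le
  have hj := Γ_subset (hX j)
  refine ⟨C / (β j + 1) + 2 * M / r ^ (β j + 1), by have : 0 < β j + 1 := by linarith
                                                    positivity, fun Z hZ => ?_⟩
  have hb : 0 < β j + 1 := by linarith
  rw [add_mul]
  rcases le_or_gt ‖Z - X j‖ r with hZr | hZr
  · refine le_trans ?_ (le_add_of_nonneg_right (by positivity))
    rcases eq_or_ne Z (X j) with rfl | hne
    · simp [Real.zero_rpow hb.ne']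
    set s := ‖Z - X j‖ with hs
    have hs0 : 0 < s := norm_pos_iff.2 (sub_ne_zero.2 hne)
    set l : ℝ → ℂ := fun t => X j + t * (Z - X j) with hl
    have hlc : Continuous l := by fun_prop
    have hmem : ∀ t ∈ Ioo (0 : ℝ) 1, l t ∈ 𝒰 := fun t ht => by
      refine openSegment_subset_ball_of_ne hj hZ hne.symm ?_
      exact ⟨1 - t, t, by linarith [ht.2], ht.1, by ring, by simp [hl]; ring⟩
    have hmem' : ∀ t ∈ Icc (0 : ℝ) 1, l t ∈ 𝒰c := fun t ht => by
      refine (convex_closedBall (0 : ℂ) 1).segment_subset hj hZ ?_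
      exact ⟨1 - t, t, by linarith [ht.2], ht.1, by ring, by simp [hl]; ring⟩
    have hder : ∀ t ∈ Ioo (0 : ℝ) 1,
        HasDerivAt (fun t => σ (l t)) (deriv σ (l t) * (Z - X j)) t := fun t ht => by
      have h1 := (hσ.differentiableOn.differentiableAt
        (isOpen_𝒰.mem_nhds (hmem t ht))).hasDerivAt
      have h2 : HasDerivAt l (Z - X j) t := by
        have := ((Complex.ofRealCLM.hasDerivAt (x := t)).mul_const (Z - X j)).const_add (X j)
        rwa [Complex.ofRealCLM_apply, Complex.ofReal_one, one_mul] at this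
      exact h1.comp t h2
    have hint : IntervalIntegrable (fun t : ℝ => C * s ^ (β j + 1) * t ^ β j) volume 0 1 :=
      (intervalIntegral.intervalIntegrable_rpow' hβ).const_mul _
    have := norm_sub_le_integral_of_norm_deriv_le_of_le (zero_le_one' ℝ)
      (hσ.continuousOn.comp hlc.continuousOn hmem')
      (fun t ht => (hder t ht).differentiableAt.differentiableWithinAt)
      (B := fun t : ℝ => C * s ^ (β j + 1) * t ^ β j)
      (by
        refine Eventually.of_forall fun t => fun ht => ?_
        rw [show (σ ∘ l) = fun t => σ (l t) from rfl, (hder t ht).deriv, norm_mul]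
        have hu := hmem t ht
        have h3 : l t - X j = t * (Z - X j) := by simp [hl]
        have h4 : ‖l t - X j‖ = t * s := by
          rw [h3, norm_mul, Complex.norm_real, Real.norm_of_nonneg ht.1.le]
        have h5 : l t ∉ range X := by
          rintro ⟨k, hk⟩
          have := mem_Γ.1 (hX k)
          rw [hk] at this
          exact (mem_𝒰.1 hu).ne this
        have h6 := hCX (l t) ⟨𝒰_subset hu, h5⟩ (by
          rw [h4]; nlinarith [ht.2])
        rw [sigmaDeriv, if_pos (mem_𝒰.1 hu), h4, Real.mul_rpow ht.1.le hs0.le] at h6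
        rw [Real.rpow_add_one hs0.ne']
        calc _ ≤ C * (t ^ β j * s ^ β j) * s := by gcongr
          _ = _ := by ring) hint
    have hl1 : l 1 = Z := by simp [hl]
    have hl0 : l 0 = X j := by simp [hl]
    simp only [Function.comp, hl1, hl0] at this
    refine this.trans (le_of_eq ?_)
    rw [intervalIntegral.integral_const_mul, integral_rpow (Or.inl hβ), Real.zero_rpow hb.ne']
    simp; ring
  · refine le_trans ?_ (le_add_of_nonneg_left (by positivity))
    have h1 : ‖σ Z - σ (X j)‖ ≤ 2 * M := by
      linarith [norm_sub_le (σ Z) (σ (X j)), hMσ Z hZ, hMσ _ hj]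
    refine h1.trans ?_
    rw [div_mul_eq_mul_div, le_div_iff₀ (by positivity)]
    gcongr

/-- The lower bound for `|d(S, Z)|` excludes `Z = X_j`, so it is used for `Z` in the disk and passed
to the limit `Z → X_j`. For `S` away from `X_j`, quantitative injectivity of `σ` takes over. -/
theorem IsConformalParam.exists_le_norm_sub_corner (hσ : IsConformalParam σ D)
    (hX : ∀ j, X j ∈ Γ) {r : ℝ} (hr : 0 < r) (hrR : 4 * r ≤ R₀ X) (j : Fin m)
    (hβ : -1 < β j) {c : ℝ} (hc : 0 < c)
    (hd : ∀ Z ∈ near 𝒰c r (X j) \ range X, ∀ S ∈ near Γ (2 * r) (X j) \ range X, S ≠ Z →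
        c * (‖S - X j‖ + ‖Z - X j‖) ^ β j ≤ ‖d σ S Z‖) :
    ∃ C, 0 < C ∧ ∀ S ∈ Γ, C * ‖S - X j‖ ^ (β j + 1) ≤ ‖σ S - σ (X j)‖ := by
  have hb : 0 < β j + 1 := by linarith
  obtain ⟨c₁, hc₁, hcσ⟩ := hσ.exists_le_norm_sub (δ := 2 * r) (by positivity)
  have hj := Γ_subset (hX j)
  refine ⟨min c (c₁ / 2 ^ (β j + 1)), by positivity, fun S hS => ?_⟩
  rcases eq_or_ne S (X j) with rfl | hne
  · simp [Real.zero_rpow hb.ne']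
  have hs0 : 0 < ‖S - X j‖ := norm_pos_iff.2 (sub_ne_zero.2 hne)
  rcases le_or_gt ‖S - X j‖ (2 * r) with hSr | hSr
  · have hSX : S ∉ range X := by
      rintro ⟨k, rfl⟩
      have hk : k ≠ j := fun h => hne (by rw [h])
      linarith [R₀_le (X := X) hk]
    have hlim : Tendsto (fun Z => ‖d σ S Z‖) (𝓝[𝒰] (X j)) (𝓝 ‖d σ S (X j)‖) := by
      have h1 : Tendsto σ (𝓝[𝒰] (X j)) (𝓝 (σ (X j))) :=
        (hσ.continuousOn _ hj).mono_left (nhdsWithin_mono _ 𝒰_subset)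
      refine ((tendsto_const_nhds.sub h1).div (tendsto_const_nhds.sub
        (tendsto_nhdsWithin_of_tendsto_nhds tendsto_id)) (sub_ne_zero.2 hne)).norm
    have hlim' : Tendsto (fun Z => c * (‖S - X j‖ + ‖Z - X j‖) ^ β j) (𝓝[𝒰] (X j))
        (𝓝 (c * (‖S - X j‖ + ‖X j - X j‖) ^ β j)) := by
      have h1 : ContinuousAt (fun Z => c * (‖S - X j‖ + ‖Z - X j‖) ^ β j) (X j) := by
        refine ContinuousAt.const_mul (ContinuousAt.rpow_const (by fun_prop) (Or.inl ?_)) c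
        rw [sub_self, norm_zero, add_zero]; exact hs0.ne'
      exact h1.tendsto.mono_left nhdsWithin_le_nhds
    have hne' : (𝓝[𝒰] (X j)).NeBot := mem_closure_iff_nhdsWithin_neBot.1 (closure_𝒰 ▸ hj)
    have h2 := le_of_tendsto_of_tendsto hlim' hlim (by
      filter_upwards [self_mem_nhdsWithin, mem_nhdsWithin_of_mem_nhds
        (Metric.closedBall_mem_nhds (X j) hr)] with Z hZ hZr
      have hZX : ∀ w ∈ Γ, w ≠ Z := by
        rintro w hw rfl
        exact (mem_𝒰.1 hZ).ne (mem_Γ.1 hw)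
      refine hd Z ⟨⟨𝒰_subset hZ, by simpa [dist_eq_norm] using hZr⟩, ?_⟩ S ⟨⟨hS, hSr⟩, hSX⟩
        (hZX S hS)
      rintro ⟨k, hk⟩
      exact hZX _ (hX k) hk)
    rw [sub_self, norm_zero, add_zero, d, norm_div, le_div_iff₀ hs0] at h2
    rw [Real.rpow_add_one hs0.ne', ← mul_assoc]
    refine le_trans ?_ h2
    gcongr
    exact min_le_left _ _
  · have h1 := hcσ S (Γ_subset hS) _ hj hSr.le
    refine le_trans ?_ h1
    have h2 : ‖S - X j‖ ≤ 2 := by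
      have := norm_sub_le S (X j)
      rw [mem_Γ.1 hS, mem_Γ.1 (hX j)] at this; linarith
    -- The circle has diameter `2`, which explains the second entry of the minimum chosen above.
    calc _ ≤ c₁ / 2 ^ (β j + 1) * 2 ^ (β j + 1) := by
          gcongr; exact min_le_right _ _
      _ = c₁ := by field_simp

end Growth

/-! ### The standing assumptions, and the two classes of densities -/

/-- The standing assumptions on the domain, the points `X_j` and the exponents. -/
structure Setup {m : ℕ} (D : Set ℂ) (σ : ℂ → ℂ) (X : Fin m → ℂ) (β α γ : Fin m → ℝ) : Prop where
  card_pos : 0 < m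
  param : IsConformalParam σ D
  mem : ∀ j, X j ∈ Γ
  inj : Function.Injective X
  neg_one_lt : ∀ j, -1 < β j
  condA : ConditionA σ X β
  condB : ConditionB σ X β
  α_pos : ∀ j, 0 < α j
  α_lt_one : ∀ j, α j < 1
  γ_eq : ∀ j, γ j = (β j + 1) * α j
  γ_lt_one : ∀ j, γ j < 1

section Classes

variable {D : Set ℂ} {σ : ℂ → ℂ} {m : ℕ} {X : Fin m → ℂ} {β α γ : Fin m → ℝ}

theorem Setup.γ_pos (h : Setup D σ X β α γ) (j : Fin m) : 0 < γ j := by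
  rw [h.γ_eq]
  exact mul_pos (by linarith [h.neg_one_lt j]) (h.α_pos j)

/-- Here `β_j - γ_j + 1 = (β_j + 1)(1 - α_j)`. This exponent governs the product of a density with
`|σ'|`. -/
theorem Setup.neg_one_lt_sub (h : Setup D σ X β α γ) (j : Fin m) : -1 < β j - γ j := by
  rw [h.γ_eq]
  nlinarith [h.neg_one_lt j, h.α_lt_one j]

theorem Setup.exists_comparable (h : Setup D σ X β α γ) (j : Fin m) :
    ∃ a b, 0 < a ∧ 0 < b ∧ (∀ S ∈ Γ, a * ‖S - X j‖ ^ (β j + 1) ≤ ‖σ S - σ (X j)‖) ∧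
      ∀ Z ∈ 𝒰c, ‖σ Z - σ (X j)‖ ≤ b * ‖Z - X j‖ ^ (β j + 1) := by
  obtain ⟨r, hr, hrR, -, -, hd⟩ := h.condB
  obtain ⟨c, hc, hdc⟩ := hd j
  obtain ⟨b, hb, hb'⟩ := h.param.exists_norm_sub_le h.mem h.condA hr (by linarith) j
    (h.neg_one_lt j)
  obtain ⟨a, ha, ha'⟩ := h.param.exists_le_norm_sub_corner h.mem hr (by linarith) j
    (h.neg_one_lt j) hc hdc
  exact ⟨a, b, ha, hb, ha', hb'⟩

theorem rpow_neg_le_of_mul_rpow_le {a x y p α : ℝ} (ha : 0 < a) (hx : 0 < x) (hα : 0 ≤ α)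
    (h : a * x ^ p ≤ y) : y ^ (-α) ≤ a ^ (-α) * x ^ (-(p * α)) := by
  calc y ^ (-α) ≤ (a * x ^ p) ^ (-α) :=
        Real.rpow_le_rpow_of_nonpos (by positivity) h (by linarith)
    _ = _ := by rw [Real.mul_rpow ha.le (by positivity), ← Real.rpow_mul hx.le, mul_neg]

theorem mul_rpow_neg_le_of_le_mul_rpow {b x y p α : ℝ} (hb : 0 < b) (hx : 0 < x) (hy : 0 < y)
    (hα : 0 ≤ α) (h : y ≤ b * x ^ p) : x ^ (-(p * α)) ≤ b ^ α * y ^ (-α) := by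
  have h1 : (b * x ^ p) ^ (-α) ≤ y ^ (-α) := Real.rpow_le_rpow_of_nonpos hy h (by linarith)
  rw [Real.mul_rpow hb.le (by positivity), ← Real.rpow_mul hx.le, mul_neg,
    Real.rpow_neg hb.le] at h1
  calc x ^ (-(p * α)) = b ^ α * ((b ^ α)⁻¹ * x ^ (-(p * α))) := by
        rw [mul_inv_cancel_left₀ (by positivity)]
    _ ≤ _ := by gcongr

theorem Setup.continuousOn_iff (h : Setup D σ X β α γ) (φ : Biharm → ℝ) :
    ContinuousOn φ (regBdryZeta D σ X) ↔ ContinuousOn (pull σ φ) (Γ \ range X) := by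
  have hs : Γ \ range X ⊆ 𝒰c := sdiff_subset.trans Γ_subset
  rw [h.param.regBdryZeta_eq h.mem]
  unfold ContinuousOn
  rw [forall_mem_image]
  refine forall₂_congr fun Z hZ => ?_
  unfold ContinuousWithinAt
  rw [← h.param.map_nhdsWithin hs (hs hZ), tendsto_map'_iff]
  rfl

theorem prod_le_of_forall_le {x y : Fin m → ℝ} {C : Fin m → ℝ} (hx : ∀ j, 0 ≤ x j)
    (hxy : ∀ j, x j ≤ C j * y j) : ∏ j, x j ≤ (∏ j, C j) * ∏ j, y j := by
  rw [← Finset.prod_mul_distrib]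
  exact Finset.prod_le_prod (fun j _ => hx j) fun j _ => hxy j

theorem exists_bound_transfer {ι : Type*} {A : Set ι} {f g k : ι → ℝ} {K : ℝ}
    (hg : ∀ i ∈ A, 0 ≤ g i) (hgk : ∀ i ∈ A, g i ≤ K * k i)
    (hf : ∃ c, ∀ i ∈ A, |f i| ≤ c * g i) : ∃ c, ∀ i ∈ A, |f i| ≤ c * k i := by
  obtain ⟨c, hc⟩ := hf
  refine ⟨|c| * K, fun i hi => (hc i hi).trans ?_⟩
  rw [mul_assoc]
  exact mul_le_mul (le_abs_self c) (hgk i hi) (hg i hi) (abs_nonneg c)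

/-- On the circle `|σ(S) - σ(X_j)|` is comparable with `|S - X_j|^{β_j + 1}`, so its power `-α_j` is
comparable with `|S - X_j|^{-γ_j}`. The lower comparison gives one implication and the upper one the
converse. -/
theorem Setup.boundaryClass_iff (h : Setup D σ X β α γ) (φ : Biharm → ℝ) :
    BoundaryClass D σ X α φ ↔ WeightedClass X γ (pull σ φ) := by
  choose a b ha hb hab hba using h.exists_comparable
  have hpos : ∀ S ∈ Γ \ range X, ∀ j, 0 < ‖S - X j‖ := fun S hS j =>
    norm_pos_iff.2 (sub_ne_zero.2 fun he => hS.2 ⟨j, he.symm⟩)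
  have e : ∀ S j, ‖emb (σ S) - corner σ X j‖ = ‖σ S - σ (X j)‖ := fun S j => norm_emb_sub _ _
  rw [BoundaryClass, WeightedClass, h.continuousOn_iff φ, and_iff_right h.γ_lt_one]
  refine and_congr_right fun _ => ?_
  rw [h.param.regBdryZeta_eq h.mem]
  simp only [forall_mem_image, e]
  constructor
  · refine exists_bound_transfer (A := Γ \ range X) (K := ∏ j, a j ^ (-α j))
      (fun S _ => Finset.prod_nonneg fun j _ => by positivity) fun S hS =>
      prod_le_of_forall_le (fun j => by positivity) fun j => ?_
    rw [h.γ_eq]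
    exact rpow_neg_le_of_mul_rpow_le (ha j) (hpos S hS j) (h.α_pos j).le (hab j S hS.1)
  · refine exists_bound_transfer (A := Γ \ range X) (K := ∏ j, b j ^ (α j))
      (fun S _ => Finset.prod_nonneg fun j _ => by positivity) fun S hS =>
      prod_le_of_forall_le (fun j => by positivity) fun j => ?_
    rw [h.γ_eq]
    refine mul_rpow_neg_le_of_le_mul_rpow (hb j) (hpos S hS j) ?_ (h.α_pos j).le
      (hba j S (Γ_subset hS.1))
    have := hpos S hS j
    exact (mul_pos (ha j) (by positivity)).trans_le (hab j S hS.1)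

/-- Compose `ψ` with a left inverse of the boundary parametrization. Agreement is claimed only off
the exceptional points. -/
theorem Setup.exists_pull_eq (h : Setup D σ X β α γ) {ψ : ℂ → ℝ} (hψ : WeightedClass X γ ψ) :
    ∃ φ : Biharm → ℝ, BoundaryClass D σ X α φ ∧ EqOn (pull σ φ) ψ (Γ \ range X) := by
  have hs : Γ \ range X ⊆ 𝒰c := sdiff_subset.trans Γ_subset
  set F : ℂ → Biharm := fun Z => emb (σ Z) with hF
  have hleft : ∀ S ∈ Γ \ range X, Function.invFunOn F 𝒰c (F S) = S := fun S hS =>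
    h.param.injOn_emb.leftInvOn_invFunOn (hs hS)
  have heq : EqOn (pull σ fun ζ => ψ (Function.invFunOn F 𝒰c ζ)) ψ (Γ \ range X) :=
    fun S hS => congrArg ψ (hleft S hS)
  refine ⟨_, (h.boundaryClass_iff _).2 ⟨hψ.1, hψ.2.1.congr heq, ?_⟩, heq⟩
  obtain ⟨c, hc⟩ := hψ.2.2
  exact ⟨c, fun S hS => by rw [heq hS]; exact hc S hS⟩

end Classes

/-! ### Linear approximation of `σ` near a regular point of the circle -/

section Approx

variable {D : Set ℂ} {σ : ℂ → ℂ} {m : ℕ} {X : Fin m → ℂ} {β α γ : Fin m → ℝ}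

theorem sigmaDeriv_of_mem_Γ {T : ℂ} (hT : T ∈ Γ) : sigmaDeriv σ T = contourDeriv σ T := by
  rw [sigmaDeriv, if_neg]
  rw [mem_Γ.1 hT]; exact lt_irrefl _

theorem hasDerivAt_comp_circleMap {T : ℂ} (hT : ‖T‖ = 1) {f : ℂ → ℂ} {u : ℝ}
    (hf : DifferentiableWithinAt ℂ f Γ (T * circleMap 0 1 u)) :
    HasDerivAt (fun u : ℝ => f (T * circleMap 0 1 u))
      (T * (circleMap 0 1 u * Complex.I) * contourDeriv f (T * circleMap 0 1 u)) u := by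
  have h1 : HasDerivAt (fun u : ℝ => T * circleMap 0 1 u) (T * (circleMap 0 1 u * Complex.I)) u :=
    (hasDerivAt_circleMap 0 1 u).const_mul T
  have h2 := hf.hasDerivWithinAt.scomp_hasDerivAt u h1 fun v => by
    rw [mem_Γ, norm_mul, hT, norm_circleMap_one, one_mul]
  exact h2

/-- `T e^{iu}` runs through the points of the circle. -/
theorem exists_mul_circleMap_eq {S T : ℂ} (hS : ‖S‖ = 1) (hT : ‖T‖ = 1) :
    ∃ θ : ℝ, |θ| ≤ Real.pi ∧ T * circleMap 0 1 θ = S := by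
  have hT0 : T ≠ 0 := norm_ne_zero_iff.1 (by rw [hT]; exact one_ne_zero)
  refine ⟨(S / T).arg, Complex.abs_arg_le_pi _, ?_⟩
  have h := Complex.norm_mul_exp_arg_mul_I (S / T)
  rw [norm_div, hS, hT, div_one, Complex.ofReal_one, one_mul] at h
  simp only [circleMap, zero_add, Complex.ofReal_one, one_mul, h]
  field_simp

/-- Along an arc of length at most `π` from `T` to `S` no point is farther from `T` than `S`, so a
monotone modulus may be evaluated at the endpoint. -/
theorem norm_mul_circleMap_sub_mono {T : ℂ} (hT : ‖T‖ = 1) {u θ : ℝ} (h : |u| ≤ |θ|)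
    (hθ : |θ| ≤ Real.pi) : ‖T * circleMap 0 1 u - T‖ ≤ ‖T * circleMap 0 1 θ - T‖ := by
  rw [norm_mul_circleMap_sub hT, norm_mul_circleMap_sub hT]
  have key : ∀ x : ℝ, |x| ≤ Real.pi → |Real.sin (x / 2)| = Real.sin (|x| / 2) := fun x hx => by
    have h0 : 0 ≤ Real.sin (|x| / 2) :=
      Real.sin_nonneg_of_nonneg_of_le_pi (by positivity) (by linarith [abs_nonneg x])
    rcases abs_choice x with h | h
    · rw [h] at h0 ⊢; exact abs_of_nonneg h0
    · rw [h] at h0 ⊢; rw [neg_div, Real.sin_neg] at h0 ⊢; exact abs_of_nonpos (by linarith)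
  rw [key u (h.trans hθ), key θ hθ]
  have := Real.sin_le_sin_of_le_of_le_pi_div_two (x := |u| / 2) (y := |θ| / 2)
    (by linarith [abs_nonneg u, Real.pi_pos]) (by linarith) (by linarith)
  linarith

/-- The mean value inequality along the arc from `T` to `S`, applied to `σ` minus its linear part
with slope `σ'(T)`. -/
theorem norm_sub_contour_le {T : ℂ} (hT : ‖T‖ = 1) {ρ M : ℝ} {ω : ℝ → ℝ} (hω : IsModulus ω)
    (hM : 0 ≤ M)
    (hdiff : ∀ V ∈ Γ, ‖V - T‖ ≤ ρ → DifferentiableWithinAt ℂ σ Γ V)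
    (hloc : ∀ V ∈ Γ, V ≠ T → ‖V - T‖ ≤ ρ →
      ‖contourDeriv σ V - contourDeriv σ T‖ ≤ M * ω ‖V - T‖)
    {S : ℂ} (hS : S ∈ Γ) (hST : S ≠ T) (hSρ : ‖S - T‖ ≤ ρ) :
    ‖σ S - σ T - contourDeriv σ T * (S - T)‖ ≤ 2 * M * ω ‖S - T‖ * ‖S - T‖ := by
  obtain ⟨θ, hθ, rfl⟩ := exists_mul_circleMap_eq (mem_Γ.1 hS) hT
  set a := contourDeriv σ T with ha
  set s := ‖T * circleMap 0 1 θ - T‖ with hs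
  have hs0 : 0 < s := norm_pos_iff.2 (sub_ne_zero.2 hST)
  have hmem : ∀ u : ℝ, T * circleMap 0 1 u ∈ Γ := fun u => by
    rw [mem_Γ, norm_mul, hT, norm_circleMap_one, one_mul]
  have hle : ∀ u ∈ Icc (-|θ|) |θ|, ‖T * circleMap 0 1 u - T‖ ≤ s := fun u hu =>
    norm_mul_circleMap_sub_mono hT (abs_le.2 hu) hθ
  have hder : ∀ u ∈ Icc (-|θ|) |θ|, HasDerivWithinAt
      (fun u : ℝ => σ (T * circleMap 0 1 u) - a * (T * circleMap 0 1 u))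
      (T * (circleMap 0 1 u * Complex.I) * (contourDeriv σ (T * circleMap 0 1 u) - a))
      (Icc (-|θ|) |θ|) u := fun u hu => by
    have h1 := hasDerivAt_comp_circleMap hT (hdiff _ (hmem u) ((hle u hu).trans hSρ))
    have h2 : HasDerivAt (fun u : ℝ => a * (T * circleMap 0 1 u))
        (a * (T * (circleMap 0 1 u * Complex.I))) u :=
      ((hasDerivAt_circleMap 0 1 u).const_mul T).const_mul a
    refine HasDerivAt.hasDerivWithinAt ((h1.sub h2).congr_deriv ?_)
    ring
  have hbound : ∀ u ∈ Icc (-|θ|) |θ|,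
      ‖T * (circleMap 0 1 u * Complex.I) * (contourDeriv σ (T * circleMap 0 1 u) - a)‖ ≤
        M * ω s := fun u hu => by
    rw [norm_mul, norm_mul, norm_mul, hT, norm_circleMap_one, Complex.norm_I, one_mul, one_mul,
      one_mul]
    rcases eq_or_ne (T * circleMap 0 1 u) T with h | h
    · rw [h, ha, sub_self, norm_zero]
      exact mul_nonneg hM (hω.pos s hs0).le
    · refine (hloc _ (hmem u) h ((hle u hu).trans hSρ)).trans ?_
      gcongr
      exact hω.mono (norm_pos_iff.2 (sub_ne_zero.2 h)) hs0 (hle u hu)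
  have h := Convex.norm_image_sub_le_of_norm_hasDerivWithin_le hder hbound (convex_Icc _ _)
    (x := 0) (y := θ) ⟨by simp, by simp⟩ ⟨neg_abs_le θ, le_abs_self θ⟩
  have hT1 : T * circleMap 0 1 0 = T := by simp [circleMap]
  simp only [hT1, sub_zero, Real.norm_eq_abs] at h
  -- The arc is at most `π/2` times the chord, and `π ≤ 4`; this is the factor `2` in the
  -- conclusion.
  have h2 : |θ| ≤ 2 * s := by
    have h3 := two_div_pi_mul_abs_le hT hθ
    have h4 : 1 / 2 ≤ 2 / Real.pi := by
      rw [div_le_div_iff₀ two_pos Real.pi_pos]; linarith [Real.pi_le_four]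
    nlinarith [abs_nonneg θ]
  have h0 := mul_nonneg hM (hω.pos s hs0).le
  calc _ = ‖σ (T * circleMap 0 1 θ) - a * (T * circleMap 0 1 θ) - (σ T - a * T)‖ := by
        congr 1; ring
    _ ≤ M * ω s * |θ| := h
    _ ≤ M * ω s * (2 * s) := by gcongr
    _ = _ := by ring

/-- The same argument along the radius. The mean value inequality with right derivatives asks only
for continuity at the endpoint `T`. -/
theorem norm_sub_radial_le (hσ : IsConformalParam σ D) {T : ℂ} (hT : ‖T‖ = 1) {ρ M : ℝ}
    {ω : ℝ → ℝ} (hω : IsModulus ω) (hM : 0 ≤ M)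
    (hloc : ∀ V ∈ segment ℝ 0 T, V ≠ T → ‖V - T‖ ≤ ρ →
      ‖sigmaDeriv σ V - contourDeriv σ T‖ ≤ M * ω ‖V - T‖)
    {r : ℝ} (hr : 0 ≤ r) (hr1 : r < 1) (hrρ : 1 - r ≤ ρ) :
    ‖σ (r * T) - σ T - contourDeriv σ T * (r * T - T)‖ ≤ M * ω (1 - r) * (1 - r) := by
  set a := contourDeriv σ T with ha
  set l : ℝ → ℂ := fun u => u * T with hl
  have hlc : Continuous l := by fun_prop
  have hln : ∀ u : ℝ, 0 ≤ u → ‖l u‖ = u := fun u hu => by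
    rw [hl, norm_mul, hT, mul_one, Complex.norm_real, Real.norm_of_nonneg hu]
  have hlT : ∀ u : ℝ, u ≤ 1 → ‖l u - T‖ = 1 - u := fun u hu => by
    have : l u - T = ((u - 1 : ℝ) : ℂ) * T := by simp [hl]; ring
    rw [this, norm_mul, hT, mul_one, Complex.norm_real, Real.norm_of_nonpos (by linarith)]; ring
  have hlder : ∀ u, HasDerivAt l T u := fun u => by
    have := (Complex.ofRealCLM.hasDerivAt (x := u)).mul_const T
    rwa [Complex.ofRealCLM_apply, Complex.ofReal_one, one_mul] at this
  have hcont : ContinuousOn (fun u => σ (l u) - a * l u) (Icc r 1) := by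
    refine (hσ.continuousOn.comp hlc.continuousOn fun u hu => ?_).sub
      (continuousOn_const.mul hlc.continuousOn)
    rw [mem_𝒰c, hln u (hr.trans hu.1)]; exact hu.2
  have hder : ∀ u ∈ Ico r 1, HasDerivWithinAt (fun u => σ (l u) - a * l u)
      ((sigmaDeriv σ (l u) - a) * T) (Ici u) u := fun u hu => by
    have hu' : ‖l u‖ < 1 := by rw [hln u (hr.trans hu.1)]; exact hu.2
    rw [sigmaDeriv, if_pos hu', sub_mul]
    have h1 := (hσ.differentiableOn.differentiableAt
      (isOpen_𝒰.mem_nhds (mem_𝒰.2 hu'))).hasDerivAt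
    exact ((h1.comp u (hlder u)).sub ((hlder u).const_mul a)).hasDerivWithinAt
  have hbound : ∀ u ∈ Ico r 1, ‖(sigmaDeriv σ (l u) - a) * T‖ ≤ M * ω (1 - r) := fun u hu => by
    rw [norm_mul, hT, mul_one]
    have h1 := hlT u hu.2.le
    have h2 : 0 < 1 - u := by linarith [hu.2]
    refine (hloc (l u) ⟨1 - u, u, h2.le, hr.trans hu.1, by ring, by simp [hl]⟩ ?_ ?_).trans ?_
    · intro h; rw [h, sub_self, norm_zero] at h1; linarith
    · rw [h1]; linarith [hu.1]
    · rw [h1]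
      gcongr
      exact hω.mono h2 (by simp only [mem_Ioi]; linarith) (by linarith [hu.1])
  have h := norm_image_sub_le_of_norm_deriv_right_le_segment hcont hder hbound 1 ⟨hr1.le, le_rfl⟩
  have h1 : l 1 = T := by simp [hl]
  rw [h1, norm_sub_rev] at h
  refine le_trans (le_of_eq ?_) h
  congr 1
  simp only [hl]; ring

/-- For `S`, `Z` close to `T ∈ Γ`, `Z` on the radius of `T`: `σ(S) - σ(Z)` is nearly linear. -/
theorem norm_sub_linear_le (hσ : IsConformalParam σ D) {T : ℂ} (hT : ‖T‖ = 1) {ρ M : ℝ}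
    {ω : ℝ → ℝ} (hω : IsModulus ω) (hM : 0 ≤ M)
    (hdiff : ∀ V ∈ Γ, ‖V - T‖ ≤ ρ → DifferentiableWithinAt ℂ σ Γ V)
    (hloc : ∀ V ∈ Γ ∪ segment ℝ 0 T, V ≠ T → ‖V - T‖ ≤ ρ →
      ‖sigmaDeriv σ V - contourDeriv σ T‖ ≤ M * ω ‖V - T‖)
    {S : ℂ} (hS : S ∈ Γ) (hSρ : ‖S - T‖ ≤ ρ) {r : ℝ} (hr : 0 ≤ r) (hr1 : r ≤ 1)
    (hrρ : 1 - r ≤ ρ) (hne : S ≠ r * T) :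
    ‖contourDeriv σ S - contourDeriv σ T‖ ≤ 10 * M * ω ‖S - r * T‖ ∧
    ‖σ S - σ (r * T) - contourDeriv σ T * (S - r * T)‖ ≤
      10 * M * ω ‖S - r * T‖ * ‖S - r * T‖ := by
  set p := ‖S - r * T‖ with hp
  have hp0 : 0 < p := norm_pos_iff.2 (sub_ne_zero.2 hne)
  have hrT : ‖(r : ℂ) * T - T‖ = 1 - r := by
    have : (r : ℂ) * T - T = ((r - 1 : ℝ) : ℂ) * T := by push_cast; ring
    rw [this, norm_mul, hT, mul_one, Complex.norm_real, Real.norm_of_nonpos (by linarith)]; ring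
  -- The point `rT` is at distance `1 - r` from the circle, so `p` dominates `1 - r` and half of `|S
  -- - T|`. Both one-dimensional estimates can then be expressed through `ω(p)`.
  have hrp : 1 - r ≤ p := by
    have := norm_sub_norm_le S (r * T)
    rw [mem_Γ.1 hS, norm_mul, hT, Complex.norm_real, Real.norm_of_nonneg hr, mul_one] at this
    exact this
  have hSp : ‖S - T‖ ≤ 2 * p := by
    have := norm_sub_le_norm_sub_add_norm_sub S (r * T) T
    linarith
  have hωp := hω.pos p hp0
  have hω2 : ω (2 * p) ≤ 2 * ω p := hω.le_two_mul hp0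
  have hMω := mul_nonneg hM hωp.le
  have hSω : S ≠ T → M * ω ‖S - T‖ ≤ 2 * (M * ω p) := fun h => by
    have h1 := hω.mono (norm_pos_iff.2 (sub_ne_zero.2 h)) (show 0 < 2 * p by positivity) hSp
    calc M * ω ‖S - T‖ ≤ M * (2 * ω p) := by gcongr; linarith
      _ = _ := by ring
  have hA : ‖σ S - σ T - contourDeriv σ T * (S - T)‖ ≤ 8 * (M * ω p) * p := by
    rcases eq_or_ne S T with rfl | h
    · simp; positivity
    · have h1 := norm_sub_contour_le hT hω hM hdiff (fun V hV hVT hVρ => by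
        rw [← sigmaDeriv_of_mem_Γ hV]; exact hloc V (Or.inl hV) hVT hVρ) hS h hSρ
      calc _ ≤ _ := h1
        _ = 2 * (M * ω ‖S - T‖) * ‖S - T‖ := by ring
        _ ≤ 2 * (2 * (M * ω p)) * (2 * p) := by
            have := hSω h
            gcongr
        _ = _ := by ring
  have hB : ‖σ (r * T) - σ T - contourDeriv σ T * (r * T - T)‖ ≤ (M * ω p) * p := by
    rcases eq_or_lt_of_le hr1 with rfl | h
    · simp; positivity
    · have h1 := norm_sub_radial_le hσ hT hω hM (fun V hV => hloc V (Or.inr hV)) hr h hrρ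
      have h2 := hω.mono (show 0 < 1 - r by linarith) hp0 hrp
      refine h1.trans ?_
      have h3 : 0 ≤ 1 - r := by linarith
      gcongr
  constructor
  · rcases eq_or_ne S T with h | h
    · rw [h, sub_self, norm_zero]; positivity
    · have h1 := hloc S (Or.inl hS) h hSρ
      rw [sigmaDeriv_of_mem_Γ hS] at h1
      linarith [hSω h]
  · have h1 := norm_sub_le (σ S - σ T - contourDeriv σ T * (S - T))
      (σ (r * T) - σ T - contourDeriv σ T * (r * T - T))
    rw [show σ S - σ T - contourDeriv σ T * (S - T) -
      (σ (r * T) - σ T - contourDeriv σ T * (r * T - T)) =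
      σ S - σ (r * T) - contourDeriv σ T * (S - r * T) by ring] at h1
    nlinarith [mul_nonneg hMω hp0.le]

end Approx

open ComplexConjugate

/-! ### The kernels -/

/-- `Ω₁(S, Z) / (S - Z)` without the factor `ψ(S)`. -/
def ker₁ (σ : ℂ → ℂ) (S Z : ℂ) : ℂ := contourDeriv σ S / (σ S - σ Z) - 1 / (S - Z)

/-- `Ω₂(S, Z) / (S - Z)` without the factor `ψ(S)`. -/
def ker₂ (σ : ℂ → ℂ) (S Z : ℂ) : ℂ :=
  Complex.I / 4 * ((contourDeriv σ S * conj (σ S - σ Z) +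
    conj (contourDeriv σ S) * conj S ^ 2 * (σ S - σ Z)) / (σ S - σ Z) ^ 2)

/-- The kernel of vanishing mean that has the modulus of the Poisson kernel. -/
def poissonPhase (S Z : ℂ) : ℂ := conj S * (1 - (‖Z‖ ^ 2 : ℝ)) / (S - Z) ^ 2

/-- The coefficient of `poissonPhase` in `ker₂` near the radius of `T`. -/
def phaseCoef (σ : ℂ → ℂ) (T : ℂ) : ℂ :=
  Complex.I / 4 * (conj (contourDeriv σ T) / contourDeriv σ T)

/-- `ker₂` without its part that tends to a multiple of the Poisson kernel. -/
def ker₂' (σ : ℂ → ℂ) (S Z : ℂ) : ℂ := ker₂ σ S Z - phaseCoef σ (Z / ‖Z‖) * poissonPhase S Z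

section Kernels

variable {σ : ℂ → ℂ}

theorem norm_phaseCoef_le (T : ℂ) : ‖phaseCoef σ T‖ ≤ 1 / 4 := by
  rw [phaseCoef, norm_mul, norm_div, norm_div, RCLike.norm_conj, Complex.norm_I]
  have := div_self_le_one ‖contourDeriv σ T‖
  norm_num
  linarith

theorem norm_poissonPhase {S Z : ℂ} (hS : S ∈ Γ) (hZ : Z ∈ 𝒰c) :
    ‖poissonPhase S Z‖ = poissonKernel 0 Z S := by
  have h : ‖Z‖ ^ 2 ≤ 1 := pow_le_one₀ (norm_nonneg _) (mem_𝒰c.1 hZ)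
  rw [poissonPhase, poissonKernel_def, norm_div, norm_mul, RCLike.norm_conj, mem_Γ.1 hS, norm_pow]
  simp only [sub_zero, mem_Γ.1 hS, one_mul, one_pow]
  congr 1
  rw [← Complex.ofReal_one, ← Complex.ofReal_sub, Complex.norm_real, Real.norm_of_nonneg]
  linarith

theorem poissonKernel_nonneg {S Z : ℂ} (hS : S ∈ Γ) (hZ : Z ∈ 𝒰c) : 0 ≤ poissonKernel 0 Z S := by
  rw [← norm_poissonPhase hS hZ]; exact norm_nonneg _

/-- Since `1 - |Z| ≤ |S - Z|` and `1 + |Z| ≤ 2`, the numerator is at most `2|S - Z|`. -/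
theorem poissonKernel_le {S Z : ℂ} (hS : S ∈ Γ) (hZ : Z ∈ 𝒰c) :
    poissonKernel 0 Z S ≤ 2 / ‖S - Z‖ := by
  rcases eq_or_ne S Z with rfl | h
  · simp [poissonKernel_def]
  have hp : 0 < ‖S - Z‖ := norm_pos_iff.2 (sub_ne_zero.2 h)
  rw [poissonKernel_def, sub_zero, sub_zero, div_le_div_iff₀ (by positivity) hp]
  have h1 := norm_sub_norm_le S Z
  have h2 := mem_𝒰c.1 hZ
  have h3 := norm_nonneg Z
  rw [mem_Γ.1 hS] at h1 ⊢
  have : 1 ^ 2 - ‖Z‖ ^ 2 ≤ 2 * ‖S - Z‖ := by nlinarith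
  nlinarith

theorem norm_ker₁_le (S Z : ℂ) :
    ‖ker₁ σ S Z‖ ≤ ‖contourDeriv σ S‖ / ‖σ S - σ Z‖ + 1 / ‖S - Z‖ := by
  refine (norm_sub_le _ _).trans (le_of_eq ?_)
  rw [norm_div, norm_div, norm_one]

theorem norm_ker₂_le {S : ℂ} (hS : S ∈ Γ) (Z : ℂ) :
    ‖ker₂ σ S Z‖ ≤ ‖contourDeriv σ S‖ / ‖σ S - σ Z‖ / 2 := by
  rcases eq_or_ne (σ S - σ Z) 0 with h | h
  · simp [ker₂, h]
  have hw : 0 < ‖σ S - σ Z‖ := norm_pos_iff.2 h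
  have h1 : ‖contourDeriv σ S * conj (σ S - σ Z) +
      conj (contourDeriv σ S) * conj S ^ 2 * (σ S - σ Z)‖ ≤
      2 * (‖contourDeriv σ S‖ * ‖σ S - σ Z‖) := by
    refine (norm_add_le _ _).trans (le_of_eq ?_)
    rw [norm_mul, norm_mul, norm_mul, norm_pow, RCLike.norm_conj, RCLike.norm_conj,
      RCLike.norm_conj, mem_Γ.1 hS]
    ring
  rw [ker₂, norm_mul, norm_div, norm_div, Complex.norm_I, norm_pow, ← mul_div_assoc,
    div_le_iff₀ (by positivity)]
  norm_num
  calc _ ≤ 1 / 4 * (2 * (‖contourDeriv σ S‖ * ‖σ S - σ Z‖)) := by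
        norm_num at h1 ⊢; linarith
    _ = _ := by field_simp; ring

theorem norm_ker₂'_le {S Z : ℂ} (hS : S ∈ Γ) (hZ : Z ∈ 𝒰c) :
    ‖ker₂' σ S Z‖ ≤ ‖contourDeriv σ S‖ / ‖σ S - σ Z‖ + 1 / ‖S - Z‖ := by
  have h1 := norm_ker₂_le (σ := σ) hS Z
  have h2 : ‖phaseCoef σ (Z / ‖Z‖) * poissonPhase S Z‖ ≤ 1 / 4 * (2 / ‖S - Z‖) := by
    rw [norm_mul, norm_poissonPhase hS hZ]
    exact mul_le_mul (norm_phaseCoef_le _) (poissonKernel_le hS hZ) (poissonKernel_nonneg hS hZ)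
      (by norm_num)
  have h3 : 1 / 4 * (2 / ‖S - Z‖) = 1 / ‖S - Z‖ / 2 := by ring
  have h4 : 0 ≤ 1 / ‖S - Z‖ := by positivity
  have h5 : 0 ≤ ‖contourDeriv σ S‖ / ‖σ S - σ Z‖ := by positivity
  refine (norm_sub_le _ _).trans ?_
  linarith

/-- The derivative `D` and the divided difference `w/p` are both within `e` of the slope `a`. -/
theorem norm_sub_div_le {D w p a : ℂ} {e : ℝ} (hp : p ≠ 0)
    (h1 : ‖D - a‖ ≤ e) (h2 : ‖w - a * p‖ ≤ e * ‖p‖) :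
    ‖D - w / p‖ ≤ 2 * e ∧ ‖w / p - a‖ ≤ e := by
  have h3 : ‖w / p - a‖ ≤ e := by
    rw [show w / p - a = (w - a * p) / p by field_simp, norm_div]
    exact (div_le_iff₀ (norm_pos_iff.2 hp)).2 h2
  refine ⟨?_, h3⟩
  have := norm_sub_le (D - a) (w / p - a)
  rw [sub_sub_sub_cancel_right] at this
  linarith

/-- `ker₁` is the difference of the derivative and the divided difference, divided by `σ(S) - σ(Z)`.
-/
theorem norm_ker₁_le_of_approx {S Z a : ℂ} {e κ : ℝ} (hne : S ≠ Z) (hκ : 0 < κ)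
    (h1 : ‖contourDeriv σ S - a‖ ≤ e) (h2 : ‖σ S - σ Z - a * (S - Z)‖ ≤ e * ‖S - Z‖)
    (h3 : κ * ‖S - Z‖ ≤ ‖σ S - σ Z‖) : ‖ker₁ σ S Z‖ ≤ 2 * e / (κ * ‖S - Z‖) := by
  have hp : S - Z ≠ 0 := sub_ne_zero.2 hne
  have hp0 : 0 < ‖S - Z‖ := norm_pos_iff.2 hp
  have hw0 : 0 < ‖σ S - σ Z‖ := (by positivity : 0 < κ * ‖S - Z‖).trans_le h3
  have hw : σ S - σ Z ≠ 0 := norm_pos_iff.1 hw0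
  have h4 := (norm_sub_div_le hp h1 h2).1
  have h5 : ker₁ σ S Z = (contourDeriv σ S - (σ S - σ Z) / (S - Z)) / (σ S - σ Z) := by
    rw [ker₁]; field_simp
  rw [h5, norm_div]
  exact div_le_div₀ ((norm_nonneg _).trans h4) h4 (by positivity) h3

/-- Put `p = S - Z` and `δ = w/p`. For `|S| = 1` one has `conj p + conj S² p = conj S (|p|² + 1 -
|Z|²)`. With `D` replaced by `δ`, the quotient in `ker₂` is thus `(conj w/w) conj S`, which is
bounded, plus `conj δ/δ` times `poissonPhase`. The middle term on the right replaces `δ` by `a` in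
the latter coefficient, and the last one accounts for `D - δ`. -/
theorem ker₂_sub_identity {S Z D w a : ℂ} (hS : S * conj S = 1) (hp : S - Z ≠ 0) (hw : w ≠ 0)
    (ha : a ≠ 0) :
    Complex.I / 4 * ((D * conj w + conj D * conj S ^ 2 * w) / w ^ 2) -
      Complex.I / 4 * (conj a / a) * (conj S * (1 - Z * conj Z) / (S - Z) ^ 2) =
    Complex.I / 4 * (conj w / w * conj S +
      conj S * (1 - Z * conj Z) / (S - Z) ^ 2 *
        ((conj (w / (S - Z)) * a - conj a * (w / (S - Z))) / (w / (S - Z) * a)) +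
      ((D - w / (S - Z)) * conj w + conj (D - w / (S - Z)) * conj S ^ 2 * w) / w ^ 2) := by
  have hpc : conj S - conj Z ≠ 0 := by rw [← map_sub]; exact (map_ne_zero _).2 hp
  have hS0 : S ≠ 0 := left_ne_zero_of_mul_eq_one hS
  have hSc : conj S = S⁻¹ := (inv_eq_of_mul_eq_one_right hS).symm
  simp only [map_sub, map_div₀]
  rw [hSc] at hpc ⊢
  generalize conj Z = Zb at *
  generalize conj w = wb at *
  generalize conj a = ab at *
  generalize conj D = Db at *
  have hpc' : 1 - S * Zb ≠ 0 := by
    intro h; apply hpc; field_simp; rw [mul_zero]; exact h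
  field_simp
  ring

/-- After subtraction of the phase term only a bounded term and two errors proportional to `e/|S -
Z|` are left. This is the same form as the bound for `ker₁`. -/
theorem norm_ker₂'_le_of_approx {S T : ℂ} {e κ r : ℝ} (hS : S ∈ Γ) (hT : T ∈ Γ) (hr : 0 < r)
    (hr1 : r ≤ 1) (hne : S ≠ r * T) (hκ : 0 < κ) (ha : contourDeriv σ T ≠ 0)
    (h1 : ‖contourDeriv σ S - contourDeriv σ T‖ ≤ e)
    (h2 : ‖σ S - σ (r * T) - contourDeriv σ T * (S - r * T)‖ ≤ e * ‖S - r * T‖)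
    (h3 : κ * ‖S - r * T‖ ≤ ‖σ S - σ (r * T)‖) :
    ‖ker₂' σ S (r * T)‖ ≤ 2 * e / (κ * ‖S - r * T‖) + 1 := by
  -- The phase coefficient in `ker₂'` is taken at the radial projection of `Z`, here `T`, so it
  -- matches the slope of the linear approximation.
  have hTr : (r * T) / ‖(r * T : ℂ)‖ = T := by
    rw [norm_mul, mem_Γ.1 hT, mul_one, Complex.norm_real, Real.norm_of_nonneg hr.le,
      mul_div_cancel_left₀]
    exact_mod_cast hr.ne'
  set Z : ℂ := r * T with hZ
  have hZc : Z ∈ 𝒰c := by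
    rw [mem_𝒰c, hZ, norm_mul, mem_Γ.1 hT, mul_one, Complex.norm_real, Real.norm_of_nonneg hr.le]
    exact hr1
  have hp : S - Z ≠ 0 := sub_ne_zero.2 hne
  have hp0 : 0 < ‖S - Z‖ := norm_pos_iff.2 hp
  have hw0 : 0 < ‖σ S - σ Z‖ := (by positivity : 0 < κ * ‖S - Z‖).trans_le h3
  have hw : σ S - σ Z ≠ 0 := norm_pos_iff.1 hw0
  obtain ⟨h4, h5⟩ := norm_sub_div_le hp h1 h2
  have hSS : S * conj S = 1 := by
    rw [Complex.mul_conj, Complex.normSq_eq_norm_sq, mem_Γ.1 hS]; simp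
  have hph : poissonPhase S Z = conj S * (1 - Z * conj Z) / (S - Z) ^ 2 := by
    rw [poissonPhase, Complex.mul_conj, Complex.normSq_eq_norm_sq]
  rw [ker₂', hTr, ker₂, phaseCoef, hph, ker₂_sub_identity hSS hp hw ha, ← hph]
  have he : 0 ≤ e := (norm_nonneg _).trans h1
  set w := σ S - σ Z with hw'
  set a := contourDeriv σ T with ha'
  set δ := contourDeriv σ S - w / (S - Z) with hδ
  have b1 : ‖conj w / w * conj S‖ = 1 := by
    rw [norm_mul, norm_div, RCLike.norm_conj, RCLike.norm_conj, mem_Γ.1 hS, div_self hw0.ne',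
      one_mul]
  have hdκ : κ ≤ ‖w / (S - Z)‖ := by rw [norm_div, le_div_iff₀ hp0]; exact h3
  have ha0 : 0 < ‖a‖ := norm_pos_iff.2 ha
  have b2 : ‖(conj (w / (S - Z)) * a - conj a * (w / (S - Z))) / (w / (S - Z) * a)‖ ≤
      2 * e / κ := by
    have e1 : conj (w / (S - Z)) * a - conj a * (w / (S - Z)) =
        conj (w / (S - Z) - a) * a - conj a * (w / (S - Z) - a) := by
      rw [map_sub]; ring
    rw [norm_div, e1, norm_mul (w / (S - Z))]
    have e2 : ‖conj (w / (S - Z) - a) * a - conj a * (w / (S - Z) - a)‖ ≤ 2 * e * ‖a‖ := by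
      refine (norm_sub_le _ _).trans ?_
      rw [norm_mul, norm_mul, RCLike.norm_conj, RCLike.norm_conj]
      nlinarith
    refine (div_le_div₀ (by positivity) e2 (by positivity)
      (mul_le_mul_of_nonneg_right hdκ ha0.le)).trans (le_of_eq ?_)
    field_simp
  have b3 : ‖poissonPhase S Z‖ ≤ 2 / ‖S - Z‖ :=
    (norm_poissonPhase hS hZc).trans_le (poissonKernel_le hS hZc)
  have b4 : ‖(δ * conj w + conj δ * conj S ^ 2 * w) / w ^ 2‖ ≤ 4 * e / (κ * ‖S - Z‖) := by
    have e1 : ‖δ * conj w + conj δ * conj S ^ 2 * w‖ ≤ 4 * e * ‖w‖ := by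
      refine (norm_add_le _ _).trans ?_
      rw [norm_mul, norm_mul, norm_mul, norm_pow, RCLike.norm_conj, RCLike.norm_conj,
        RCLike.norm_conj, mem_Γ.1 hS]
      nlinarith
    rw [norm_div, norm_pow]
    calc _ ≤ 4 * e * ‖w‖ / ‖w‖ ^ 2 := by gcongr
      _ = 4 * e / ‖w‖ := by field_simp
      _ ≤ _ := by gcongr
  rw [norm_mul, norm_div, Complex.norm_I]
  have b5 := norm_add₃_le (a := conj w / w * conj S) (b := poissonPhase S Z *
    ((conj (w / (S - Z)) * a - conj a * (w / (S - Z))) / (w / (S - Z) * a)))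
    (c := (δ * conj w + conj δ * conj S ^ 2 * w) / w ^ 2)
  rw [b1, norm_mul] at b5
  have b6 := mul_le_mul b3 b2 (norm_nonneg _) (by positivity)
  have e6 : 2 / ‖S - Z‖ * (2 * e / κ) = 4 * (e / (κ * ‖S - Z‖)) := by field_simp; ring
  have e7 : 4 * e / (κ * ‖S - Z‖) = 4 * (e / (κ * ‖S - Z‖)) := by ring
  have e8 : 2 * e / (κ * ‖S - Z‖) = 2 * (e / (κ * ‖S - Z‖)) := by ring
  rw [e6] at b6; rw [e7] at b4; rw [e8]
  norm_num at b5 b4 b6 ⊢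
  linarith

end Kernels

/-! ### The properties common to the two kernels -/

/-- The properties of the kernels on which the estimates of the integrals depend. -/
structure IsKernel {m : ℕ} (σ : ℂ → ℂ) (X : Fin m → ℂ) (k : ℂ → ℂ → ℂ) : Prop where
  continuousOn : ∀ Z ∈ 𝒰c, ContinuousOn (fun S => k S Z) ((Γ \ range X) \ {Z})
  tendsto : ∀ S ∈ Γ, ∀ Z₀ ∈ Γ, S ≠ Z₀ → Tendsto (k S) (𝓝[𝒰] Z₀) (𝓝 (k S Z₀))
  norm_le : ∀ S ∈ Γ, ∀ Z ∈ 𝒰c,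
    ‖k S Z‖ ≤ ‖contourDeriv σ S‖ / ‖σ S - σ Z‖ + 1 / ‖S - Z‖
  norm_le_of_approx : ∀ S ∈ Γ, ∀ T ∈ Γ, ∀ e κ r : ℝ, 0 < r → r ≤ 1 → S ≠ r * T → 0 < κ →
    contourDeriv σ T ≠ 0 → ‖contourDeriv σ S - contourDeriv σ T‖ ≤ e →
    ‖σ S - σ (r * T) - contourDeriv σ T * (S - r * T)‖ ≤ e * ‖S - r * T‖ →
    κ * ‖S - r * T‖ ≤ ‖σ S - σ (r * T)‖ → ‖k S (r * T)‖ ≤ 2 * e / (κ * ‖S - r * T‖) + 1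

section IsKernel

variable {D : Set ℂ} {σ : ℂ → ℂ} {m : ℕ} {X : Fin m → ℂ} {β α γ : Fin m → ℝ}

theorem Setup.continuousOn_contourDeriv (h : Setup D σ X β α γ) (Z : ℂ) :
    ContinuousOn (contourDeriv σ) ((Γ \ range X) \ {Z}) :=
  h.condA.continuousOn.mono sdiff_subset

theorem IsConformalParam.sub_ne_zero (hσ : IsConformalParam σ D) {S Z : ℂ} (hS : S ∈ 𝒰c)
    (hZ : Z ∈ 𝒰c) (h : S ≠ Z) : σ S - σ Z ≠ 0 :=
  _root_.sub_ne_zero.2 fun h' => h (hσ.injOn hS hZ h')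

theorem IsConformalParam.continuousOn_sub (hσ : IsConformalParam σ D) (Z : ℂ) :
    ContinuousOn (fun S => σ S - σ Z) ((Γ \ range X) \ {Z}) :=
  (hσ.continuousOn.mono ((sdiff_subset.trans sdiff_subset).trans Γ_subset)).sub continuousOn_const

theorem IsConformalParam.tendsto_sub (hσ : IsConformalParam σ D) (S : ℂ) {Z₀ : ℂ}
    (hZ₀ : Z₀ ∈ 𝒰c) : Tendsto (fun Z => σ S - σ Z) (𝓝[𝒰] Z₀) (𝓝 (σ S - σ Z₀)) :=
  tendsto_const_nhds.sub ((hσ.continuousOn _ hZ₀).mono_left (nhdsWithin_mono _ 𝒰_subset))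

theorem Setup.isKernel_ker₁ (h : Setup D σ X β α γ) : IsKernel σ X (ker₁ σ) where
  continuousOn Z hZ := by
    refine ((h.continuousOn_contourDeriv Z).div (h.param.continuousOn_sub Z) fun S hS => ?_).sub
      (continuousOn_const.div (continuousOn_id.sub continuousOn_const) fun S hS => ?_)
    · exact h.param.sub_ne_zero (Γ_subset hS.1.1) hZ hS.2
    · exact sub_ne_zero.2 hS.2
  tendsto S hS Z₀ hZ₀ hne := by
    refine (tendsto_const_nhds.div (h.param.tendsto_sub S (Γ_subset hZ₀)) ?_).sub
      (tendsto_const_nhds.div (tendsto_const_nhds.sub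
        (tendsto_nhdsWithin_of_tendsto_nhds tendsto_id)) (sub_ne_zero.2 hne))
    exact h.param.sub_ne_zero (Γ_subset hS) (Γ_subset hZ₀) hne
  norm_le S _ Z _ := norm_ker₁_le S Z
  norm_le_of_approx S _ T _ e κ r _ _ hne hκ _ h1 h2 h3 :=
    (norm_ker₁_le_of_approx hne hκ h1 h2 h3).trans (by linarith)

theorem tendsto_poissonPhase {S Z₀ : ℂ} (hZ₀ : Z₀ ∈ Γ) (hne : S ≠ Z₀) :
    Tendsto (poissonPhase S) (𝓝 Z₀) (𝓝 0) := by
  have h1 : ContinuousAt (poissonPhase S) Z₀ := by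
    refine ContinuousAt.div (by fun_prop) (by fun_prop) (pow_ne_zero 2 (sub_ne_zero.2 hne))
  have h2 : poissonPhase S Z₀ = 0 := by
    simp [poissonPhase, mem_Γ.1 hZ₀]
  rw [← h2]; exact h1

theorem poissonPhase_of_mem_Γ (S : ℂ) {Z : ℂ} (hZ : Z ∈ Γ) : poissonPhase S Z = 0 := by
  simp [poissonPhase, mem_Γ.1 hZ]

theorem ker₂'_of_mem_Γ (S : ℂ) {Z : ℂ} (hZ : Z ∈ Γ) : ker₂' σ S Z = ker₂ σ S Z := by
  rw [ker₂', poissonPhase_of_mem_Γ S hZ, mul_zero, sub_zero]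

theorem continuousOn_poissonPhase (Z : ℂ) :
    ContinuousOn (fun S => poissonPhase S Z) ((Γ \ range X) \ {Z}) :=
  ContinuousOn.div (by fun_prop) (by fun_prop) fun _ hS => pow_ne_zero 2 (sub_ne_zero.2 hS.2)

theorem Setup.continuousOn_ker₂ (h : Setup D σ X β α γ) {Z : ℂ} (hZ : Z ∈ 𝒰c) :
    ContinuousOn (fun S => ker₂ σ S Z) ((Γ \ range X) \ {Z}) := by
  have h1 := h.continuousOn_contourDeriv Z
  have h2 := h.param.continuousOn_sub (X := X) Z
  have hc : Continuous (fun z : ℂ => conj z) := Complex.continuous_conj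
  refine continuousOn_const.mul (ContinuousOn.div ((h1.mul (hc.comp_continuousOn h2)).add
    (((hc.comp_continuousOn h1).mul (hc.continuousOn.pow 2)).mul h2)) (h2.pow 2) fun S hS => ?_)
  exact pow_ne_zero 2 (h.param.sub_ne_zero (Γ_subset hS.1.1) hZ hS.2)

theorem Setup.tendsto_ker₂ (h : Setup D σ X β α γ) {S Z₀ : ℂ} (hS : S ∈ Γ) (hZ₀ : Z₀ ∈ Γ)
    (hne : S ≠ Z₀) : Tendsto (ker₂ σ S) (𝓝[𝒰] Z₀) (𝓝 (ker₂ σ S Z₀)) := by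
  have h2 := h.param.tendsto_sub S (Γ_subset hZ₀)
  have hc := (Complex.continuous_conj.tendsto _).comp h2
  refine tendsto_const_nhds.mul (((tendsto_const_nhds.mul hc).add
    (tendsto_const_nhds.mul h2)).div (h2.pow 2) ?_)
  exact pow_ne_zero 2 (h.param.sub_ne_zero (Γ_subset hS) (Γ_subset hZ₀) hne)

theorem Setup.isKernel_ker₂' (h : Setup D σ X β α γ) : IsKernel σ X (ker₂' σ) where
  continuousOn Z hZ := (h.continuousOn_ker₂ hZ).sub
    (continuousOn_const.mul (continuousOn_poissonPhase Z))
  tendsto S hS Z₀ hZ₀ hne := by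
    rw [ker₂'_of_mem_Γ S hZ₀, ← sub_zero (ker₂ σ S Z₀)]
    refine (h.tendsto_ker₂ hS hZ₀ hne).sub ?_
    have h1 := (tendsto_poissonPhase hZ₀ hne).mono_left (nhdsWithin_le_nhds (s := 𝒰))
    -- No continuity of the phase coefficient is needed: it is bounded, while `poissonPhase`
    -- vanishes on the circle.
    rw [tendsto_zero_iff_norm_tendsto_zero] at h1 ⊢
    refine squeeze_zero (fun _ => norm_nonneg _) (fun Z => ?_) h1
    rw [norm_mul]
    have := norm_phaseCoef_le (σ := σ) (Z / ‖Z‖)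
    nlinarith [norm_nonneg (poissonPhase S Z)]
  norm_le S hS Z hZ := norm_ker₂'_le hS hZ
  norm_le_of_approx S hS T hT e κ r hr hr1 hne hκ ha h1 h2 h3 :=
    norm_ker₂'_le_of_approx hS hT hr hr1 hne hκ ha h1 h2 h3

/-- The point `Z` is added to the finite exceptional family. -/
theorem aestronglyMeasurable_circle_of_diff_singleton {f : ℂ → ℂ} {Z : ℂ}
    (hf : ContinuousOn f ((Γ \ range X) \ {Z})) (s : Set ℝ) :
    AEStronglyMeasurable (fun θ => f (circleMap 0 1 θ)) (volume.restrict s) := by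
  refine aestronglyMeasurable_circle (X := (Fin.cons Z X : Fin (m + 1) → ℂ)) (hf.mono ?_) s
  rintro S ⟨h1, h2⟩
  rw [Fin.range_cons] at h2
  exact ⟨⟨h1, fun h => h2 (Or.inr h)⟩, fun h => h2 (Or.inl h)⟩

/-- The constant in the modulus of continuity of `σ'` at a point `T` of the circle. -/
theorem exists_local_modulus (hm : 0 < m) {c : ℝ} {T : ℂ} (hT : T ∈ Γ \ range X) {ω : ℝ → ℝ}
    (hω : IsModulus ω)
    (hmod : ∀ Z ∈ near (Γ ∪ segment ℝ 0 T) (R X T / 2) T, Z ≠ T →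
      ‖sigmaDeriv σ Z - sigmaDeriv σ T‖ ≤
        c * (ω ‖Z - T‖ / ω (R X T / 2)) * ∏ j, ‖Z - X j‖ ^ β j) :
    ∀ V ∈ Γ ∪ segment ℝ 0 T, V ≠ T → ‖V - T‖ ≤ R X T / 2 →
      ‖sigmaDeriv σ V - contourDeriv σ T‖ ≤
        (|c| * (∏ k, ((2 : ℝ)⁻¹ ^ β k + 2 ^ β k)) * (∏ k, ‖T - X k‖ ^ β k) / ω (R X T / 2)) *
          ω ‖V - T‖ := by
  intro V hV hVT hVR
  have h1 := hmod V ⟨hV, hVR⟩ hVT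
  rw [sigmaDeriv_of_mem_Γ hT.1] at h1
  have h2 := prod_rpow_le_of_norm_sub_le hm β hT.2 hVR
  have h3 := hω.pos _ (norm_pos_iff.2 (sub_ne_zero.2 hVT))
  have h4 := hω.pos _ (half_pos (R_pos hm hT.2))
  have h5 : 0 ≤ ∏ j, ‖V - X j‖ ^ β j := Finset.prod_nonneg fun j _ => by positivity
  calc _ ≤ _ := h1
    _ ≤ |c| * (ω ‖V - T‖ / ω (R X T / 2)) * ∏ j, ‖V - X j‖ ^ β j := by
        gcongr; exact le_abs_self c
    _ ≤ |c| * (ω ‖V - T‖ / ω (R X T / 2)) *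
        ((∏ k, ((2 : ℝ)⁻¹ ^ β k + 2 ^ β k)) * ∏ k, ‖T - X k‖ ^ β k) := by gcongr
    _ = _ := by ring

/-- The near bound for the kernels. -/
theorem IsKernel.norm_le_of_modulus {k : ℂ → ℂ → ℂ} (hk : IsKernel σ X k)
    (h : Setup D σ X β α γ) {T : ℂ} (hT : T ∈ Γ \ range X) {ρ M κ : ℝ} {ω : ℝ → ℝ}
    (hω : IsModulus ω) (hM : 0 ≤ M) (hρ : ρ ≤ R X T / 2)
    (hloc : ∀ V ∈ Γ ∪ segment ℝ 0 T, V ≠ T → ‖V - T‖ ≤ ρ →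
      ‖sigmaDeriv σ V - contourDeriv σ T‖ ≤ M * ω ‖V - T‖)
    {S : ℂ} (hS : S ∈ Γ) (hSρ : ‖S - T‖ ≤ ρ) (hST : S ≠ T) {r : ℝ} (hr : 0 < r) (hr1 : r ≤ 1)
    (hrρ : 1 - r ≤ ρ) (hκ : 0 < κ) (h3 : κ * ‖S - r * T‖ ≤ ‖σ S - σ (r * T)‖) :
    ‖k S (r * T)‖ ≤ 80 * M / κ * (ω ‖S - T‖ / ‖S - T‖) + 1 := by
  have hT1 := mem_Γ.1 hT.1
  have hSp : ‖S - T‖ ≤ 2 * ‖S - r * T‖ := by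
    have h1 := norm_sub_le_norm_sub_add_norm_sub S (r * T) T
    have h2 : (r : ℂ) * T - T = ((r - 1 : ℝ) : ℂ) * T := by push_cast; ring
    rw [h2, norm_mul, hT1, mul_one, Complex.norm_real, Real.norm_of_nonpos (by linarith)] at h1
    have h3 := norm_sub_norm_le S (r * T)
    rw [mem_Γ.1 hS, norm_mul, hT1, Complex.norm_real, Real.norm_of_nonneg hr.le, mul_one] at h3
    linarith
  have hs0 : 0 < ‖S - T‖ := norm_pos_iff.2 (sub_ne_zero.2 hST)
  have hp0 : 0 < ‖S - r * T‖ := by linarith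
  have hne : S ≠ r * T := sub_ne_zero.1 (norm_pos_iff.1 hp0)
  obtain ⟨h1, h2⟩ := norm_sub_linear_le h.param hT1 hω hM (fun V hV hVρ => by
    refine h.condA.exists_deriv V ⟨hV, ?_⟩
    rintro ⟨j, rfl⟩
    have h1 := R_le (X := X) T j
    rw [norm_sub_rev] at h1
    linarith [R_pos h.card_pos hT.2]) hloc hS hSρ hr.le hr1 hrρ hne
  have h4 := hk.norm_le_of_approx S hS T hT.1 _ κ r hr hr1 hne hκ (h.condA.ne_zero T hT) h1 h2 h3
  refine h4.trans (add_le_add ?_ le_rfl)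
  -- Since `|S - rT| ≥ |S - T|/2`, almost monotonicity moves `ω(η)/η` to a point independent of `r`.
  -- The factors `20`, `2` and `2` make `80`.
  have h5 := hω.div_le (half_pos hs0) (b := ‖S - r * T‖) (by linarith)
  have h6 : ω (‖S - T‖ / 2) ≤ ω ‖S - T‖ := hω.mono (half_pos hs0) hs0 (by linarith)
  calc 2 * (10 * M * ω ‖S - r * T‖) / (κ * ‖S - r * T‖) =
        20 * M / κ * (ω ‖S - r * T‖ / ‖S - r * T‖) := by field_simp; ring
    _ ≤ 20 * M / κ * (2 * (ω ‖S - T‖ / (‖S - T‖ / 2))) := by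
        gcongr
        exact h5.trans (by gcongr)
    _ = _ := by field_simp; ring

end IsKernel

/-! ### Integrability and boundary continuity of the integrals with the two kernels -/

section Continuity

variable {D : Set ℂ} {σ : ℂ → ℂ} {m : ℕ} {X : Fin m → ℂ} {β α γ : Fin m → ℝ}

/-- If a nondecreasing `ω` stayed above `ε`, then `1/η` would be integrable at zero. -/
theorem IsModulus.exists_lt {ω : ℝ → ℝ} (hω : IsModulus ω) {a : ℝ} (ha : 0 < a)
    (hint : IntegrableOn (fun η => ω η / η) (Ioc 0 a)) {ε : ℝ} (hε : 0 < ε) :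
    ∃ η₀, 0 < η₀ ∧ ∀ η, 0 < η → η ≤ η₀ → ω η < ε := by
  by_contra! hcon
  have h1 : ∀ η, 0 < η → ε ≤ ω η := fun η hη => by
    obtain ⟨η', h0, h1, h2⟩ := hcon η hη
    exact h2.trans (hω.mono h0 hη h1)
  have h2 : IntegrableOn (fun η : ℝ => η⁻¹) (Ioc 0 a) := by
    refine Integrable.mono' (hint.const_mul ε⁻¹) measurable_inv.aestronglyMeasurable ?_
    refine (ae_restrict_mem measurableSet_Ioc).mono fun η hη => ?_
    rw [Real.norm_of_nonneg (by have := hη.1; positivity), ← div_eq_inv_mul, div_div,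
      le_div_iff₀ (mul_pos hη.1 hε)]
    have := h1 η hη.1
    have h3 := hη.1
    field_simp
    exact this
  have h3 : IntervalIntegrable (fun η : ℝ => η⁻¹) volume 0 a :=
    (intervalIntegrable_iff_integrableOn_Ioc_of_le ha.le).2 h2
  rw [intervalIntegrable_inv_iff] at h3
  rcases h3 with h | h
  · exact ha.ne h
  · exact h left_mem_uIcc

theorem R_le_add (hm : 0 < m) (Z T : ℂ) : R X Z ≤ ‖T - Z‖ + R X T := by
  obtain ⟨j, hj⟩ := exists_R_eq (X := X) hm T
  have h1 := R_le (X := X) Z j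
  have h2 := norm_sub_le_norm_sub_add_norm_sub Z T (X j)
  rw [norm_sub_rev Z T] at h2
  linarith

/-- Near a regular point of the circle `σ'` has a modulus of continuity that satisfies the Dini
condition. -/
theorem Setup.exists_modulus (h : Setup D σ X β α γ) {Z₀ : ℂ} (hZ₀ : Z₀ ∈ Γ \ range X) :
    ∃ (ω : ℝ → ℝ) (a M : ℝ), IsModulus ω ∧ 0 < a ∧ 0 ≤ M ∧
      IntegrableOn (fun η => ω η / η) (Ioc 0 a) ∧
      ∀ T ∈ Γ \ range X, ‖T - Z₀‖ ≤ R X Z₀ / 2 → ∀ V ∈ Γ ∪ segment ℝ 0 T, V ≠ T →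
        ‖V - T‖ ≤ R X T / 2 →
        ‖sigmaDeriv σ V - contourDeriv σ T‖ ≤ M * ω ‖V - T‖ := by
  obtain ⟨r₀, hr₀, -, ⟨ω₁s, hω₁s, ⟨cS, hS⟩, ⟨c₁, hc₁⟩⟩, ⟨ω₁, hω₁, hD, ⟨c₂, hc₂⟩⟩, -⟩ := h.condB
  have hm := h.card_pos
  have hR₀ := R_pos hm hZ₀.2
  set W : ℂ → ℝ := fun T => ∏ k, ‖T - X k‖ ^ β k with hW
  set CW : ℝ := ∏ k, ((2 : ℝ)⁻¹ ^ β k + 2 ^ β k) with hCW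
  have hCW0 : 0 ≤ CW := Finset.prod_nonneg fun k _ => by positivity
  have hW0 : ∀ T, 0 ≤ W T := fun T => Finset.prod_nonneg fun k _ => by positivity
  have hp₁ := hω₁s.pos (R X Z₀ / 4) (by positivity)
  have hp₂ := hω₁.pos (R X Z₀ / 4) (by positivity)
  set M₁ := |c₁| * CW * (CW * W Z₀) / ω₁s (R X Z₀ / 4) with hM₁
  set M₂ := |c₂| * CW * (CW * W Z₀) / ω₁ (R X Z₀ / 4) with hM₂
  have hM₁0 : 0 ≤ M₁ := by have := hW0 Z₀; positivity
  have hM₂0 : 0 ≤ M₂ := by have := hW0 Z₀; positivity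
  -- Adding the two moduli avoids deciding on which side of the boundary of the `r₀`-neighbourhood
  -- the points `T` lie. The value `r₀/4` is admissible in the strong Dini condition, which needs `ε
  -- < r₀/2`.
  refine ⟨fun η => ω₁s η + ω₁ η, min (r₀ / 4) 2, M₁ + M₂, hω₁s.add hω₁, by positivity,
    by positivity, ?_, ?_⟩
  · have e1 := (hS (r₀ / 4) (by positivity) (by linarith)).1.mono_set
      (Ioc_subset_Ioc_right (min_le_left (r₀ / 4) 2))
    have e2 := IntegrableOn.mono_set hD (Ioc_subset_Ioc_right (min_le_right (r₀ / 4) 2))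
    refine (e1.add e2).congr (Eventually.of_forall fun η => ?_)
    simp only [Pi.add_apply, add_div]
  · intro T hT hTZ V hV hVT hVR
    have hRT : R X Z₀ / 2 ≤ R X T := by linarith [R_le_add (X := X) hm Z₀ T]
    have hWT : W T ≤ CW * W Z₀ := prod_rpow_le_of_norm_sub_le hm β hZ₀.2 hTZ
    have hs0 : 0 < ‖V - T‖ := norm_pos_iff.2 (sub_ne_zero.2 hVT)
    have q₁ := hω₁s.pos _ hs0
    have q₂ := hω₁.pos _ hs0
    -- Constants at `T` are replaced by constants at `Z₀`: the weights are comparable and `R(T) ≥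
    -- R(Z₀)/2`.
    have key : ∀ (c : ℝ) (ω : ℝ → ℝ), IsModulus ω →
        |c| * CW * W T / ω (R X T / 2) ≤ |c| * CW * (CW * W Z₀) / ω (R X Z₀ / 4) := by
      intro c ω hω
      have h1 := hω.pos (R X Z₀ / 4) (by positivity)
      have h2 : ω (R X Z₀ / 4) ≤ ω (R X T / 2) :=
        hω.mono (show 0 < R X Z₀ / 4 by positivity) (show 0 < R X T / 2 by linarith) (by linarith)
      have h3 := hW0 T
      have h4 := hW0 Z₀
      gcongr
    by_cases hn : T ∈ nearAll Γ r₀ X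
    · have h1 := exists_local_modulus hm hT hω₁s (hc₁ T ⟨hn, hT.2⟩) V hV hVT hVR
      have h2 := mul_le_mul_of_nonneg_right (key c₁ ω₁s hω₁s) q₁.le
      have h3 : M₁ * ω₁s ‖V - T‖ ≤ (M₁ + M₂) * (ω₁s ‖V - T‖ + ω₁ ‖V - T‖) :=
        mul_le_mul (by linarith) (by linarith) q₁.le (by linarith)
      exact h1.trans (h2.trans h3)
    · have h1 := exists_local_modulus hm hT hω₁ (hc₂ T ⟨hT.1, hn⟩) V hV hVT hVR
      have h2 := mul_le_mul_of_nonneg_right (key c₂ ω₁ hω₁) q₂.le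
      have h3 : M₂ * ω₁ ‖V - T‖ ≤ (M₁ + M₂) * (ω₁s ‖V - T‖ + ω₁ ‖V - T‖) :=
        mul_le_mul (by linarith) (by linarith) q₂.le (by linarith)
      exact h1.trans (h2.trans h3)

theorem notMem_range_of_norm_sub_le {Z₀ S : ℂ} {ρ : ℝ} (hρ : ρ < R X Z₀)
    (h : ‖S - Z₀‖ ≤ ρ) : S ∉ range X := by
  rintro ⟨j, rfl⟩
  have := R_le (X := X) Z₀ j
  rw [norm_sub_rev] at this
  linarith

/-- The bound is uniform in `T` near `Z₀` and in `r`. There `|σ'(T)|` exceeds `|σ'(Z₀)|/2` and the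
error of the linear approximation has slope at most `|σ'(Z₀)|/4`, so `|σ(S) - σ(rT)|` is at least
`|σ'(Z₀)|/4` times `|S - rT|`. -/
theorem IsKernel.exists_local_bound {k : ℂ → ℂ → ℂ} (hk : IsKernel σ X k)
    (h : Setup D σ X β α γ) {Z₀ : ℂ} (hZ₀ : Z₀ ∈ Γ \ range X) :
    ∃ (ω : ℝ → ℝ) (ρ C : ℝ), IsModulus ω ∧ 0 < ρ ∧ ρ < 1 ∧ 0 ≤ C ∧ ρ < R X Z₀ ∧
      IntegrableOn (fun η => ω η / η) (Ioc 0 ρ) ∧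
      ∀ T ∈ Γ, ‖T - Z₀‖ ≤ ρ → ∀ S ∈ Γ, ‖S - T‖ ≤ ρ → S ≠ T → ∀ r : ℝ, 0 < r → r ≤ 1 →
        1 - r ≤ ρ → ‖k S (r * T)‖ ≤ C * (ω ‖S - T‖ / ‖S - T‖) + 1 := by
  obtain ⟨ω, a, M, hω, ha, hM, hint, hloc⟩ := h.exists_modulus hZ₀
  have hm := h.card_pos
  have hR₀ := R_pos hm hZ₀.2
  have ha₀ : 0 < ‖contourDeriv σ Z₀‖ := norm_pos_iff.2 (h.condA.ne_zero Z₀ hZ₀)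
  -- The threshold makes `10 M ω ≤ |σ'(Z₀)|/4`; the added `1` covers `M = 0`.
  obtain ⟨η₀, hη₀, hη⟩ := hω.exists_lt ha hint
    (ε := ‖contourDeriv σ Z₀‖ / (4 * (10 * M + 1))) (by positivity)
  have hcont := (h.condA.continuousOn Z₀ hZ₀).norm.eventually
    (lt_mem_nhds (half_lt_self ha₀))
  rw [eventually_nhdsWithin_iff, Metric.eventually_nhds_iff] at hcont
  obtain ⟨ρ₁, hρ₁, hcont⟩ := hcont
  refine ⟨ω, min (min (η₀ / 2) (ρ₁ / 2)) (min (min (R X Z₀ / 4) a) (1 / 2)),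
    80 * M / (‖contourDeriv σ Z₀‖ / 4), hω, by positivity, ?_, by positivity, ?_, ?_, ?_⟩
  · exact (min_le_right _ _).trans_lt ((min_le_right _ _).trans_lt (by norm_num))
  · exact (min_le_right _ _).trans_lt ((min_le_left _ _).trans_lt
      ((min_le_left _ _).trans_lt (by linarith)))
  · exact hint.mono_set (Ioc_subset_Ioc_right
      ((min_le_right _ _).trans ((min_le_left _ _).trans (min_le_right _ _))))
  intro T hTΓ hTZ S hS hST hne r hr hr1 hrρ
  set ρ := min (min (η₀ / 2) (ρ₁ / 2)) (min (min (R X Z₀ / 4) a) (1 / 2)) with hρ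
  have l1 : ρ ≤ η₀ / 2 := (min_le_left _ _).trans (min_le_left _ _)
  have l2 : ρ ≤ ρ₁ / 2 := (min_le_left _ _).trans (min_le_right _ _)
  have l3 : ρ ≤ R X Z₀ / 4 := (min_le_right _ _).trans ((min_le_left _ _).trans (min_le_left _ _))
  have hT : T ∈ Γ \ range X := ⟨hTΓ, notMem_range_of_norm_sub_le (by linarith) hTZ⟩
  have hRT : R X Z₀ / 2 ≤ R X T := by linarith [R_le_add (X := X) hm Z₀ T]
  have hloc' := hloc T hT (by linarith)
  have haT : ‖contourDeriv σ Z₀‖ / 2 < ‖contourDeriv σ T‖ :=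
    hcont (y := T) (by rw [dist_eq_norm]; linarith) hT
  have hloc'' : ∀ V ∈ Γ ∪ segment ℝ 0 T, V ≠ T → ‖V - T‖ ≤ ρ →
      ‖sigmaDeriv σ V - contourDeriv σ T‖ ≤ M * ω ‖V - T‖ :=
    fun V hV hVT hVρ => hloc' V hV hVT (by linarith)
  have hT1 := mem_Γ.1 hTΓ
  refine hk.norm_le_of_modulus h hT hω hM (ρ := ρ) (by linarith) hloc'' hS hST hne hr hr1 hrρ
    (by positivity) ?_
  rcases eq_or_ne S (r * T) with he | he
  · rw [← he]; simp
  have hp0 : 0 < ‖S - r * T‖ := norm_pos_iff.2 (sub_ne_zero.2 he)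
  have h2 := (norm_sub_linear_le h.param hT1 hω hM (fun V hV hVρ => by
    refine h.condA.exists_deriv V ⟨hV, ?_⟩
    exact notMem_range_of_norm_sub_le (by linarith) hVρ) hloc'' hS hST hr.le hr1 hrρ he).2
  have hpη : ‖S - r * T‖ ≤ η₀ := by
    have h3 := norm_sub_le_norm_sub_add_norm_sub S T (r * T)
    have h4 : T - r * T = ((1 - r : ℝ) : ℂ) * T := by push_cast; ring
    rw [h4, norm_mul, hT1, mul_one, Complex.norm_real, Real.norm_of_nonneg (by linarith)] at h3
    linarith
  have h5 := (hη _ hp0 hpη).le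
  rw [le_div_iff₀ (by positivity)] at h5
  have h6 : 10 * M * ω ‖S - r * T‖ ≤ ‖contourDeriv σ Z₀‖ / 4 := by
    nlinarith [hω.pos _ hp0]
  have h7 := norm_sub_norm_le (contourDeriv σ T * (S - r * T)) (σ S - σ (r * T))
  rw [norm_mul, norm_sub_rev _ (σ S - σ (r * T))] at h7
  have h8 := mul_le_mul_of_nonneg_right haT.le hp0.le
  have h9 := mul_le_mul_of_nonneg_right h6 hp0.le
  linarith

/-- The integrand of `(1/2πi) ∫_Γ ψ(S) k(S, Z) dS`, up to the constant factor. -/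
def kerIntegrand (ψ : ℂ → ℝ) (k : ℂ → ℂ → ℂ) (Z S : ℂ) : ℂ := ψ S * k S Z * S

/-- `(1/2πi) ∫_Γ ψ(S) k(S, Z) dS`. -/
def kerIntegral (ψ : ℂ → ℝ) (k : ℂ → ℂ → ℂ) (Z : ℂ) : ℂ :=
  (2 * Real.pi : ℂ)⁻¹ * ∫ θ in Ioc 0 (2 * Real.pi), kerIntegrand ψ k Z (circleMap 0 1 θ)

theorem norm_kerIntegrand (ψ : ℂ → ℝ) (k : ℂ → ℂ → ℂ) (Z : ℂ) {S : ℂ} (hS : S ∈ Γ) :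
    ‖kerIntegrand ψ k Z S‖ = |ψ S| * ‖k S Z‖ := by
  rw [kerIntegrand, norm_mul, norm_mul, mem_Γ.1 hS, mul_one, Complex.norm_real, Real.norm_eq_abs]

theorem IsKernel.aestronglyMeasurable {k : ℂ → ℂ → ℂ} (hk : IsKernel σ X k) {ψ : ℂ → ℝ}
    (hψ : ContinuousOn ψ (Γ \ range X)) {Z : ℂ} (hZ : Z ∈ 𝒰c) (s : Set ℝ) :
    AEStronglyMeasurable (fun θ => kerIntegrand ψ k Z (circleMap 0 1 θ)) (volume.restrict s) := by
  refine aestronglyMeasurable_circle_of_diff_singleton (X := X) (Z := Z) ?_ s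
  exact ((Complex.continuous_ofReal.comp_continuousOn (hψ.mono sdiff_subset)).mul
    (hk.continuousOn Z hZ)).mul continuousOn_id

theorem ae_circleMap_ne (T : ℂ) (s : Set ℝ) :
    ∀ᵐ θ ∂(volume.restrict s), circleMap 0 1 θ ≠ T := by
  filter_upwards [ae_circleMap_notMem (fun _ : Fin 1 => T) s] with θ hθ h
  exact hθ.2 ⟨0, h.symm⟩

/-- The integrand is bounded by products with exponents `β_j - γ_j` and `-γ_j`, all above `-1`. It
serves as the dominating function away from the singularity. -/
theorem Setup.integrableOn_weight (h : Setup D σ X β α γ) {ψ : ℂ → ℝ} (hψ : WeightedClass X γ ψ) :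
    IntegrableOn (fun θ => |ψ (circleMap 0 1 θ)| * (‖contourDeriv σ (circleMap 0 1 θ)‖ + 1))
      (Ioc 0 (2 * Real.pi)) := by
  obtain ⟨-, hψc, c, hc⟩ := hψ
  obtain ⟨c', hc'⟩ := h.condA.bound
  have e1 := integrableOn_circle_prod_rpow h.card_pos h.mem h.inj h.neg_one_lt_sub
  have e2 := integrableOn_circle_prod_rpow h.card_pos h.mem h.inj (e := fun j => -γ j)
    fun j => by linarith [h.γ_lt_one j]
  refine ((e1.const_mul (|c| * |c'|)).add (e2.const_mul |c|)).mono' ?_ ?_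
  · refine aestronglyMeasurable_circle (X := X)
      (f := fun S => |ψ S| * (‖contourDeriv σ S‖ + 1)) ?_ _
    exact hψc.abs.mul (h.condA.continuousOn.norm.add continuousOn_const)
  · filter_upwards [ae_circleMap_notMem X (Ioc 0 (2 * Real.pi))] with θ hθ
    set S := circleMap 0 1 θ with hS
    have hpos : ∀ j, 0 < ‖S - X j‖ := fun j =>
      norm_pos_iff.2 (sub_ne_zero.2 fun he => hθ.2 ⟨j, he.symm⟩)
    have p1 : 0 ≤ ∏ k, ‖S - X k‖ ^ (-γ k) := Finset.prod_nonneg fun k _ => by positivity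
    have p2 : 0 ≤ ∏ k, ‖S - X k‖ ^ β k := Finset.prod_nonneg fun k _ => by positivity
    have b1 : |ψ S| ≤ |c| * ∏ k, ‖S - X k‖ ^ (-γ k) :=
      (hc S hθ).trans (mul_le_mul_of_nonneg_right (le_abs_self c) p1)
    have b2 := (hc' S ⟨Γ_subset hθ.1, hθ.2⟩).trans
      (mul_le_mul_of_nonneg_right (le_abs_self c') p2)
    rw [sigmaDeriv_of_mem_Γ hθ.1] at b2
    have p3 : (∏ k, ‖S - X k‖ ^ (-γ k)) * ∏ k, ‖S - X k‖ ^ β k =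
        ∏ k, ‖S - X k‖ ^ (β k - γ k) := by
      rw [← Finset.prod_mul_distrib]
      refine Finset.prod_congr rfl fun k _ => ?_
      rw [← Real.rpow_add (hpos k)]; congr 1; ring
    rw [Real.norm_of_nonneg (by positivity)]
    simp only [Pi.add_apply]
    rw [← p3]
    calc _ ≤ (|c| * ∏ k, ‖S - X k‖ ^ (-γ k)) * (|c'| * ∏ k, ‖S - X k‖ ^ β k + 1) := by gcongr
      _ = _ := by ring

/-- The bound of the integrand away from the singularity. -/
theorem IsKernel.norm_kerIntegrand_le {k : ℂ → ℂ → ℂ} (hk : IsKernel σ X k)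
    (hσ : IsConformalParam σ D) {δ : ℝ} (hδ : 0 < δ) : ∃ C, 0 ≤ C ∧
      ∀ ψ : ℂ → ℝ, ∀ S ∈ Γ, ∀ Z ∈ 𝒰c, δ ≤ ‖S - Z‖ →
      ‖kerIntegrand ψ k Z S‖ ≤ C * (|ψ S| * (‖contourDeriv σ S‖ + 1)) := by
  obtain ⟨c, hc, hcσ⟩ := hσ.exists_le_norm_sub hδ
  refine ⟨1 / c + 1 / δ, by positivity, fun ψ S hS Z hZ hSZ => ?_⟩
  have h1 := hk.norm_le S hS Z hZ
  have h2 := hcσ S (Γ_subset hS) Z hZ hSZ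
  rw [norm_kerIntegrand ψ k Z hS]
  have h3 : ‖contourDeriv σ S‖ / ‖σ S - σ Z‖ ≤ ‖contourDeriv σ S‖ / c := by gcongr
  have h4 : 1 / ‖S - Z‖ ≤ 1 / δ := by gcongr
  have h5 : ‖k S Z‖ ≤ (1 / c + 1 / δ) * (‖contourDeriv σ S‖ + 1) := by
    have e1 : (1 / c + 1 / δ) * (‖contourDeriv σ S‖ + 1) = ‖contourDeriv σ S‖ / c + 1 / δ +
      (1 / c + 1 / δ * ‖contourDeriv σ S‖) := by ring
    have e2 : 0 ≤ 1 / c + 1 / δ * ‖contourDeriv σ S‖ := by positivity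
    linarith
  calc _ ≤ |ψ S| * ((1 / c + 1 / δ) * (‖contourDeriv σ S‖ + 1)) := by gcongr
    _ = _ := by ring

/-- The parts of the integrals over small arcs are uniformly small. -/
theorem IsKernel.exists_lintegral_near_le {k : ℂ → ℂ → ℂ} (hk : IsKernel σ X k)
    (h : Setup D σ X β α γ) {ψ : ℂ → ℝ} (hψ : ContinuousOn ψ (Γ \ range X)) {Z₀ : ℂ}
    (hZ₀ : Z₀ ∈ Γ \ range X) {ε : ENNReal} (hε : ε ≠ 0) :
    ∃ δ : ℝ, 0 < δ ∧ δ < 1 ∧ ∀ T ∈ Γ, ‖T - Z₀‖ ≤ 2 * δ → ∀ r : ℝ, 0 < r → r ≤ 1 → 1 - r ≤ δ →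
      ∫⁻ θ in Ioc 0 (2 * Real.pi), indicator {S : ℂ | ‖S - Z₀‖ ≤ δ}
        (fun S => ‖kerIntegrand ψ k (r * T) S‖ₑ) (circleMap 0 1 θ) ≤ ε := by
  obtain ⟨ω, ρ, C, hω, hρ, hρ1, hC, hρR, hint, hb⟩ := hk.exists_local_bound h hZ₀
  have hcont := (hψ Z₀ hZ₀).abs.eventually (gt_mem_nhds (lt_add_one |ψ Z₀|))
  rw [eventually_nhdsWithin_iff, Metric.eventually_nhds_iff] at hcont
  obtain ⟨ρ₁, hρ₁, hcont⟩ := hcont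
  set Cψ := |ψ Z₀| + 1 with hCψ
  have hCψ0 : 0 ≤ Cψ := by positivity
  set g : ℝ → ENNReal := fun η => ENNReal.ofReal (Cψ * (C * (ω η / η) + 1)) with hg
  have hgdec : ∀ a b, 0 < a → a ≤ b → g b ≤ 2 * g a := fun a b ha hab => by
    rw [hg, ← ENNReal.ofReal_ofNat, ← ENNReal.ofReal_mul (by norm_num)]
    refine ENNReal.ofReal_le_ofReal ?_
    have h1 := hω.div_le ha hab
    calc Cψ * (C * (ω b / b) + 1) ≤ Cψ * (C * (2 * (ω a / a)) + 2) := by gcongr; norm_num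
      _ = _ := by ring
  have hgfin : ∫⁻ η in Ioc 0 ρ, g η ≠ ⊤ := by
    have : IntegrableOn (fun η => Cψ * (C * (ω η / η) + 1)) (Ioc 0 ρ) := by
      have h1 : IntegrableOn (fun _ : ℝ => (1 : ℝ)) (Ioc 0 ρ) := integrableOn_const (by simp)
      exact ((Integrable.const_mul hint C).add h1).const_mul Cψ
    exact (Integrable.lintegral_lt_top this).ne
  have hε' : ε / (2 * ENNReal.ofReal Real.pi) ≠ 0 :=
    (ENNReal.div_pos hε (ENNReal.mul_ne_top (by simp) (by simp))).ne'
  -- Absolute continuity of the integral of the one-variable majorant `g`; the interval `(0, 3δ]`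
  -- will be short enough.
  obtain ⟨δ', hδ', hsmall⟩ := exists_pos_setLIntegral_lt_of_measure_lt hgfin hε'
  obtain ⟨t, ht0, ht⟩ : ∃ t : ℝ, 0 < t ∧ ENNReal.ofReal t < δ' := by
    rcases eq_or_ne δ' ⊤ with rfl | hne
    · exact ⟨1, one_pos, by simp⟩
    · have := ENNReal.toReal_pos hδ'.ne' hne
      exact ⟨δ'.toReal / 2, by positivity,
        (ENNReal.ofReal_lt_iff_lt_toReal (by positivity) hne).2 (by linarith)⟩
  refine ⟨min (min (t / 3) (ρ / 3)) (ρ₁ / 2), by positivity, ?_, ?_⟩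
  · exact (min_le_left _ _).trans_lt ((min_le_right _ _).trans_lt (by linarith))
  set δ := min (min (t / 3) (ρ / 3)) (ρ₁ / 2) with hδ
  have l1 : δ ≤ t / 3 := (min_le_left _ _).trans (min_le_left _ _)
  have l2 : δ ≤ ρ / 3 := (min_le_left _ _).trans (min_le_right _ _)
  have l3 : δ ≤ ρ₁ / 2 := min_le_right _ _
  have hδ0 : 0 < δ := by positivity
  intro T hT hTZ r hr hr1 hrδ
  -- The `δ`-arc around `Z₀` lies in the `3δ`-arc around `T`, where the majorant depends on `|S -
  -- T|` alone. Hence the uniformity in `T` and `r`.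
  have hpt : ∀ S ∈ Γ, S ≠ T → indicator {S : ℂ | ‖S - Z₀‖ ≤ δ}
      (fun S => ‖kerIntegrand ψ k (r * T) S‖ₑ) S ≤
      indicator {S : ℂ | ‖S - T‖ ≤ 3 * δ} (fun S => g ‖S - T‖) S := by
    intro S hS hST
    by_cases hSZ : ‖S - Z₀‖ ≤ δ
    · have hST' : ‖S - T‖ ≤ 3 * δ := by
        have := norm_sub_le_norm_sub_add_norm_sub S Z₀ T
        rw [norm_sub_rev Z₀ T] at this; linarith
      rw [indicator_of_mem (by exact hSZ), indicator_of_mem (by exact hST'),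
        ← ofReal_norm, hg]
      refine ENNReal.ofReal_le_ofReal ?_
      rw [norm_kerIntegrand _ _ _ hS]
      have h1 := hb T hT (by linarith) S hS (by linarith) hST r hr hr1 (by linarith)
      have h2 := hcont (y := S) (by rw [dist_eq_norm]; linarith)
        ⟨hS, notMem_range_of_norm_sub_le (by linarith) hSZ⟩
      exact mul_le_mul h2.le h1 (norm_nonneg _) hCψ0
    · rw [indicator_of_notMem (by exact hSZ)]; exact zero_le
  have h1 : ∫⁻ θ in Ioc 0 (2 * Real.pi), indicator {S : ℂ | ‖S - Z₀‖ ≤ δ}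
        (fun S => ‖kerIntegrand ψ k (r * T) S‖ₑ) (circleMap 0 1 θ) ≤
      ∫⁻ θ in Ioc 0 (2 * Real.pi),
        indicator {S : ℂ | ‖S - T‖ ≤ 3 * δ} (fun S => g ‖S - T‖) (circleMap 0 1 θ) :=
    lintegral_mono_ae ((ae_circleMap_ne T _).mono fun θ hθ => hpt _ (circleMap_mem_Γ θ) hθ)
  refine h1.trans ((lintegral_circle_le (by simp) hgdec (mem_Γ.1 hT) (3 * δ)).trans ?_)
  have h2 : ∫⁻ η in Ioc 0 (3 * δ), g η ≤ ε / (2 * ENNReal.ofReal Real.pi) := by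
    have h3 := hsmall (Ioc 0 (3 * δ)) (by
      refine (Measure.restrict_apply_le _ _).trans_lt ?_
      rw [Real.volume_Ioc]
      exact (ENNReal.ofReal_le_ofReal (by linarith)).trans_lt ht)
    rw [Measure.restrict_restrict measurableSet_Ioc, Ioc_inter_Ioc, max_self,
      min_eq_left (by linarith)] at h3
    exact h3.le
  exact ENNReal.mul_le_of_le_div' h2

theorem measurableSet_near (Z : ℂ) (δ : ℝ) :
    MeasurableSet {θ : ℝ | ‖circleMap 0 1 θ - Z‖ ≤ δ} :=
  measurableSet_le ((continuous_circleMap 0 1).sub continuous_const).norm.measurable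
    measurable_const

theorem IsKernel.integrableOn_of_mem_𝒰 {k : ℂ → ℂ → ℂ} (hk : IsKernel σ X k)
    (h : Setup D σ X β α γ) {ψ : ℂ → ℝ} (hψ : WeightedClass X γ ψ) {Z : ℂ} (hZ : Z ∈ 𝒰) :
    IntegrableOn (fun θ => kerIntegrand ψ k Z (circleMap 0 1 θ)) (Ioc 0 (2 * Real.pi)) := by
  have hZ1 := mem_𝒰.1 hZ
  obtain ⟨C, -, hCb⟩ := hk.norm_kerIntegrand_le h.param (δ := 1 - ‖Z‖) (by linarith)
  refine Integrable.mono' ((h.integrableOn_weight hψ).const_mul C)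
    (hk.aestronglyMeasurable hψ.2.1 (𝒰_subset hZ) _) (Eventually.of_forall fun θ => ?_)
  refine hCb ψ _ (circleMap_mem_Γ θ) Z (𝒰_subset hZ) ?_
  have := norm_sub_norm_le (circleMap 0 1 θ) Z
  rwa [norm_circleMap_one] at this

/-- Small-arc bound near `Z₀`, weight bound elsewhere. Absolute integrability is what turns the
principal values into ordinary integrals. -/
theorem IsKernel.integrableOn_of_mem_Γ {k : ℂ → ℂ → ℂ} (hk : IsKernel σ X k)
    (h : Setup D σ X β α γ) {ψ : ℂ → ℝ} (hψ : WeightedClass X γ ψ) {Z₀ : ℂ}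
    (hZ₀ : Z₀ ∈ Γ \ range X) :
    IntegrableOn (fun θ => kerIntegrand ψ k Z₀ (circleMap 0 1 θ)) (Ioc 0 (2 * Real.pi)) := by
  obtain ⟨δ, hδ, -, hnear⟩ := hk.exists_lintegral_near_le h hψ.2.1 hZ₀ (ε := 1) one_ne_zero
  have hn := hnear Z₀ hZ₀.1 (by simp; positivity) 1 one_pos le_rfl (by simp; positivity)
  rw [Complex.ofReal_one, one_mul] at hn
  obtain ⟨C, hC, hCb⟩ := hk.norm_kerIntegrand_le h.param hδ
  have hw := (h.integrableOn_weight hψ).const_mul C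
  refine ⟨hk.aestronglyMeasurable hψ.2.1 (Γ_subset hZ₀.1) _, ?_⟩
  have hle : ∀ θ : ℝ, ‖kerIntegrand ψ k Z₀ (circleMap 0 1 θ)‖ₑ ≤
      indicator {S : ℂ | ‖S - Z₀‖ ≤ δ} (fun S => ‖kerIntegrand ψ k Z₀ S‖ₑ) (circleMap 0 1 θ) +
      ENNReal.ofReal (C * (|ψ (circleMap 0 1 θ)| *
        (‖contourDeriv σ (circleMap 0 1 θ)‖ + 1))) := by
    intro θ
    by_cases hd : ‖circleMap 0 1 θ - Z₀‖ ≤ δ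
    · rw [indicator_of_mem (by exact hd)]; exact le_self_add
    · rw [indicator_of_notMem (by exact hd), zero_add, ← ofReal_norm]
      exact ENNReal.ofReal_le_ofReal
        (hCb ψ _ (circleMap_mem_Γ θ) Z₀ (Γ_subset hZ₀.1) (not_le.1 hd).le)
  refine (lintegral_mono hle).trans_lt ?_
  rw [lintegral_add_right' _ hw.aestronglyMeasurable.aemeasurable.ennreal_ofReal]
  exact ENNReal.add_lt_top.2 ⟨hn.trans_lt ENNReal.one_lt_top, hw.lintegral_lt_top⟩

theorem norm_setIntegral_near_le {f : ℂ → ℂ} {Z₀ : ℂ} {δ ε : ℝ} (hε : 0 ≤ ε)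
    (hle : ∫⁻ θ in Ioc 0 (2 * Real.pi), indicator {S : ℂ | ‖S - Z₀‖ ≤ δ}
        (fun S => ‖f S‖ₑ) (circleMap 0 1 θ) ≤ ENNReal.ofReal ε) :
    ‖∫ θ in Ioc 0 (2 * Real.pi), indicator {S : ℂ | ‖S - Z₀‖ ≤ δ} f (circleMap 0 1 θ)‖ ≤ ε := by
  refine (norm_integral_le_lintegral_norm _).trans ?_
  refine ENNReal.toReal_le_of_le_ofReal hε (le_trans (lintegral_mono fun θ => ?_) hle)
  rw [ofReal_norm]
  by_cases hd : ‖circleMap 0 1 θ - Z₀‖ ≤ δ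
  · rw [indicator_of_mem (by exact hd), indicator_of_mem (by exact hd)]
  · rw [indicator_of_notMem (by exact hd), enorm_zero]; exact zero_le

/-- Polar decomposition of the points of the disk near the point `Z₀` of the circle. -/
theorem exists_polar {Z Z₀ : ℂ} {δ : ℝ} (hδ : δ < 1) (hZ : Z ∈ 𝒰c) (hZ₀ : Z₀ ∈ Γ)
    (hd : ‖Z - Z₀‖ ≤ δ) :
    ∃ T ∈ Γ, ∃ r : ℝ, 0 < r ∧ r ≤ 1 ∧ r = ‖Z‖ ∧ Z = r * T ∧ 1 - r ≤ δ ∧ ‖T - Z₀‖ ≤ 2 * δ := by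
  have h1 := norm_sub_norm_le Z₀ Z
  rw [norm_sub_rev, mem_Γ.1 hZ₀] at h1
  have hr : 0 < ‖Z‖ := by linarith
  have hrc : ((‖Z‖ : ℝ) : ℂ) ≠ 0 := by exact_mod_cast hr.ne'
  have hT : ‖Z / ‖Z‖‖ = 1 := by
    rw [norm_div, Complex.norm_real, norm_norm, div_self hr.ne']
  have hZT : Z = (‖Z‖ : ℝ) * (Z / ‖Z‖) := by field_simp
  refine ⟨Z / ‖Z‖, mem_Γ.2 hT, ‖Z‖, hr, mem_𝒰c.1 hZ, rfl, hZT, by linarith, ?_⟩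
  have h2 : ‖Z / ‖Z‖ - Z‖ ≤ δ := by
    have h3 : Z / ‖Z‖ - Z = ((1 - ‖Z‖ : ℝ) : ℂ) * (Z / ‖Z‖) := by
      push_cast; field_simp
    rw [h3, norm_mul, hT, mul_one, Complex.norm_real,
      Real.norm_of_nonneg (by linarith [mem_𝒰c.1 hZ])]
    linarith
  have := norm_sub_le_norm_sub_add_norm_sub (Z / ‖Z‖) Z Z₀
  linarith

/-- The integrals with the kernel `k` are continuous up to the regular points of the circle. -/
theorem IsKernel.tendsto_kerIntegral {k : ℂ → ℂ → ℂ} (hk : IsKernel σ X k)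
    (h : Setup D σ X β α γ) {ψ : ℂ → ℝ} (hψ : WeightedClass X γ ψ) {Z₀ : ℂ}
    (hZ₀ : Z₀ ∈ Γ \ range X) :
    Tendsto (kerIntegral ψ k) (𝓝[𝒰] Z₀) (𝓝 (kerIntegral ψ k Z₀)) := by
  refine tendsto_const_nhds.mul ?_
  rw [Metric.tendsto_nhds]
  intro ε hε
  obtain ⟨δ, hδ, hδ1, hnear⟩ := hk.exists_lintegral_near_le h hψ.2.1 hZ₀
    (ε := ENNReal.ofReal (ε / 4)) (ENNReal.ofReal_pos.2 (by positivity)).ne'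
  have hn : ∀ Z ∈ 𝒰c, ‖Z - Z₀‖ ≤ δ → ‖∫ θ in Ioc 0 (2 * Real.pi),
      indicator {S : ℂ | ‖S - Z₀‖ ≤ δ} (kerIntegrand ψ k Z) (circleMap 0 1 θ)‖ ≤ ε / 4 := by
    intro Z hZ hd
    obtain ⟨T, hT, r, hr, hr1, -, hZr, hrδ, hTZ⟩ := exists_polar hδ1 hZ hZ₀.1 hd
    rw [hZr]
    exact norm_setIntegral_near_le (by positivity) (hnear T hT hTZ r hr hr1 hrδ)
  -- Off the `δ`-arc, `|S - Z| ≥ δ/2` as soon as `|Z - Z₀| ≤ δ/2`, so the far part converges by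
  -- domination.
  obtain ⟨C, hC, hCb⟩ := hk.norm_kerIntegrand_le h.param (half_pos hδ)
  have hms := measurableSet_near Z₀ δ
  have hfar : Tendsto (fun Z => ∫ θ in Ioc 0 (2 * Real.pi),
      indicator {S : ℂ | ‖S - Z₀‖ ≤ δ}ᶜ (kerIntegrand ψ k Z) (circleMap 0 1 θ)) (𝓝[𝒰] Z₀)
      (𝓝 (∫ θ in Ioc 0 (2 * Real.pi),
        indicator {S : ℂ | ‖S - Z₀‖ ≤ δ}ᶜ (kerIntegrand ψ k Z₀) (circleMap 0 1 θ))) := by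
    refine tendsto_integral_filter_of_dominated_convergence _ ?_ ?_
      ((h.integrableOn_weight hψ).const_mul C) ?_
    · filter_upwards [self_mem_nhdsWithin] with Z hZ
      exact (hk.aestronglyMeasurable hψ.2.1 (𝒰_subset hZ) _).indicator hms.compl
    · filter_upwards [self_mem_nhdsWithin, mem_nhdsWithin_of_mem_nhds
        (Metric.closedBall_mem_nhds Z₀ (half_pos hδ))] with Z hZ hZd
      refine Eventually.of_forall fun θ => ?_
      by_cases hd : ‖circleMap 0 1 θ - Z₀‖ ≤ δ
      · rw [indicator_of_notMem (by simpa using hd), norm_zero]; positivity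
      · rw [indicator_of_mem (by simpa using hd)]
        refine hCb ψ _ (circleMap_mem_Γ θ) Z (𝒰_subset hZ) ?_
        rw [mem_closedBall_iff_norm] at hZd
        have := norm_sub_le_norm_sub_add_norm_sub (circleMap 0 1 θ) Z Z₀
        linarith
    · refine Eventually.of_forall fun θ => ?_
      by_cases hd : ‖circleMap 0 1 θ - Z₀‖ ≤ δ
      · have : circleMap 0 1 θ ∉ {S : ℂ | ‖S - Z₀‖ ≤ δ}ᶜ := by simpa using hd
        simp only [indicator_of_notMem this]
        exact tendsto_const_nhds
      · have : circleMap 0 1 θ ∈ {S : ℂ | ‖S - Z₀‖ ≤ δ}ᶜ := by simpa using hd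
        simp only [indicator_of_mem this]
        refine (tendsto_const_nhds.mul (hk.tendsto _ (circleMap_mem_Γ θ) Z₀ hZ₀.1 ?_)).mul
          tendsto_const_nhds
        intro he
        rw [he, sub_self, norm_zero] at hd
        exact hd hδ.le
  have hsplit : ∀ Z, IntegrableOn (fun θ => kerIntegrand ψ k Z (circleMap 0 1 θ))
        (Ioc 0 (2 * Real.pi)) →
      ∫ θ in Ioc 0 (2 * Real.pi), kerIntegrand ψ k Z (circleMap 0 1 θ) =
      (∫ θ in Ioc 0 (2 * Real.pi),
        indicator {S : ℂ | ‖S - Z₀‖ ≤ δ} (kerIntegrand ψ k Z) (circleMap 0 1 θ)) +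
      ∫ θ in Ioc 0 (2 * Real.pi),
        indicator {S : ℂ | ‖S - Z₀‖ ≤ δ}ᶜ (kerIntegrand ψ k Z) (circleMap 0 1 θ) := by
    intro Z hi
    refine (integral_congr_ae (Eventually.of_forall fun θ => ?_)).trans
      (integral_add (hi.indicator hms) (hi.indicator hms.compl))
    exact (congrFun (indicator_self_add_compl {S : ℂ | ‖S - Z₀‖ ≤ δ} (kerIntegrand ψ k Z))
      (circleMap 0 1 θ)).symm
  rw [Metric.tendsto_nhds] at hfar
  filter_upwards [hfar (ε / 4) (by positivity), self_mem_nhdsWithin, mem_nhdsWithin_of_mem_nhds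
        (Metric.closedBall_mem_nhds Z₀ hδ)] with Z hfZ hZ hZd
  rw [hsplit Z (hk.integrableOn_of_mem_𝒰 h hψ hZ), hsplit Z₀ (hk.integrableOn_of_mem_Γ h hψ hZ₀)]
  have n1 := hn Z (𝒰_subset hZ) (by simpa [dist_eq_norm] using hZd)
  have n2 := hn Z₀ (Γ_subset hZ₀.1) (by simp; positivity)
  rw [← dist_zero_right] at n1 n2
  have n3 := dist_triangle_right (∫ θ in Ioc 0 (2 * Real.pi),
    indicator {S : ℂ | ‖S - Z₀‖ ≤ δ} (kerIntegrand ψ k Z) (circleMap 0 1 θ))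
    (∫ θ in Ioc 0 (2 * Real.pi),
    indicator {S : ℂ | ‖S - Z₀‖ ≤ δ} (kerIntegrand ψ k Z₀) (circleMap 0 1 θ)) 0
  refine (dist_add_add_le _ _ _ _).trans_lt ?_
  linarith

end Continuity

/-! ### Growth of the integrals near the points `X_j` -/

section GrowthOfIntegrals

variable {D : Set ℂ} {σ : ℂ → ℂ} {m : ℕ} {X : Fin m → ℂ} {β α γ : Fin m → ℝ}

theorem R_eq_of_norm_sub_le (hm : 0 < m) {T : ℂ} {j : Fin m} (h : 2 * ‖T - X j‖ ≤ R₀ X) :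
    R X T = ‖T - X j‖ := by
  refine le_antisymm (R_le T j) ?_
  obtain ⟨k, hk⟩ := exists_R_eq (X := X) hm T
  rw [hk]
  rcases eq_or_ne k j with rfl | hne
  · exact le_rfl
  · have h1 := R₀_le (X := X) hne
    have h2 := norm_sub_le_norm_sub_add_norm_sub (X k) T (X j)
    rw [norm_sub_rev (X k) T] at h2
    linarith

theorem WeightedClass.exists_abs_le {ψ : ℂ → ℝ} (hψ : WeightedClass X γ ψ) (hX : ∀ j, X j ∈ Γ)
    {r : ℝ} (hr : 0 < r) (hrR : 2 * r ≤ R₀ X) (j : Fin m) :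
    ∃ C, 0 < C ∧ ∀ S ∈ Γ \ range X, ‖S - X j‖ ≤ r → |ψ S| ≤ C * ‖S - X j‖ ^ (-γ j) := by
  obtain ⟨-, -, c, hc⟩ := hψ
  obtain ⟨C, hC, hCX⟩ := exists_prod_rpow_le hX (fun j => -γ j) hr j
  refine ⟨(|c| + 1) * C, by positivity, fun Z hZ hZr => (hc Z hZ).trans ?_⟩
  rw [mul_assoc]
  have h1 := hCX Z (Γ_subset hZ.1) fun k hk => by
    have h2 := R₀_le (X := X) hk
    have h3 := norm_sub_le_norm_sub_add_norm_sub (X k) Z (X j)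
    rw [norm_sub_rev (X k) Z] at h3
    linarith
  have h2 : 0 ≤ ∏ k, ‖Z - X k‖ ^ (-γ k) := Finset.prod_nonneg fun k _ => by positivity
  exact mul_le_mul (by linarith [le_abs_self c]) h1 h2 (by positivity)

/-- Away from the singularity the distance `|S - Z|` is comparable with `|S - X| + |Z - X|`. -/
theorem add_le_mul_of_far {S Z T x : ℂ} (hTZ : ‖Z - T‖ ≤ ‖S - Z‖)
    (hfar : ‖T - x‖ / 2 < ‖S - T‖ ∨ ‖T - x‖ / 2 < ‖Z - T‖) :
    ‖S - x‖ + ‖Z - x‖ ≤ 13 * ‖S - Z‖ := by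
  have h1 := norm_sub_le_norm_sub_add_norm_sub S Z T
  have h2 := norm_sub_le_norm_sub_add_norm_sub S T x
  have h3 := norm_sub_le_norm_sub_add_norm_sub Z S x
  rw [norm_sub_rev Z S] at h3
  have h4 := norm_nonneg (S - Z)
  -- With `p = |S - Z|`: `|S - T| ≤ 2p`, hence `|T - x| < 4p` in either case, so `|S - x| ≤ 6p` and
  -- `|Z - x| ≤ 7p`.
  rcases hfar with h | h <;> linarith

/-- If `g ≤ b` there is no singularity at `s = 0` and the power of `s` is absorbed by `s + ρ`;
otherwise it is kept. The maximum provides the nonnegative exponent required by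
`lintegral_circle_rpow_mul_add_rpow_le`. -/
theorem rpow_mul_le_of_le_max {s ρ b g : ℝ} (hs : 0 < s) (hρ : 0 < ρ) :
    s ^ (-g) * (s ^ b * (s + ρ) ^ (-(b + 1))) ≤
      s ^ (-(max 0 (g - b))) * (s + ρ) ^ (max 0 (g - b) - g - 1) := by
  rw [← mul_assoc, ← Real.rpow_add hs]
  rcases le_total (g - b) 0 with h | h
  · rw [max_eq_left h, neg_zero, Real.rpow_zero, one_mul]
    have h1 : s ^ (-g + b) ≤ (s + ρ) ^ (-g + b) :=
      Real.rpow_le_rpow hs.le (by linarith) (by linarith)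
    calc _ ≤ (s + ρ) ^ (-g + b) * (s + ρ) ^ (-(b + 1)) := by gcongr
      _ = _ := by rw [← Real.rpow_add (by linarith)]; congr 1; ring
  · rw [max_eq_right h]
    apply le_of_eq
    congr 2 <;> ring

/-- The growth estimate for integrals of functions that satisfy the bound of the kernels away from
the singularity, and are integrable near it. -/
theorem Setup.exists_lintegral_growth (h : Setup D σ X β α γ) {ψ : ℂ → ℝ}
    (hψ : WeightedClass X γ ψ) (j : Fin m) :
    ∃ C ρ₀, 0 ≤ C ∧ 0 < ρ₀ ∧ ρ₀ ≤ 1 / 2 ∧ ∀ Z ∈ 𝒰, ‖Z - X j‖ < ρ₀ → ∀ (f : ℂ → ℂ) (C₀ : ℝ), 0 ≤ C₀ →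
      (∀ S ∈ Γ, ‖f S‖ ≤ ‖contourDeriv σ S‖ / ‖σ S - σ Z‖ + 2 / ‖S - Z‖) →
      (∀ T ∈ Γ \ range X, ∀ r : ℝ, 0 < r → r ≤ 1 → Z = r * T → 1 - r ≤ R X T / 2 →
        ∫⁻ θ in Ioc 0 (2 * Real.pi), indicator {S : ℂ | ‖S - T‖ ≤ R X T / 2}
          (fun S => ‖f S‖ₑ) (circleMap 0 1 θ) ≤ ENNReal.ofReal C₀) →
      ∫⁻ θ in Ioc 0 (2 * Real.pi), ENNReal.ofReal (|ψ (circleMap 0 1 θ)| * ‖f (circleMap 0 1 θ)‖) ≤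
        ENNReal.ofReal (C * (1 + C₀) * ‖Z - X j‖ ^ (-γ j)) := by
  obtain ⟨r₀, hr₀, hr₀R, -, -, hd⟩ := h.condB
  obtain ⟨c, hc, hdc⟩ := hd j
  obtain ⟨CD, hCD, hD⟩ := exists_norm_sigmaDeriv_le h.mem h.condA (r := 2 * r₀) (by positivity)
    (by linarith) j
  obtain ⟨Cψ, hCψ, hψb⟩ := hψ.exists_abs_le h.mem (r := 2 * r₀) (by positivity) (by linarith) j
  obtain ⟨c', hc', hσc⟩ := h.param.exists_le_norm_sub hr₀
  have hγ := h.γ_pos j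
  have hγ1 := h.γ_lt_one j
  set p := max 0 (γ j - β j) with hp
  have hp0 : 0 ≤ p := le_max_left _ _
  have hp1 : p < 1 := max_lt one_pos (by linarith [h.neg_one_lt_sub j])
  set I := ∫ θ in Ioc 0 (2 * Real.pi), |ψ (circleMap 0 1 θ)| *
    (‖contourDeriv σ (circleMap 0 1 θ)‖ + 1) with hI
  have hI0 : 0 ≤ I := setIntegral_nonneg measurableSet_Ioc fun θ _ => by positivity
  set J₁ := Real.pi * (1 / (1 - p) + 1 / γ j) with hJ₁
  set J₂ := Real.pi * (1 / (1 - γ j) + 1 / γ j) with hJ₂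
  have hJ₁0 : 0 ≤ J₁ := by
    have : 0 < 1 - p := by linarith
    positivity
  have hJ₂0 : 0 ≤ J₂ := by
    have : 0 < 1 - γ j := by linarith
    positivity
  set A := 1 / c' + 2 / r₀ with hA
  set B₁ := Cψ * (13 * CD / c) with hB₁
  set B₂ := Cψ * 26 with hB₂
  set B₃ := Cψ * 3 ^ γ j with hB₃
  refine ⟨A * I + B₁ * J₁ + B₂ * J₂ + B₃, min (r₀ / 4) (1 / 2), by positivity, by positivity,
    min_le_right _ _, ?_⟩
  intro Z hZ hZρ f C₀ hC₀ hfar hnear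
  set ρ := ‖Z - X j‖ with hρ
  have hρ1 : ρ < r₀ / 4 := hZρ.trans_le (min_le_left _ _)
  have hρ2 : ρ < 1 / 2 := hZρ.trans_le (min_le_right _ _)
  have hZne : ∀ w ∈ Γ, w ≠ Z := by
    rintro w hw rfl
    exact (mem_𝒰.1 hZ).ne (mem_Γ.1 hw)
  have hρ0 : 0 < ρ := norm_pos_iff.2 (sub_ne_zero.2 (hZne _ (h.mem j)).symm)
  obtain ⟨T, hT, r, hr, hr1, hrZ, hZr, hrρ, -⟩ := exists_polar (by linarith) (𝒰_subset hZ)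
    (h.mem j) le_rfl
  have hZT : ‖Z - T‖ = 1 - r := by
    have : Z - T = ((r - 1 : ℝ) : ℂ) * T := by rw [hZr]; push_cast; ring
    rw [this, norm_mul, mem_Γ.1 hT, mul_one, Complex.norm_real,
      Real.norm_of_nonpos (by linarith)]; ring
  have hTX : ‖T - X j‖ ≤ 2 * ρ := by
    have := norm_sub_le_norm_sub_add_norm_sub T Z (X j)
    rw [norm_sub_rev T Z] at this; linarith
  have hRT : R X T = ‖T - X j‖ := R_eq_of_norm_sub_le h.card_pos (by linarith)
  have hw := h.integrableOn_weight hψ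
  set near : ℂ → Prop := fun S => ‖S - T‖ ≤ R X T / 2 ∧ 1 - r ≤ R X T / 2 with hnear_def
  have hρneg : 1 ≤ ρ ^ (-γ j) := Real.one_le_rpow_of_pos_of_le_one_of_nonpos hρ0 (by linarith)
    (by linarith)
  -- Three regimes. Far from `X_j` the kernel is bounded by the weight. Off the arc around `T`, `|S
  -- - Z|` is comparable with `|S - X_j| + ρ` and powers suffice. On the arc only the density is
  -- estimated, the kernel being left to the hypothesis on its integral.
  have hpt : ∀ S ∈ Γ \ range X, |ψ S| * ‖f S‖ ≤ A * (|ψ S| * (‖contourDeriv σ S‖ + 1)) +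
      (B₁ * (‖S - X j‖ ^ (-p) * (‖S - X j‖ + ρ) ^ (p - γ j - 1)) +
      B₂ * (‖S - X j‖ ^ (-γ j) * (‖S - X j‖ + ρ) ^ (γ j - γ j - 1))) ∨
      (near S ∧ |ψ S| ≤ B₃ * ρ ^ (-γ j)) := by
    intro S hS
    have hs0 : 0 < ‖S - X j‖ := norm_pos_iff.2 (sub_ne_zero.2 fun he => hS.2 ⟨j, he.symm⟩)
    set s := ‖S - X j‖ with hs
    have hk := hfar S hS.1
    have t2 : 0 ≤ B₁ * (s ^ (-p) * (s + ρ) ^ (p - γ j - 1)) := by positivity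
    have t3 : 0 ≤ B₂ * (s ^ (-γ j) * (s + ρ) ^ (γ j - γ j - 1)) := by positivity
    rcases lt_or_ge (2 * r₀) s with hsr | hsr
    · left
      have h1 : r₀ ≤ ‖S - Z‖ := by
        have := norm_sub_le_norm_sub_add_norm_sub S Z (X j)
        linarith
      have h2 := hσc S (Γ_subset hS.1) Z (𝒰_subset hZ) h1
      have h3 : ‖f S‖ ≤ A * (‖contourDeriv σ S‖ + 1) := by
        refine hk.trans ?_
        have e1 : ‖contourDeriv σ S‖ / ‖σ S - σ Z‖ ≤ ‖contourDeriv σ S‖ / c' := by gcongr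
        have e2 : 2 / ‖S - Z‖ ≤ 2 / r₀ := by gcongr
        have e3 : A * (‖contourDeriv σ S‖ + 1) = ‖contourDeriv σ S‖ / c' + 2 / r₀ +
          (1 / c' + 2 / r₀ * ‖contourDeriv σ S‖) := by rw [hA]; ring
        have e4 : 0 ≤ 1 / c' + 2 / r₀ * ‖contourDeriv σ S‖ := by positivity
        linarith
      have h4 : |ψ S| * ‖f S‖ ≤ A * (|ψ S| * (‖contourDeriv σ S‖ + 1)) :=
        calc _ ≤ |ψ S| * (A * (‖contourDeriv σ S‖ + 1)) := by gcongr
          _ = _ := by ring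
      linarith
    · have hψS := hψb S hS hsr
      by_cases hn : near S
      · right
        refine ⟨hn, hψS.trans ?_⟩
        rw [hB₃, mul_assoc]
        refine mul_le_mul_of_nonneg_left ?_ hCψ.le
        have h1 := norm_sub_le_norm_sub_add_norm_sub T S (X j)
        rw [norm_sub_rev T S] at h1
        have h2 := norm_sub_le_norm_sub_add_norm_sub Z T (X j)
        have h3 := hn.1
        have h4 := hn.2
        rw [hRT] at h3 h4
        -- With `t = |T - X_j|`, both `S` and `Z` are within `t/2` of `T`, so `s ≥ t/2` and `ρ ≤
        -- 3t/2`.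
        have h5 : ρ / 3 ≤ s := by linarith
        calc s ^ (-γ j) ≤ (ρ / 3) ^ (-γ j) :=
              Real.rpow_le_rpow_of_nonpos (by positivity) h5 (by linarith)
          _ = _ := by
              rw [Real.div_rpow hρ0.le (by norm_num), Real.rpow_neg (by norm_num : (0 : ℝ) ≤ 3),
                div_inv_eq_mul, mul_comm]
      · left
        have hp0' : 0 < ‖S - Z‖ := norm_pos_iff.2 (sub_ne_zero.2 (hZne S hS.1))
        have hrp : ‖Z - T‖ ≤ ‖S - Z‖ := by
          have := norm_sub_norm_le S Z
          rw [mem_Γ.1 hS.1, ← hrZ] at this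
          rw [hZT]; exact this
        have h13 : s + ρ ≤ 13 * ‖S - Z‖ := by
          refine add_le_mul_of_far hrp ?_
          by_contra! hcon
          refine hn ⟨?_, ?_⟩
          · rw [hRT]; exact hcon.1
          · rw [hRT, ← hZT]; exact hcon.2
        have hZX : Z ∉ range X := by rintro ⟨k, hk⟩; exact hZne _ (h.mem k) hk
        have hdb := hdc Z ⟨⟨𝒰_subset hZ, by linarith⟩, hZX⟩ S ⟨⟨hS.1, hsr⟩, hS.2⟩ (hZne S hS.1)
        rw [d, norm_div, le_div_iff₀ hp0'] at hdb
        have hDS := hD S ⟨Γ_subset hS.1, hS.2⟩ hsr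
        rw [sigmaDeriv_of_mem_Γ hS.1] at hDS
        have hsρ : 0 < s + ρ := by positivity
        -- The lower bound on the divided difference, multiplied by `|S - Z| ≥ (s + ρ)/13`.
        have hwlow : c / 13 * (s + ρ) ^ (β j + 1) ≤ ‖σ S - σ Z‖ := by
          refine le_trans ?_ hdb
          rw [Real.rpow_add_one hsρ.ne']
          calc c / 13 * ((s + ρ) ^ β j * (s + ρ)) ≤
                c / 13 * ((s + ρ) ^ β j * (13 * ‖S - Z‖)) := by gcongr
            _ = _ := by ring
        have e1 : ‖contourDeriv σ S‖ / ‖σ S - σ Z‖ ≤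
            13 * CD / c * (s ^ β j * (s + ρ) ^ (-(β j + 1))) := by
          calc _ ≤ CD * s ^ β j / (c / 13 * (s + ρ) ^ (β j + 1)) := by gcongr
            _ = _ := by rw [Real.rpow_neg hsρ.le]; field_simp
        have e2 : 2 / ‖S - Z‖ ≤ 26 * (s + ρ) ^ (γ j - γ j - 1) := by
          rw [sub_self, zero_sub, Real.rpow_neg_one, div_le_iff₀ hp0', ← div_eq_mul_inv,
            div_mul_eq_mul_div, le_div_iff₀ hsρ]
          linarith
        have e3 := rpow_mul_le_of_le_max (b := β j) (g := γ j) hs0 hρ0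
        have h5 : |ψ S| * ‖f S‖ ≤ Cψ * s ^ (-γ j) *
            (13 * CD / c * (s ^ β j * (s + ρ) ^ (-(β j + 1))) +
              26 * (s + ρ) ^ (γ j - γ j - 1)) :=
          mul_le_mul hψS (by linarith) (norm_nonneg _) (by positivity)
        have h6 := mul_le_mul_of_nonneg_left e3 (show 0 ≤ B₁ by positivity)
        have t1 : 0 ≤ A * (|ψ S| * (‖contourDeriv σ S‖ + 1)) := by positivity
        have h7 : Cψ * s ^ (-γ j) * (13 * CD / c * (s ^ β j * (s + ρ) ^ (-(β j + 1))) +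
              26 * (s + ρ) ^ (γ j - γ j - 1)) =
            B₁ * (s ^ (-γ j) * (s ^ β j * (s + ρ) ^ (-(β j + 1)))) +
            B₂ * (s ^ (-γ j) * (s + ρ) ^ (γ j - γ j - 1)) := by rw [hB₁, hB₂]; ring
        linarith
  -- the integral of the part near the singularity
  have hN : ∃ N : ℝ → ENNReal, (∀ θ, near (circleMap 0 1 θ) → ‖f (circleMap 0 1 θ)‖ₑ ≤ N θ) ∧
      ∫⁻ θ in Ioc 0 (2 * Real.pi), N θ ≤ ENNReal.ofReal C₀ := by
    by_cases hr2 : 1 - r ≤ R X T / 2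
    · refine ⟨fun θ => indicator {S : ℂ | ‖S - T‖ ≤ R X T / 2}
          (fun S => ‖f S‖ₑ) (circleMap 0 1 θ), fun θ hθ => ?_, hnear T ⟨hT, ?_⟩ r hr hr1 hZr hr2⟩
      · simp only [indicator_of_mem (show circleMap 0 1 θ ∈ {S : ℂ | ‖S - T‖ ≤ R X T / 2} from hθ.1)]
        exact le_rfl
      · intro hTX
        have : 0 < 1 - r := by linarith [mem_𝒰.1 hZ]
        obtain ⟨k, hk⟩ := hTX
        have := R_le (X := X) T k
        rw [hk, sub_self, norm_zero] at this
        linarith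
    · exact ⟨fun _ => 0, fun θ hθ => (hr2 hθ.2).elim, by simp⟩
  obtain ⟨N, hN1, hN2⟩ := hN
  set g₁ : ℝ → ENNReal := fun θ => ENNReal.ofReal
    (A * (|ψ (circleMap 0 1 θ)| * (‖contourDeriv σ (circleMap 0 1 θ)‖ + 1))) with hg₁
  set g₂ : ℝ → ENNReal := fun θ => ENNReal.ofReal (‖circleMap 0 1 θ - X j‖ ^ (-p) *
    (‖circleMap 0 1 θ - X j‖ + ρ) ^ (p - γ j - 1)) with hg₂
  set g₃ : ℝ → ENNReal := fun θ => ENNReal.ofReal (‖circleMap 0 1 θ - X j‖ ^ (-γ j) *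
    (‖circleMap 0 1 θ - X j‖ + ρ) ^ (γ j - γ j - 1)) with hg₃
  have hmeas : ∀ a b : ℝ, Measurable fun θ => ENNReal.ofReal (‖circleMap 0 1 θ - X j‖ ^ a *
      (‖circleMap 0 1 θ - X j‖ + ρ) ^ b) := fun a b => by
    have h1 : Measurable fun θ => ‖circleMap 0 1 θ - X j‖ :=
      ((continuous_circleMap 0 1).sub continuous_const).norm.measurable
    exact ((h1.pow_const a).mul ((h1.add_const ρ).pow_const b)).ennreal_ofReal
  have hle : ∀ᵐ θ ∂(volume.restrict (Ioc 0 (2 * Real.pi))),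
      ENNReal.ofReal (|ψ (circleMap 0 1 θ)| * ‖f (circleMap 0 1 θ)‖) ≤
      g₁ θ + (ENNReal.ofReal B₁ * g₂ θ + (ENNReal.ofReal B₂ * g₃ θ +
        ENNReal.ofReal (B₃ * ρ ^ (-γ j)) * N θ)) := by
    filter_upwards [ae_circleMap_notMem X (Ioc 0 (2 * Real.pi))] with θ hθ
    rcases hpt _ hθ with h1 | ⟨h1, h2⟩
    · refine (ENNReal.ofReal_le_ofReal h1).trans ?_
      rw [ENNReal.ofReal_add (by positivity) (by positivity),
        ENNReal.ofReal_add (by positivity) (by positivity),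
        ENNReal.ofReal_mul (by positivity : 0 ≤ B₁), ENNReal.ofReal_mul (by positivity : 0 ≤ B₂)]
      gcongr
      exact le_self_add
    · rw [ENNReal.ofReal_mul (abs_nonneg _), ofReal_norm]
      calc _ ≤ ENNReal.ofReal (B₃ * ρ ^ (-γ j)) * N θ :=
            mul_le_mul' (ENNReal.ofReal_le_ofReal h2) (hN1 θ h1)
        _ ≤ _ := le_add_self.trans (le_add_self.trans le_add_self)
  refine (lintegral_mono_ae hle).trans ?_
  rw [lintegral_add_left' (hw.const_mul A).aestronglyMeasurable.aemeasurable.ennreal_ofReal,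
    lintegral_add_left ((hmeas _ _).const_mul _), lintegral_add_left ((hmeas _ _).const_mul _),
    lintegral_const_mul' _ _ ENNReal.ofReal_ne_top, lintegral_const_mul' _ _ ENNReal.ofReal_ne_top,
    lintegral_const_mul' _ _ ENNReal.ofReal_ne_top]
  have i1 : ∫⁻ θ in Ioc 0 (2 * Real.pi), g₁ θ = ENNReal.ofReal (A * I) := by
    rw [← ofReal_integral_eq_lintegral_ofReal (hw.const_mul A)
      (Eventually.of_forall fun θ => by positivity), integral_const_mul]
  have i2 := lintegral_circle_rpow_mul_add_rpow_le hp0 hp1 hγ hρ0 (mem_Γ.1 (h.mem j))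
  have i3 := lintegral_circle_rpow_mul_add_rpow_le hγ.le hγ1 hγ hρ0 (mem_Γ.1 (h.mem j))
  rw [i1]
  calc _ ≤ ENNReal.ofReal (A * I) + (ENNReal.ofReal B₁ * ENNReal.ofReal (J₁ * ρ ^ (-γ j)) +
        (ENNReal.ofReal B₂ * ENNReal.ofReal (J₂ * ρ ^ (-γ j)) +
          ENNReal.ofReal (B₃ * ρ ^ (-γ j)) * ENNReal.ofReal C₀)) := by gcongr
    _ = ENNReal.ofReal (A * I + (B₁ * (J₁ * ρ ^ (-γ j)) + (B₂ * (J₂ * ρ ^ (-γ j)) +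
          B₃ * ρ ^ (-γ j) * C₀))) := by
        rw [← ENNReal.ofReal_mul (by positivity), ← ENNReal.ofReal_mul (by positivity),
          ← ENNReal.ofReal_mul (by positivity), ← ENNReal.ofReal_add (by positivity)
          (by positivity), ← ENNReal.ofReal_add (by positivity) (by positivity),
          ← ENNReal.ofReal_add (by positivity) (by positivity)]
    _ ≤ _ := by
        refine ENNReal.ofReal_le_ofReal ?_
        have hAI : 0 ≤ A * I := by positivity
        have hB₁J : 0 ≤ B₁ * J₁ := by positivity
        have hB₂J : 0 ≤ B₂ * J₂ := by positivity
        have hB₃0 : 0 ≤ B₃ := by positivity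
        -- The bounded contribution is absorbed because `ρ < 1/2` gives `ρ^{-γ_j} ≥ 1`.
        have q1 : A * I ≤ A * I * ρ ^ (-γ j) := le_mul_of_one_le_right hAI hρneg
        have q2 : (A * I + B₁ * J₁ + B₂ * J₂ + B₃ * C₀) * ρ ^ (-γ j) ≤
            (A * I + B₁ * J₁ + B₂ * J₂ + B₃) * (1 + C₀) * ρ ^ (-γ j) := by
          gcongr
          nlinarith
        linarith

/-- Near `X_j` the integrals of the kernels over arcs around `T` of length comparable with the
distance from `T` to `X_j` are bounded. -/
theorem IsKernel.exists_lintegral_arc_le {k : ℂ → ℂ → ℂ} (hk : IsKernel σ X k)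
    (h : Setup D σ X β α γ) (j : Fin m) :
    ∃ C ρ₀ : ℝ, 0 ≤ C ∧ 0 < ρ₀ ∧ ∀ T ∈ Γ \ range X, ‖T - X j‖ ≤ ρ₀ → ∀ r : ℝ, 0 < r → r ≤ 1 →
      1 - r ≤ R X T / 2 →
      ∫⁻ θ in Ioc 0 (2 * Real.pi), indicator {S : ℂ | ‖S - T‖ ≤ R X T / 2}
          (fun S => ‖k S (r * T)‖ₑ) (circleMap 0 1 θ) ≤ ENNReal.ofReal C := by
  obtain ⟨r₀, hr₀, hr₀R, ⟨ω, hω, ⟨cS, hS⟩, ⟨c₁, hc₁⟩⟩, -, hd⟩ := h.condB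
  obtain ⟨c, hc, hdc⟩ := hd j
  obtain ⟨C, hC, hCX⟩ := exists_prod_rpow_le h.mem β hr₀ j
  set CW : ℝ := ∏ k, ((2 : ℝ)⁻¹ ^ β k + 2 ^ β k) with hCW
  have hCW0 : 0 ≤ CW := Finset.prod_nonneg fun k _ => by positivity
  set K : ℝ := (3 : ℝ)⁻¹ ^ β j + 3 ^ β j with hK
  have hK0 : 0 < K := by positivity
  set B := 80 * (|c₁| * CW * C * K / c) with hB
  have hB0 : 0 ≤ B := by positivity
  refine ⟨2 * Real.pi * (B * |cS| + 1), r₀ / 2, by positivity, by positivity, ?_⟩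
  intro T hT hTj r hr hr1 hrR
  set t := ‖T - X j‖ with ht
  have hRT : R X T = t := R_eq_of_norm_sub_le h.card_pos (by linarith)
  have ht0 : 0 < t := hRT ▸ R_pos h.card_pos hT.2
  rw [hRT] at hrR ⊢
  have hωt := hω.pos (t / 2) (by positivity)
  set M := |c₁| * CW * (∏ k, ‖T - X k‖ ^ β k) / ω (t / 2) with hM
  have hW0 : 0 ≤ ∏ k, ‖T - X k‖ ^ β k := Finset.prod_nonneg fun k _ => by positivity
  have hloc := exists_local_modulus h.card_pos hT hω
    (hc₁ T ⟨mem_iUnion.2 ⟨j, hT.1, by linarith⟩, hT.2⟩)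
  rw [hRT] at hloc
  have hW : ∏ k, ‖T - X k‖ ^ β k ≤ C * t ^ β j := hCX T (Γ_subset hT.1) fun k hk => by
    have h2 := R₀_le (X := X) hk
    have h3 := norm_sub_le_norm_sub_add_norm_sub (X k) T (X j)
    rw [norm_sub_rev (X k) T] at h3
    linarith
  have hT1 := mem_Γ.1 hT.1
  have hrT : ‖(r : ℂ) * T - T‖ = 1 - r := by
    have : (r : ℂ) * T - T = ((r - 1 : ℝ) : ℂ) * T := by push_cast; ring
    rw [this, norm_mul, hT1, mul_one, Complex.norm_real, Real.norm_of_nonpos (by linarith)]; ring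
  have hbound : ∀ S ∈ Γ, ‖S - T‖ ≤ t / 2 → S ≠ T →
      ‖k S (r * T)‖ ≤ B / ω (t / 2) * (ω ‖S - T‖ / ‖S - T‖) + 1 := by
    intro S hSΓ hST hne
    have hs0 : 0 < ‖S - T‖ := norm_pos_iff.2 (sub_ne_zero.2 hne)
    have hωs := hω.pos _ hs0
    have hκ : 0 < c / K * t ^ β j := by positivity
    have hZX : ∀ V : ℂ, ‖V - T‖ ≤ t / 2 → V ∉ range X := fun V hV =>
      notMem_range_of_norm_sub_le (by rw [hRT]; linarith) hV
    have hlow : c / K * t ^ β j * ‖S - r * T‖ ≤ ‖σ S - σ (r * T)‖ := by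
      rcases eq_or_ne S (r * T) with he | he
      · rw [← he]; simp
      have h1 := norm_sub_le_norm_sub_add_norm_sub S T (X j)
      have h2 := norm_sub_le_norm_sub_add_norm_sub (r * T) T (X j)
      have h3 := norm_sub_le_norm_sub_add_norm_sub T S (X j)
      have h4 := norm_sub_le_norm_sub_add_norm_sub T (r * T) (X j)
      rw [norm_sub_rev T S] at h3
      rw [norm_sub_rev T (r * T)] at h4
      have hdb := hdc (r * T) ⟨⟨?_, by linarith⟩, hZX _ (by linarith)⟩ S
        ⟨⟨hSΓ, by linarith⟩, hZX S hST⟩ he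
      · rw [d, norm_div, le_div_iff₀ (norm_pos_iff.2 (sub_ne_zero.2 he))] at hdb
        refine le_trans (mul_le_mul_of_nonneg_right ?_ (norm_nonneg _)) hdb
        have h5 := rpow_le_mul_rpow (s := ‖S - X j‖ + ‖r * T - X j‖) (t := t) (K := 3)
          (by linarith) (by norm_num) (by linarith) (by linarith) (β j)
        rw [div_mul_eq_mul_div, div_le_iff₀ hK0, mul_assoc]
        refine mul_le_mul_of_nonneg_left ?_ hc.le
        rw [mul_comm]; exact h5
      · rw [mem_𝒰c, norm_mul, hT1, mul_one, Complex.norm_real, Real.norm_of_nonneg hr.le]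
        exact hr1
    refine (hk.norm_le_of_modulus h hT hω (ρ := t / 2) (M := M) (by positivity) (by rw [hRT])
      hloc hSΓ hST hne hr hr1 hrR hκ hlow).trans ?_
    refine add_le_add (mul_le_mul_of_nonneg_right ?_ (by positivity)) le_rfl
    -- The weight in `M` and the lower slope of `σ` both scale as `t^{β_j}`, so this power cancels
    -- and only `1/ω(t/2)` remains.
    rw [hM]
    calc 80 * (|c₁| * CW * (∏ k, ‖T - X k‖ ^ β k) / ω (t / 2)) / (c / K * t ^ β j) ≤
          80 * (|c₁| * CW * (C * t ^ β j) / ω (t / 2)) / (c / K * t ^ β j) := by gcongr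
      _ = B / ω (t / 2) := by rw [hB]; field_simp
  set g : ℝ → ENNReal := fun η => ENNReal.ofReal (B / ω (t / 2) * (ω η / η) + 1) with hg
  have hgdec : ∀ a b, 0 < a → a ≤ b → g b ≤ 2 * g a := fun a b ha hab => by
    rw [hg, ← ENNReal.ofReal_ofNat, ← ENNReal.ofReal_mul (by norm_num)]
    refine ENNReal.ofReal_le_ofReal ?_
    have h1 := hω.div_le ha hab
    calc B / ω (t / 2) * (ω b / b) + 1 ≤ B / ω (t / 2) * (2 * (ω a / a)) + 2 := by
          gcongr; norm_num
      _ = _ := by ring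
  have hpt : ∀ S ∈ Γ, S ≠ T → indicator {S : ℂ | ‖S - T‖ ≤ t / 2}
      (fun S => ‖k S (r * T)‖ₑ) S ≤
      indicator {S : ℂ | ‖S - T‖ ≤ t / 2} (fun S => g ‖S - T‖) S := by
    intro S hS hST
    refine indicator_le_indicator' fun hd => ?_
    rw [← ofReal_norm]
    exact ENNReal.ofReal_le_ofReal (hbound S hS hd hST)
  refine (lintegral_mono_ae ((ae_circleMap_ne T _).mono
    fun θ hθ => hpt _ (circleMap_mem_Γ θ) hθ)).trans
    ((lintegral_circle_le (by simp) hgdec hT1 (t / 2)).trans ?_)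
  obtain ⟨hint, hle⟩ := hS (t / 2) (by positivity) (by linarith)
  have h1i : IntegrableOn (fun _ : ℝ => (1 : ℝ)) (Ioc 0 (t / 2)) := integrableOn_const (by simp)
  have hgi : ∫⁻ η in Ioc 0 (t / 2), g η =
      ENNReal.ofReal (B / ω (t / 2) * (∫ η in Ioc 0 (t / 2), ω η / η) + t / 2) := by
    have hsum : IntegrableOn (fun η => B / ω (t / 2) * (ω η / η) + 1) (Ioc 0 (t / 2)) :=
      (Integrable.const_mul hint _).add h1i
    rw [hg, ← ofReal_integral_eq_lintegral_ofReal hsum,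
      integral_add (Integrable.const_mul hint _) h1i, integral_const_mul]
    · simp [max_eq_left (half_pos ht0).le]
    · refine (ae_restrict_mem measurableSet_Ioc).mono fun η hη => ?_
      have h0 : 0 < η := hη.1
      have := hω.pos η h0
      simp only [Pi.zero_apply]
      positivity
  have ht2 : t ≤ 2 := by
    have := norm_sub_le T (X j)
    rw [hT1, mem_Γ.1 (h.mem j)] at this; linarith
  rw [hgi, ← ENNReal.ofReal_ofNat, ← ENNReal.ofReal_mul (by norm_num),
    ← ENNReal.ofReal_mul (by positivity)]
  refine ENNReal.ofReal_le_ofReal ?_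
  -- The strong Dini condition bounds the integral by a multiple of `ω(t/2)`, which cancels. The
  -- plain Dini condition would not give a bound uniform in `t`.
  have e1 : B / ω (t / 2) * (∫ η in Ioc 0 (t / 2), ω η / η) ≤ B * |cS| := by
    calc _ ≤ B / ω (t / 2) * (|cS| * ω (t / 2)) := by
          gcongr
          exact hle.le.trans (mul_le_mul_of_nonneg_right (le_abs_self _) hωt.le)
      _ = _ := by field_simp
  gcongr
  linarith

theorem IsKernel.exists_kerIntegral_growth {k : ℂ → ℂ → ℂ} (hk : IsKernel σ X k)
    (h : Setup D σ X β α γ) {ψ : ℂ → ℝ} (hψ : WeightedClass X γ ψ) (j : Fin m) :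
    ∃ C, ∀ᶠ Z in 𝓝[𝒰] (X j), ‖kerIntegral ψ k Z‖ ≤ C * ‖Z - X j‖ ^ (-γ j) := by
  obtain ⟨C₀, ρ₀, hC₀, hρ₀, harc⟩ := hk.exists_lintegral_arc_le h j
  obtain ⟨C, ρ₁, hC, hρ₁, hρ₁1, hgrow⟩ := h.exists_lintegral_growth hψ j
  refine ⟨(2 * Real.pi)⁻¹ * (C * (1 + C₀)), ?_⟩
  filter_upwards [self_mem_nhdsWithin, mem_nhdsWithin_of_mem_nhds
    (Metric.ball_mem_nhds (X j) (show 0 < min ρ₁ (ρ₀ / 2) by positivity))] with Z hZ hZd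
  rw [mem_ball_iff_norm] at hZd
  have h1 := hgrow Z hZ (hZd.trans_le (min_le_left _ _)) (fun S => k S Z) C₀ hC₀
    (fun S hS => (hk.norm_le S hS Z (𝒰_subset hZ)).trans (by gcongr; norm_num))
    (fun T hT r hr hr1 hZr hrR => by
      subst hZr
      refine harc T hT ?_ r hr hr1 hrR
      have h2 := norm_sub_le_norm_sub_add_norm_sub T (r * T) (X j)
      have h3 := hZd.trans_le (min_le_right ρ₁ (ρ₀ / 2))
      have h4 : T - r * T = ((1 - r : ℝ) : ℂ) * T := by push_cast; ring
      rw [h4, norm_mul, mem_Γ.1 hT.1, mul_one, Complex.norm_real,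
        Real.norm_of_nonneg (by linarith)] at h2
      have h5 := norm_sub_norm_le (X j) (r * T)
      rw [norm_sub_rev, norm_mul, mem_Γ.1 hT.1, mem_Γ.1 (h.mem j), mul_one, Complex.norm_real,
        Real.norm_of_nonneg hr.le] at h5
      linarith)
  rw [kerIntegral, norm_mul, norm_inv, norm_mul, Complex.norm_real, Complex.norm_ofNat,
    Real.norm_of_nonneg Real.pi_pos.le, mul_assoc]
  refine mul_le_mul_of_nonneg_left ?_ (by positivity)
  refine (norm_integral_le_lintegral_norm _).trans (ENNReal.toReal_le_of_le_ofReal (by positivity)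
    (le_trans (lintegral_mono fun θ => ?_) h1))
  rw [norm_kerIntegrand _ _ _ (circleMap_mem_Γ θ)]

end GrowthOfIntegrals

/-! ### The Poisson kernel -/

section Poisson

variable {D : Set ℂ} {σ : ℂ → ℂ} {m : ℕ} {X : Fin m → ℂ} {β α γ : Fin m → ℝ}

theorem integrableOn_circle_const {E : Type*} [NormedAddCommGroup E] (c : E) :
    IntegrableOn (fun _ : ℝ => c) (Ioc 0 (2 * Real.pi)) :=
  integrableOn_const measure_Ioc_lt_top.ne

theorem continuous_poissonKernel_circle {Z : ℂ} (hZ : Z ∈ 𝒰) :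
    Continuous fun θ => poissonKernel 0 Z (circleMap 0 1 θ) := by
  simp only [poissonKernel_def, sub_zero]
  have h1 : Continuous (circleMap 0 1) := continuous_circleMap 0 1
  refine Continuous.div (by fun_prop) (by fun_prop) fun θ => ?_
  refine pow_ne_zero 2 (norm_ne_zero_iff.2 (sub_ne_zero.2 fun h => ?_))
  exact (mem_𝒰.1 hZ).ne (by rw [← h, norm_circleMap_one])

theorem integral_poissonKernel {Z : ℂ} (hZ : Z ∈ 𝒰) :
    ∫ θ in Ioc 0 (2 * Real.pi), poissonKernel 0 Z (circleMap 0 1 θ) = 2 * Real.pi := by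
  have h1 := DiffContOnCl.circleAverage_poissonKernel_smul (f := fun _ => (1 : ℂ)) (c := 0) (R := 1)
    (w := Z) diffContOnCl_const hZ
  rw [Real.circleAverage_def, intervalIntegral.integral_of_le Real.two_pi_pos.le] at h1
  simp only [Pi.smul_apply', Complex.real_smul, mul_one] at h1
  rw [integral_complex_ofReal] at h1
  have h2 : (2 * Real.pi)⁻¹ *
      ∫ θ in Ioc 0 (2 * Real.pi), poissonKernel 0 Z (circleMap 0 1 θ) = 1 := by
    exact_mod_cast h1
  have := Real.pi_pos
  field_simp at h2
  linarith

theorem sub_ne_zero_of_mem_𝒰 {Z : ℂ} (hZ : Z ∈ 𝒰) (θ : ℝ) : circleMap 0 1 θ - Z ≠ 0 :=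
  sub_ne_zero.2 fun h => (mem_𝒰.1 hZ).ne (by rw [← h, norm_circleMap_one])

theorem circleMap_mul_conj (θ : ℝ) : circleMap 0 1 θ * conj (circleMap 0 1 θ) = 1 := by
  rw [Complex.mul_conj, Complex.normSq_eq_norm_sq, norm_circleMap_one]; simp

/-- On the circle `conj S = 1/S`, so up to a constant factor the integrand is the conjugate of
`S²/(1 - conj Z · S)²`. This is holomorphic on the closed disk and vanishes at `0`, so its mean is
zero. -/
theorem integral_poissonPhase {Z : ℂ} (hZ : Z ∈ 𝒰) :
    ∫ θ in Ioc 0 (2 * Real.pi),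
      poissonPhase (circleMap 0 1 θ) Z * circleMap 0 1 θ = 0 := by
  have hne : ∀ S ∈ 𝒰c, 1 - conj Z * S ≠ 0 := fun S hS h => by
    have h1 : ‖conj Z * S‖ = 1 := by rw [← sub_eq_zero.1 h, norm_one]
    rw [norm_mul, RCLike.norm_conj] at h1
    have := mem_𝒰.1 hZ
    have := mem_𝒰c.1 hS
    nlinarith [norm_nonneg Z, norm_nonneg S]
  have hd : DiffContOnCl ℂ (fun S : ℂ => S ^ 2 / (1 - conj Z * S) ^ 2) (Metric.ball 0 |1|) := by
    rw [abs_one]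
    refine DifferentiableOn.diffContOnCl ?_
    rw [closure_ball _ one_ne_zero]
    exact DifferentiableOn.div (by fun_prop) (by fun_prop) fun S hS => pow_ne_zero 2 (hne S hS)
  have h1 := hd.circleAverage
  rw [Real.circleAverage_def, intervalIntegral.integral_of_le Real.two_pi_pos.le] at h1
  norm_num at h1
  have h2 := congrArg conj h1
  rw [← integral_conj, map_zero] at h2
  have h3 : ∀ θ : ℝ, poissonPhase (circleMap 0 1 θ) Z * circleMap 0 1 θ =
      (1 - (‖Z‖ ^ 2 : ℝ)) *
        conj (circleMap 0 1 θ ^ 2 / (1 - conj Z * circleMap 0 1 θ) ^ 2) := fun θ => by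
    have h4 := circleMap_mul_conj θ
    have h5 := sub_ne_zero_of_mem_𝒰 hZ θ
    rw [poissonPhase]
    simp only [map_div₀, map_pow, map_sub, map_mul, map_one, Complex.conj_conj]
    set S := circleMap 0 1 θ
    have h6 : 1 - Z * conj S = conj S * (S - Z) := by linear_combination -h4
    have h7 : conj S ≠ 0 := right_ne_zero_of_mul_eq_one h4
    rw [h6]
    field_simp
    linear_combination (1 - ((‖Z‖ ^ 2 : ℝ) : ℂ)) * h4
  simp only [h3]
  rw [integral_const_mul, h2, mul_zero]

theorem Setup.integrableOn_density (h : Setup D σ X β α γ) {ψ : ℂ → ℝ}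
    (hψ : WeightedClass X γ ψ) :
    IntegrableOn (fun θ => ψ (circleMap 0 1 θ)) (Ioc 0 (2 * Real.pi)) := by
  refine (h.integrableOn_weight hψ).mono' (aestronglyMeasurable_circle hψ.2.1 _)
    (Eventually.of_forall fun θ => ?_)
  rw [Real.norm_eq_abs]
  have := norm_nonneg (contourDeriv σ (circleMap 0 1 θ))
  exact le_mul_of_one_le_right (abs_nonneg _) (by linarith)

theorem integrableOn_mul_circle {f : ℝ → ℂ} (hf : IntegrableOn f (Ioc 0 (2 * Real.pi)))
    {g : ℝ → ℂ} (hg : Continuous g) :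
    IntegrableOn (fun θ => f θ * g θ) (Ioc 0 (2 * Real.pi)) := by
  obtain ⟨C, hC⟩ := (isCompact_Icc (a := (0 : ℝ)) (b := 2 * Real.pi)).exists_bound_of_continuousOn
    hg.continuousOn
  refine (hf.norm.const_mul C).mono' (hf.aestronglyMeasurable.mul
    hg.aestronglyMeasurable) ?_
  refine (ae_restrict_mem measurableSet_Ioc).mono fun θ hθ => ?_
  rw [norm_mul, mul_comm]
  exact mul_le_mul_of_nonneg_right (hC θ ⟨hθ.1.le, hθ.2⟩) (norm_nonneg _)

theorem integrableOn_mul_poissonKernel {f : ℝ → ℝ} (hf : IntegrableOn f (Ioc 0 (2 * Real.pi)))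
    {Z : ℂ} (hZ : Z ∈ 𝒰) :
    IntegrableOn (fun θ => f θ * poissonKernel 0 Z (circleMap 0 1 θ)) (Ioc 0 (2 * Real.pi)) := by
  have h1 : IntegrableOn (fun θ => (f θ : ℂ)) (Ioc 0 (2 * Real.pi)) := hf.ofReal
  have h2 := integrableOn_mul_circle h1
    (Complex.continuous_ofReal.comp (continuous_poissonKernel_circle hZ))
  have h3 := h2.re
  refine h3.congr (Eventually.of_forall fun θ => ?_)
  simp

/-- The Poisson kernel is an approximate identity. -/
theorem tendsto_integral_abs_sub_mul_poissonKernel {ψ : ℂ → ℝ}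
    (hi : IntegrableOn (fun θ => ψ (circleMap 0 1 θ)) (Ioc 0 (2 * Real.pi)))
    (hψ : ContinuousOn ψ (Γ \ range X)) {Z₀ : ℂ} (hZ₀ : Z₀ ∈ Γ \ range X) :
    Tendsto (fun Z => ∫ θ in Ioc 0 (2 * Real.pi),
      |ψ (circleMap 0 1 θ) - ψ Z₀| * poissonKernel 0 Z (circleMap 0 1 θ)) (𝓝[𝒰] Z₀) (𝓝 0) := by
  have hi' : IntegrableOn (fun θ => |ψ (circleMap 0 1 θ) - ψ Z₀|) (Ioc 0 (2 * Real.pi)) :=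
    (hi.sub (integrableOn_circle_const _)).abs
  rw [Metric.tendsto_nhds]
  intro ε hε
  have hπ := Real.pi_pos
  have hcont := Metric.continuousWithinAt_iff.1 (hψ Z₀ hZ₀) (ε / (4 * Real.pi)) (by positivity)
  obtain ⟨δ, hδ, hcont⟩ := hcont
  set I := ∫ θ in Ioc 0 (2 * Real.pi), |ψ (circleMap 0 1 θ) - ψ Z₀| with hI
  have hlim : Tendsto (fun Z : ℂ => (1 - ‖Z‖ ^ 2) * (4 / δ ^ 2) * I) (𝓝[𝒰] Z₀) (𝓝 0) := by
    have h1 : Continuous fun Z : ℂ => (1 - ‖Z‖ ^ 2) * (4 / δ ^ 2) * I := by fun_prop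
    have h2 := (h1.tendsto Z₀).mono_left (nhdsWithin_le_nhds (s := 𝒰))
    rwa [mem_Γ.1 hZ₀.1, one_pow, sub_self, zero_mul, zero_mul] at h2
  rw [Metric.tendsto_nhds] at hlim
  filter_upwards [self_mem_nhdsWithin, mem_nhdsWithin_of_mem_nhds
    (Metric.ball_mem_nhds Z₀ (half_pos hδ)), hlim (ε / 2) (by positivity)] with Z hZ hZd hZl
  have hZ1 := mem_𝒰.1 hZ
  have hZ2 : 0 ≤ 1 - ‖Z‖ ^ 2 := by nlinarith [norm_nonneg Z]
  have hI0 : 0 ≤ I := integral_nonneg fun θ => abs_nonneg _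
  have hpt : ∀ᵐ θ ∂(volume.restrict (Ioc 0 (2 * Real.pi))),
      |ψ (circleMap 0 1 θ) - ψ Z₀| * poissonKernel 0 Z (circleMap 0 1 θ) ≤
      ε / (4 * Real.pi) * poissonKernel 0 Z (circleMap 0 1 θ) +
        (1 - ‖Z‖ ^ 2) * (4 / δ ^ 2) * |ψ (circleMap 0 1 θ) - ψ Z₀| := by
    filter_upwards [ae_circleMap_notMem X (Ioc 0 (2 * Real.pi))] with θ hθ
    have hP := poissonKernel_nonneg hθ.1 (𝒰_subset hZ)
    rcases lt_or_ge (dist (circleMap 0 1 θ) Z₀) δ with hd | hd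
    · have h1 := (hcont hθ hd).le
      rw [Real.dist_eq] at h1
      have h2 := mul_le_mul_of_nonneg_right h1 hP
      have h3 : 0 ≤ (1 - ‖Z‖ ^ 2) * (4 / δ ^ 2) * |ψ (circleMap 0 1 θ) - ψ Z₀| := by positivity
      linarith
    · have h1 : δ / 2 ≤ ‖circleMap 0 1 θ - Z‖ := by
        rw [dist_eq_norm] at hd
        rw [mem_ball_iff_norm] at hZd
        have := norm_sub_le_norm_sub_add_norm_sub (circleMap 0 1 θ) Z Z₀
        linarith
      have h2 : poissonKernel 0 Z (circleMap 0 1 θ) ≤ (1 - ‖Z‖ ^ 2) * (4 / δ ^ 2) := by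
        rw [poissonKernel_def, sub_zero, sub_zero, norm_circleMap_one, one_pow]
        calc _ ≤ (1 - ‖Z‖ ^ 2) / (δ / 2) ^ 2 := by gcongr
          _ = _ := by field_simp; norm_num
      have h3 := mul_le_mul_of_nonneg_left h2 (abs_nonneg (ψ (circleMap 0 1 θ) - ψ Z₀))
      have h4 : 0 ≤ ε / (4 * Real.pi) * poissonKernel 0 Z (circleMap 0 1 θ) := by positivity
      linarith
  have hPi : IntegrableOn (fun θ => poissonKernel 0 Z (circleMap 0 1 θ)) (Ioc 0 (2 * Real.pi)) :=
    ((continuous_poissonKernel_circle hZ).integrableOn_Icc).mono_set Ioc_subset_Icc_self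
  have h0 : 0 ≤ ∫ θ in Ioc 0 (2 * Real.pi),
      |ψ (circleMap 0 1 θ) - ψ Z₀| * poissonKernel 0 Z (circleMap 0 1 θ) :=
    integral_nonneg fun θ => mul_nonneg (abs_nonneg _)
      (poissonKernel_nonneg (circleMap_mem_Γ θ) (𝒰_subset hZ))
  rw [Real.dist_eq, sub_zero, abs_of_nonneg h0]
  have hsum : IntegrableOn (fun θ => ε / (4 * Real.pi) * poissonKernel 0 Z (circleMap 0 1 θ) +
      (1 - ‖Z‖ ^ 2) * (4 / δ ^ 2) * |ψ (circleMap 0 1 θ) - ψ Z₀|) (Ioc 0 (2 * Real.pi)) :=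
    (hPi.const_mul _).add (hi'.const_mul _)
  refine (integral_mono_ae (integrableOn_mul_poissonKernel hi' hZ) hsum hpt).trans_lt ?_
  rw [integral_add (hPi.const_mul _) (hi'.const_mul _), integral_const_mul, integral_const_mul,
    integral_poissonKernel hZ, ← hI]
  rw [Real.dist_eq, sub_zero, abs_of_nonneg (by positivity)] at hZl
  have : ε / (4 * Real.pi) * (2 * Real.pi) = ε / 2 := by field_simp; norm_num
  linarith

theorem Setup.tendsto_integral_mul_poissonKernel (h : Setup D σ X β α γ) {ψ : ℂ → ℝ}
    (hψ : WeightedClass X γ ψ) {Z₀ : ℂ} (hZ₀ : Z₀ ∈ Γ \ range X) :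
    Tendsto (fun Z => ∫ θ in Ioc 0 (2 * Real.pi),
      ψ (circleMap 0 1 θ) * poissonKernel 0 Z (circleMap 0 1 θ)) (𝓝[𝒰] Z₀)
      (𝓝 (2 * Real.pi * ψ Z₀)) := by
  have hi := h.integrableOn_density hψ
  have h1 := tendsto_integral_abs_sub_mul_poissonKernel hi hψ.2.1 hZ₀
  rw [tendsto_iff_norm_sub_tendsto_zero]
  refine squeeze_zero' (Eventually.of_forall fun _ => norm_nonneg _) ?_ h1
  filter_upwards [self_mem_nhdsWithin] with Z hZ
  have hc : IntegrableOn (fun _ : ℝ => ψ Z₀) (Ioc 0 (2 * Real.pi)) := integrableOn_circle_const _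
  have e1 : 2 * Real.pi * ψ Z₀ = ∫ θ in Ioc 0 (2 * Real.pi),
      ψ Z₀ * poissonKernel 0 Z (circleMap 0 1 θ) := by
    rw [integral_const_mul, integral_poissonKernel hZ, mul_comm]
  rw [e1, ← integral_sub (integrableOn_mul_poissonKernel hi hZ) (integrableOn_mul_poissonKernel hc hZ)]
  refine (norm_integral_le_integral_norm _).trans (le_of_eq ?_)
  refine integral_congr_ae (Eventually.of_forall fun θ => ?_)
  simp only
  rw [← sub_mul, norm_mul, Real.norm_eq_abs,
    Real.norm_of_nonneg (poissonKernel_nonneg (circleMap_mem_Γ θ) (𝒰_subset hZ))]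

theorem continuous_poissonPhase_mul {Z : ℂ} (hZ : Z ∈ 𝒰) :
    Continuous fun θ => poissonPhase (circleMap 0 1 θ) Z * circleMap 0 1 θ := by
  have h1 : Continuous (circleMap 0 1) := continuous_circleMap 0 1
  unfold poissonPhase
  exact (Continuous.div (by fun_prop) (by fun_prop)
    fun θ => pow_ne_zero 2 (sub_ne_zero_of_mem_𝒰 hZ θ)).mul h1

theorem norm_kerIntegral_le (ψ : ℂ → ℝ) (k : ℂ → ℂ → ℂ) (Z : ℂ) :
    ‖kerIntegral ψ k Z‖ ≤ (2 * Real.pi)⁻¹ *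
      ‖∫ θ in Ioc 0 (2 * Real.pi), kerIntegrand ψ k Z (circleMap 0 1 θ)‖ := by
  rw [kerIntegral, norm_mul, norm_inv, norm_mul, Complex.norm_real, Complex.norm_ofNat,
    Real.norm_of_nonneg Real.pi_pos.le]

/-- By the zero mean, `ψ` may be replaced by `ψ - ψ(Z₀)`; the modulus of the kernel is the Poisson
kernel, an approximate identity. -/
theorem Setup.tendsto_kerIntegral_poissonPhase (h : Setup D σ X β α γ) {ψ : ℂ → ℝ}
    (hψ : WeightedClass X γ ψ) {Z₀ : ℂ} (hZ₀ : Z₀ ∈ Γ \ range X) :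
    Tendsto (kerIntegral ψ poissonPhase) (𝓝[𝒰] Z₀) (𝓝 0) := by
  have hi := h.integrableOn_density hψ
  have h1 := (tendsto_integral_abs_sub_mul_poissonKernel hi hψ.2.1 hZ₀).const_mul
    (2 * Real.pi)⁻¹
  rw [mul_zero] at h1
  refine squeeze_zero_norm' ?_ h1
  filter_upwards [self_mem_nhdsWithin] with Z hZ
  refine (norm_kerIntegral_le _ _ _).trans (mul_le_mul_of_nonneg_left ?_
    (inv_nonneg.2 Real.two_pi_pos.le))
  have e1 : ∫ θ in Ioc 0 (2 * Real.pi), kerIntegrand ψ poissonPhase Z (circleMap 0 1 θ) =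
      ∫ θ in Ioc 0 (2 * Real.pi), ((ψ (circleMap 0 1 θ) - ψ Z₀ : ℝ) : ℂ) *
        (poissonPhase (circleMap 0 1 θ) Z * circleMap 0 1 θ) := by
    have h2 : ∫ θ in Ioc 0 (2 * Real.pi), ((ψ Z₀ : ℝ) : ℂ) *
        (poissonPhase (circleMap 0 1 θ) Z * circleMap 0 1 θ) = 0 := by
      rw [integral_const_mul, integral_poissonPhase hZ, mul_zero]
    have hc : IntegrableOn (fun _ : ℝ => ((ψ Z₀ : ℝ) : ℂ)) (Ioc 0 (2 * Real.pi)) :=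
      integrableOn_circle_const _
    have hi' : IntegrableOn (fun θ => ((ψ (circleMap 0 1 θ) : ℝ) : ℂ)) (Ioc 0 (2 * Real.pi)) :=
      hi.ofReal
    have e2 := integral_sub (integrableOn_mul_circle hi' (continuous_poissonPhase_mul hZ))
      (integrableOn_mul_circle hc (continuous_poissonPhase_mul hZ))
    rw [h2, sub_zero] at e2
    simp only [kerIntegrand, mul_assoc]
    rw [← e2]
    refine integral_congr_ae (Eventually.of_forall fun θ => ?_)
    simp only
    push_cast; ring
  rw [e1]
  refine (norm_integral_le_integral_norm _).trans (le_of_eq ?_)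
  refine integral_congr_ae (Eventually.of_forall fun θ => ?_)
  simp only
  rw [norm_mul, norm_mul, norm_circleMap_one, mul_one, Complex.norm_real, Real.norm_eq_abs,
    norm_poissonPhase (circleMap_mem_Γ θ) (𝒰_subset hZ)]

/-- The Poisson kernel fits the general growth estimate: it is at most `2/|S - Z|`, and its integral
over any arc is at most its total mass `2π`. -/
theorem Setup.exists_poisson_growth (h : Setup D σ X β α γ) {ψ : ℂ → ℝ}
    (hψ : WeightedClass X γ ψ) (j : Fin m) :
    ∃ C, 0 ≤ C ∧ ∀ᶠ Z in 𝓝[𝒰] (X j), 1 ≤ ‖Z - X j‖ ^ (-γ j) ∧ ∫ θ in Ioc 0 (2 * Real.pi),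
      |ψ (circleMap 0 1 θ)| * poissonKernel 0 Z (circleMap 0 1 θ) ≤ C * ‖Z - X j‖ ^ (-γ j) := by
  obtain ⟨C, ρ₁, hC, hρ₁, hρ₁1, hgrow⟩ := h.exists_lintegral_growth hψ j
  refine ⟨C * (1 + 2 * Real.pi), by have := Real.pi_pos; positivity, ?_⟩
  filter_upwards [self_mem_nhdsWithin, mem_nhdsWithin_of_mem_nhds
    (Metric.ball_mem_nhds (X j) hρ₁)] with Z hZ hZd
  rw [mem_ball_iff_norm] at hZd
  have hP : ∀ θ, 0 ≤ poissonKernel 0 Z (circleMap 0 1 θ) := fun θ =>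
    poissonKernel_nonneg (circleMap_mem_Γ θ) (𝒰_subset hZ)
  have hnorm : ∀ θ, ‖((poissonKernel 0 Z (circleMap 0 1 θ) : ℝ) : ℂ)‖ =
      poissonKernel 0 Z (circleMap 0 1 θ) := fun θ => by
    rw [Complex.norm_real, Real.norm_of_nonneg (hP θ)]
  have hρ0 : 0 < ‖Z - X j‖ := norm_pos_iff.2 (sub_ne_zero.2 fun he =>
    (mem_𝒰.1 hZ).ne (by rw [he]; exact mem_Γ.1 (h.mem j)))
  refine ⟨Real.one_le_rpow_of_pos_of_le_one_of_nonpos hρ0 (by linarith)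
    (by linarith [h.γ_pos j]), ?_⟩
  have h1 := hgrow Z hZ hZd (fun S => (poissonKernel 0 Z S : ℂ)) (2 * Real.pi)
    Real.two_pi_pos.le (fun S hS => ?_) (fun T _ r _ _ _ _ => ?_)
  · simp only [hnorm] at h1
    rw [integral_eq_lintegral_of_nonneg_ae (Eventually.of_forall fun θ =>
      mul_nonneg (abs_nonneg _) (hP θ))
      (integrableOn_mul_poissonKernel (h.integrableOn_density hψ).abs hZ).aestronglyMeasurable]
    exact ENNReal.toReal_le_of_le_ofReal (by have := Real.pi_pos; positivity) h1
  · rw [Complex.norm_real, Real.norm_of_nonneg (poissonKernel_nonneg hS (𝒰_subset hZ))]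
    have := poissonKernel_le hS (𝒰_subset hZ)
    have h2 : 0 ≤ ‖contourDeriv σ S‖ / ‖σ S - σ Z‖ := by positivity
    linarith
  · have hPi : IntegrableOn (fun θ => poissonKernel 0 Z (circleMap 0 1 θ)) (Ioc 0 (2 * Real.pi)) :=
      ((continuous_poissonKernel_circle hZ).integrableOn_Icc).mono_set Ioc_subset_Icc_self
    have e1 := ofReal_integral_eq_lintegral_ofReal hPi (Eventually.of_forall hP)
    rw [integral_poissonKernel hZ] at e1
    rw [e1]
    refine lintegral_mono fun θ => (indicator_le_self _ _ _).trans ?_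
    rw [← ofReal_norm, hnorm]

theorem Setup.exists_kerIntegral_poissonPhase_growth (h : Setup D σ X β α γ) {ψ : ℂ → ℝ}
    (hψ : WeightedClass X γ ψ) (j : Fin m) :
    ∃ C, ∀ᶠ Z in 𝓝[𝒰] (X j), ‖kerIntegral ψ poissonPhase Z‖ ≤ C * ‖Z - X j‖ ^ (-γ j) := by
  obtain ⟨C, hC, hgrow⟩ := h.exists_poisson_growth hψ j
  refine ⟨(2 * Real.pi)⁻¹ * C, ?_⟩
  filter_upwards [hgrow, self_mem_nhdsWithin] with Z hZ hZU
  refine (norm_kerIntegral_le _ _ _).trans ?_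
  rw [mul_assoc]
  refine mul_le_mul_of_nonneg_left (le_trans ?_ hZ.2) (inv_nonneg.2 Real.two_pi_pos.le)
  refine (norm_integral_le_integral_norm _).trans (le_of_eq ?_)
  refine integral_congr_ae (Eventually.of_forall fun θ => ?_)
  simp only
  rw [norm_kerIntegrand _ _ _ (circleMap_mem_Γ θ),
    norm_poissonPhase (circleMap_mem_Γ θ) (𝒰_subset hZU)]

end Poisson

/-! ### Limits and growth of the integrals of the problem -/

section Integrals

variable {D : Set ℂ} {σ : ℂ → ℂ} {m : ℕ} {X : Fin m → ℂ} {β α γ : Fin m → ℝ}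

/-- The Cauchy kernel. -/
def cauchyKer (S Z : ℂ) : ℂ := 1 / (S - Z)

/-- The mean value of `ψ` over the circle. -/
def circleMean (ψ : ℂ → ℝ) : ℝ := (2 * Real.pi)⁻¹ * ∫ θ in Ioc 0 (2 * Real.pi), ψ (circleMap 0 1 θ)

/-- Write `2S/(S - Z) = 1 + (S + Z)/(S - Z)`; the real part of the last quotient is the Poisson
kernel. -/
theorem two_mul_re_cauchyKer {S Z : ℂ} (hS : S ∈ Γ) (hSZ : S ≠ Z) :
    2 * (cauchyKer S Z * S).re = 1 + poissonKernel 0 Z S := by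
  have h0 : Complex.normSq (S - Z) ≠ 0 := fun h => hSZ (sub_eq_zero.1 (Complex.normSq_eq_zero.1 h))
  have hs : Complex.normSq S = 1 := by rw [Complex.normSq_eq_norm_sq, mem_Γ.1 hS, one_pow]
  rw [poissonKernel_def, sub_zero, sub_zero, ← Complex.normSq_eq_norm_sq,
    ← Complex.normSq_eq_norm_sq, ← Complex.normSq_eq_norm_sq, cauchyKer, one_div, Complex.mul_re,
    Complex.inv_re, Complex.inv_im]
  field_simp
  simp only [Complex.normSq_apply, Complex.sub_re, Complex.sub_im] at hs ⊢
  nlinarith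

theorem continuous_cauchyKer_mul {Z : ℂ} (hZ : Z ∈ 𝒰) :
    Continuous fun θ => cauchyKer (circleMap 0 1 θ) Z * circleMap 0 1 θ := by
  have h1 : Continuous (circleMap 0 1) := continuous_circleMap 0 1
  unfold cauchyKer
  exact (Continuous.div (by fun_prop) (by fun_prop) fun θ => sub_ne_zero_of_mem_𝒰 hZ θ).mul h1

theorem integrableOn_kerIntegrand_of_continuous {ψ : ℂ → ℝ} {k : ℂ → ℂ → ℂ} {Z : ℂ}
    (hi : IntegrableOn (fun θ => ψ (circleMap 0 1 θ)) (Ioc 0 (2 * Real.pi)))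
    (hk : Continuous fun θ => k (circleMap 0 1 θ) Z * circleMap 0 1 θ) :
    IntegrableOn (fun θ => kerIntegrand ψ k Z (circleMap 0 1 θ)) (Ioc 0 (2 * Real.pi)) := by
  simp only [kerIntegrand, mul_assoc]
  exact integrableOn_mul_circle hi.ofReal hk

/-- The mean term is `C_ψ`, and the Poisson integral produces `ψ/2` on the circle. -/
theorem re_kerIntegral_cauchyKer {ψ : ℂ → ℝ} {Z : ℂ}
    (hi : IntegrableOn (fun θ => ψ (circleMap 0 1 θ)) (Ioc 0 (2 * Real.pi))) (hZ : Z ∈ 𝒰) :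
    (kerIntegral ψ cauchyKer Z).re = 1 / 2 * circleMean ψ + 1 / 2 * ((2 * Real.pi)⁻¹ *
      ∫ θ in Ioc 0 (2 * Real.pi), ψ (circleMap 0 1 θ) * poissonKernel 0 Z (circleMap 0 1 θ)) := by
  have h1 := Complex.reCLM.integral_comp_comm
    (integrableOn_kerIntegrand_of_continuous hi (continuous_cauchyKer_mul hZ))
  have e : (2 * Real.pi : ℂ)⁻¹ = (((2 * Real.pi)⁻¹ : ℝ) : ℂ) := by push_cast; rfl
  rw [kerIntegral, e, Complex.re_ofReal_mul, ← Complex.reCLM_apply, ← h1, circleMean]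
  have h2 := integral_add hi (integrableOn_mul_poissonKernel hi hZ)
  have h3 : ∫ θ in Ioc 0 (2 * Real.pi), Complex.reCLM (kerIntegrand ψ cauchyKer Z
      (circleMap 0 1 θ)) = 1 / 2 * ∫ θ in Ioc 0 (2 * Real.pi), (ψ (circleMap 0 1 θ) +
        ψ (circleMap 0 1 θ) * poissonKernel 0 Z (circleMap 0 1 θ)) := by
    rw [← integral_const_mul]
    refine integral_congr_ae (Eventually.of_forall fun θ => ?_)
    have h4 := two_mul_re_cauchyKer (circleMap_mem_Γ θ) (sub_ne_zero.1 (sub_ne_zero_of_mem_𝒰 hZ θ))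
    simp only [kerIntegrand, Complex.reCLM_apply, mul_assoc, Complex.re_ofReal_mul]
    linear_combination ψ (circleMap 0 1 θ) / 2 * h4
  rw [h3, h2]; ring

theorem Setup.tendsto_re_kerIntegral_cauchyKer (h : Setup D σ X β α γ) {ψ : ℂ → ℝ}
    (hψ : WeightedClass X γ ψ) {Z₀ : ℂ} (hZ₀ : Z₀ ∈ Γ \ range X) :
    Tendsto (fun Z => (kerIntegral ψ cauchyKer Z).re) (𝓝[𝒰] Z₀)
      (𝓝 (1 / 2 * circleMean ψ + 1 / 2 * ψ Z₀)) := by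
  have h1 := (((h.tendsto_integral_mul_poissonKernel hψ hZ₀).const_mul (2 * Real.pi)⁻¹).const_mul
    (1 / 2)).const_add (1 / 2 * circleMean ψ)
  rw [inv_mul_cancel_left₀ Real.two_pi_pos.ne'] at h1
  refine h1.congr' ?_
  filter_upwards [self_mem_nhdsWithin] with Z hZ
  exact (re_kerIntegral_cauchyKer (h.integrableOn_density hψ) hZ).symm

theorem Setup.exists_re_kerIntegral_cauchyKer_growth (h : Setup D σ X β α γ) {ψ : ℂ → ℝ}
    (hψ : WeightedClass X γ ψ) (j : Fin m) :
    ∃ C, ∀ᶠ Z in 𝓝[𝒰] (X j), |(kerIntegral ψ cauchyKer Z).re| ≤ C * ‖Z - X j‖ ^ (-γ j) := by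
  obtain ⟨C, -, hgrow⟩ := h.exists_poisson_growth hψ j
  have hi := h.integrableOn_density hψ
  refine ⟨1 / 2 * |circleMean ψ| + 1 / 2 * ((2 * Real.pi)⁻¹ * C), ?_⟩
  filter_upwards [hgrow, self_mem_nhdsWithin] with Z hZ hZU
  have h1 : |∫ θ in Ioc 0 (2 * Real.pi), ψ (circleMap 0 1 θ) *
      poissonKernel 0 Z (circleMap 0 1 θ)| ≤ C * ‖Z - X j‖ ^ (-γ j) := by
    refine le_trans ?_ hZ.2
    rw [← Real.norm_eq_abs]
    refine (norm_integral_le_integral_norm _).trans (le_of_eq ?_)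
    refine integral_congr_ae (Eventually.of_forall fun θ => ?_)
    simp only
    rw [norm_mul, Real.norm_eq_abs, Real.norm_of_nonneg
      (poissonKernel_nonneg (circleMap_mem_Γ θ) (𝒰_subset hZU))]
  rw [re_kerIntegral_cauchyKer hi hZU]
  have hpi : 0 ≤ (2 * Real.pi)⁻¹ := inv_nonneg.2 Real.two_pi_pos.le
  calc _ ≤ 1 / 2 * |circleMean ψ| * 1 + 1 / 2 * ((2 * Real.pi)⁻¹ *
        |∫ θ in Ioc 0 (2 * Real.pi), ψ (circleMap 0 1 θ) *
          poissonKernel 0 Z (circleMap 0 1 θ)|) := by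
        refine (abs_add_le _ _).trans (le_of_eq ?_)
        rw [abs_mul, abs_mul, abs_mul, abs_of_nonneg hpi, abs_of_pos one_half_pos, mul_one]
    _ ≤ 1 / 2 * |circleMean ψ| * ‖Z - X j‖ ^ (-γ j) + 1 / 2 * ((2 * Real.pi)⁻¹ *
        (C * ‖Z - X j‖ ^ (-γ j))) := by gcongr; exact hZ.1
    _ = _ := by ring

theorem Setup.integrableOn_ker₂ (h : Setup D σ X β α γ) {ψ : ℂ → ℝ}
    (hψ : WeightedClass X γ ψ) {Z : ℂ} (hZ : Z ∈ 𝒰) :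
    IntegrableOn (fun θ => kerIntegrand ψ (ker₂ σ) Z (circleMap 0 1 θ)) (Ioc 0 (2 * Real.pi)) := by
  refine ((h.isKernel_ker₂'.integrableOn_of_mem_𝒰 h hψ hZ).add
    ((integrableOn_kerIntegrand_of_continuous (h.integrableOn_density hψ)
      (continuous_poissonPhase_mul hZ)).const_mul (phaseCoef σ (Z / ‖Z‖)))).congr
    (Eventually.of_forall fun θ => ?_)
  simp only [kerIntegrand, ker₂', Pi.add_apply]; ring

theorem Setup.kerIntegral_ker₂ (h : Setup D σ X β α γ) {ψ : ℂ → ℝ}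
    (hψ : WeightedClass X γ ψ) {Z : ℂ} (hZ : Z ∈ 𝒰) :
    kerIntegral ψ (ker₂ σ) Z = kerIntegral ψ (ker₂' σ) Z +
      phaseCoef σ (Z / ‖Z‖) * kerIntegral ψ poissonPhase Z := by
  have h1 := integral_add (h.isKernel_ker₂'.integrableOn_of_mem_𝒰 h hψ hZ)
    ((integrableOn_kerIntegrand_of_continuous (h.integrableOn_density hψ)
      (continuous_poissonPhase_mul hZ)).const_mul (phaseCoef σ (Z / ‖Z‖)))
  rw [integral_const_mul] at h1
  have h2 : ∫ θ in Ioc 0 (2 * Real.pi), kerIntegrand ψ (ker₂ σ) Z (circleMap 0 1 θ) =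
      ∫ θ in Ioc 0 (2 * Real.pi), (kerIntegrand ψ (ker₂' σ) Z (circleMap 0 1 θ) +
        phaseCoef σ (Z / ‖Z‖) * kerIntegrand ψ poissonPhase Z (circleMap 0 1 θ)) := by
    refine integral_congr_ae (Eventually.of_forall fun θ => ?_)
    simp only [kerIntegrand, ker₂']; ring
  rw [kerIntegral, kerIntegral, kerIntegral, h2, h1]; ring

theorem kerIntegral_ker₂'_of_mem_Γ (ψ : ℂ → ℝ) {Z : ℂ} (hZ : Z ∈ Γ) :
    kerIntegral ψ (ker₂' σ) Z = kerIntegral ψ (ker₂ σ) Z := by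
  simp only [kerIntegral, kerIntegrand, ker₂'_of_mem_Γ _ hZ]

/-- The integral of `poissonPhase` tends to zero and its coefficient is bounded, so `ker₂`
contributes no jump term. -/
theorem Setup.tendsto_kerIntegral_ker₂ (h : Setup D σ X β α γ) {ψ : ℂ → ℝ}
    (hψ : WeightedClass X γ ψ) {Z₀ : ℂ} (hZ₀ : Z₀ ∈ Γ \ range X) :
    Tendsto (kerIntegral ψ (ker₂ σ)) (𝓝[𝒰] Z₀) (𝓝 (kerIntegral ψ (ker₂ σ) Z₀)) := by
  have h1 := h.isKernel_ker₂'.tendsto_kerIntegral h hψ hZ₀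
  have h2 : Tendsto (fun Z => phaseCoef σ (Z / ‖Z‖) * kerIntegral ψ poissonPhase Z) (𝓝[𝒰] Z₀)
      (𝓝 0) := by
    have h4 := (h.tendsto_kerIntegral_poissonPhase hψ hZ₀).norm.const_mul (1 / 4)
    rw [norm_zero, mul_zero] at h4
    refine squeeze_zero_norm (fun Z => ?_) h4
    rw [norm_mul]
    exact mul_le_mul_of_nonneg_right (norm_phaseCoef_le _) (norm_nonneg _)
  have h3 := h1.add h2
  rw [add_zero, kerIntegral_ker₂'_of_mem_Γ ψ hZ₀.1] at h3
  refine h3.congr' ?_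
  filter_upwards [self_mem_nhdsWithin] with Z hZ
  exact (h.kerIntegral_ker₂ hψ hZ).symm

theorem Setup.exists_kerIntegral_ker₂_growth (h : Setup D σ X β α γ) {ψ : ℂ → ℝ}
    (hψ : WeightedClass X γ ψ) (j : Fin m) :
    ∃ C, ∀ᶠ Z in 𝓝[𝒰] (X j), ‖kerIntegral ψ (ker₂ σ) Z‖ ≤ C * ‖Z - X j‖ ^ (-γ j) := by
  obtain ⟨C₁, hC₁⟩ := h.isKernel_ker₂'.exists_kerIntegral_growth h hψ j
  obtain ⟨C₂, hC₂⟩ := h.exists_kerIntegral_poissonPhase_growth hψ j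
  refine ⟨C₁ + 1 / 4 * C₂, ?_⟩
  filter_upwards [hC₁, hC₂, self_mem_nhdsWithin] with Z h1 h2 hZ
  rw [h.kerIntegral_ker₂ hψ hZ, add_mul, mul_assoc]
  refine (norm_add_le _ _).trans (add_le_add h1 ?_)
  rw [norm_mul]
  exact mul_le_mul (norm_phaseCoef_le _) h2 (norm_nonneg _) (by norm_num)

end Integrals

/-! ### Singular integrals -/

section Singular

variable {D : Set ℂ} {σ : ℂ → ℂ} {m : ℕ} {X : Fin m → ℂ} {β α γ : Fin m → ℝ}

/-- The circle is connected and nontrivial, so it has no isolated points; contour derivatives are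
therefore unique. -/
theorem uniqueDiffWithinAt_Γ {S : ℂ} (hS : S ∈ Γ) : UniqueDiffWithinAt ℂ Γ S := by
  rw [uniqueDiffWithinAt_iff_accPt]
  refine (isPreconnected_sphere (by rw [Complex.rank_real_complex]; exact Nat.one_lt_ofNat) (0 : ℂ)
    1).preperfect_of_nontrivial ⟨1, ?_, -1, ?_, ?_⟩ S hS
  · simp
  · simp
  · norm_num [Complex.ext_iff]

/-- On the circle `conj V = 1/V`, so `(conj V - conj S)/(V - S) = -conj V · conj S`. The slope of
`conj f` is this factor times the conjugate slope of `f`. -/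
theorem hasDerivWithinAt_conj {f : ℂ → ℂ} {a S : ℂ} (hS : S ∈ Γ) (hf : HasDerivWithinAt f a Γ S) :
    HasDerivWithinAt (fun V => conj (f V)) (-(conj a * conj S ^ 2)) Γ S := by
  rw [hasDerivWithinAt_iff_tendsto_slope] at hf ⊢
  have hc : Tendsto (fun V : ℂ => conj V) (𝓝[Γ \ {S}] S) (𝓝 (conj S)) :=
    (Complex.continuous_conj.tendsto S).mono_left nhdsWithin_le_nhds
  have h1 := (((Complex.continuous_conj.tendsto a).comp hf).mul (hc.mul_const (conj S))).neg
  rw [← pow_two] at h1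
  refine h1.congr' ?_
  filter_upwards [self_mem_nhdsWithin] with V hV
  have e : ∀ W ∈ Γ, W * conj W = 1 := fun W hW => by
    rw [Complex.mul_conj, Complex.normSq_eq_norm_sq, mem_Γ.1 hW]; norm_num
  have h2 : V - S ≠ 0 := sub_ne_zero.2 hV.2
  have h3 : conj V - conj S ≠ 0 := by rwa [← map_sub, Ne, map_eq_zero]
  simp only [Function.comp_apply, slope_def_field, map_div₀, map_sub]
  rw [div_mul_eq_mul_div, ← neg_div, div_eq_div_iff h3 h2]
  linear_combination (conj (f S) - conj (f V)) * (conj S * e V hV.1 - conj V * e S hS)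

theorem contourDeriv_sigma₂ {S : ℂ} (hS : S ∈ Γ) (hf : DifferentiableWithinAt ℂ σ Γ S) :
    contourDeriv (sigma₂ σ) S =
      (contourDeriv σ S + conj (contourDeriv σ S) * conj S ^ 2) / (2 * Complex.I) := by
  have h1 := (hf.hasDerivWithinAt.sub (hasDerivWithinAt_conj hS hf.hasDerivWithinAt)).div_const
    (2 * Complex.I)
  have h2 : sigma₂ σ = fun V => (σ V - conj (σ V)) / (2 * Complex.I) := by
    funext V
    rw [sigma₂, Complex.sub_conj]
    field_simp
    push_cast; ring
  rw [contourDeriv, h2, contourDeriv]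
  refine (h1.derivWithin (uniqueDiffWithinAt_Γ hS)).trans ?_
  rw [sub_neg_eq_add]

theorem Ω₁_div_eq {S T : ℂ} (hST : S ≠ T) (hw : σ S - σ T ≠ 0) (ψ : ℂ → ℝ) :
    Ω₁ σ ψ S T / (S - T) = ψ S * ker₁ σ S T := by
  have h1 : S - T ≠ 0 := sub_ne_zero.2 hST
  rw [Ω₁, if_neg hST, d, ker₁]
  field_simp

/-- Expressing `σ₂` by `σ` and `conj σ` in both terms, the contributions `σ'(S) w` with `w = σ(S) -
σ(T)` cancel, and what is left is `ker₂`. -/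
theorem Ω₂_div_eq {S T : ℂ} (hS : S ∈ Γ) (hf : DifferentiableWithinAt ℂ σ Γ S) (hST : S ≠ T)
    (hw : σ S - σ T ≠ 0) (ψ : ℂ → ℝ) : Ω₂ σ ψ S T / (S - T) = ψ S * ker₂ σ S T := by
  have h1 : S - T ≠ 0 := sub_ne_zero.2 hST
  have h2 : sigma₂ σ S - sigma₂ σ T =
      ((σ S - σ T) - conj (σ S - σ T)) / (2 * Complex.I) := by
    rw [Complex.sub_conj, sigma₂, sigma₂, Complex.sub_im]
    push_cast; field_simp
  rw [Ω₂, if_neg hST, d, d₂, ker₂, h2, contourDeriv_sigma₂ hS hf]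
  generalize σ S - σ T = w at *
  generalize S - T = p at *
  field_simp
  linear_combination (-4 * ψ S * (contourDeriv σ S * conj w +
    w * conj (contourDeriv σ S) * conj S ^ 2)) * Complex.I_sq

theorem circleIntegral_eq_setIntegral (f : ℂ → ℂ) :
    ∮ S in C(0, 1), f S = Complex.I * ∫ θ in Ioc 0 (2 * Real.pi), f (circleMap 0 1 θ) *
      circleMap 0 1 θ := by
  rw [circleIntegral, intervalIntegral.integral_of_le Real.two_pi_pos.le, ← integral_const_mul]
  refine integral_congr_ae (Eventually.of_forall fun θ => ?_)
  simp only [deriv_circleMap, smul_eq_mul]; ring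

theorem circleIntegrable_iff_integrableOn {f : ℂ → ℂ} : CircleIntegrable f 0 1 ↔
    IntegrableOn (fun θ => f (circleMap 0 1 θ)) (Ioc 0 (2 * Real.pi)) := by
  rw [CircleIntegrable, intervalIntegrable_iff_integrableOn_Ioc_of_le Real.two_pi_pos.le]

/-- The integrand is absolutely integrable, so the truncated integrals converge by dominated
convergence. -/
theorem hasSingularIntegral_kerIntegral {ψ : ℂ → ℝ} {k Ω : ℂ → ℂ → ℂ} {T : ℂ}
    (hi : IntegrableOn (fun θ => kerIntegrand ψ k T (circleMap 0 1 θ)) (Ioc 0 (2 * Real.pi)))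
    (hΩ : ∀ S ∈ Γ \ range X, S ≠ T → Ω S T / (S - T) = ψ S * k S T) :
    HasSingularIntegral Ω T (kerIntegral ψ k T) := by
  have hms : ∀ δ : ℝ, MeasurableSet {θ : ℝ | δ < ‖circleMap 0 1 θ - T‖} := fun δ =>
    measurableSet_lt measurable_const
      ((continuous_circleMap 0 1).sub continuous_const).norm.measurable
  have hmul : ∀ δ : ℝ, (fun θ => (if δ < ‖circleMap 0 1 θ - T‖ then
      Ω (circleMap 0 1 θ) T / (circleMap 0 1 θ - T) else 0) * circleMap 0 1 θ)
      =ᵐ[volume.restrict (Ioc 0 (2 * Real.pi))] indicator {θ : ℝ | δ < ‖circleMap 0 1 θ - T‖}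
        (fun θ => kerIntegrand ψ k T (circleMap 0 1 θ)) := fun δ => by
    filter_upwards [ae_circleMap_notMem X (Ioc 0 (2 * Real.pi)), ae_circleMap_ne T _] with θ h1 h2
    by_cases hd : δ < ‖circleMap 0 1 θ - T‖
    · rw [if_pos hd, indicator_of_mem (by exact hd), hΩ _ h1 h2, kerIntegrand]
    · rw [if_neg hd, indicator_of_notMem (by exact hd), zero_mul]
  refine ⟨fun δ _ => ?_, ?_⟩
  · rw [circleIntegrable_iff_integrableOn]
    have h1 := integrableOn_mul_circle ((hi.indicator (hms δ)).congr (hmul δ).symm)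
      (Complex.continuous_conj.comp (continuous_circleMap 0 1))
    refine h1.congr (Eventually.of_forall fun θ => ?_)
    simp only [Function.comp_apply]
    rw [mul_assoc, circleMap_mul_conj, mul_one]
  · have h1 : Tendsto (fun δ : ℝ => ∫ θ in Ioc 0 (2 * Real.pi),
        indicator {θ : ℝ | δ < ‖circleMap 0 1 θ - T‖}
          (fun θ => kerIntegrand ψ k T (circleMap 0 1 θ)) θ) (𝓝[>] 0)
        (𝓝 (∫ θ in Ioc 0 (2 * Real.pi), kerIntegrand ψ k T (circleMap 0 1 θ))) := by
      refine tendsto_integral_filter_of_dominated_convergence _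
        (Eventually.of_forall fun δ => (hi.indicator (hms δ)).aestronglyMeasurable)
        (Eventually.of_forall fun δ => Eventually.of_forall fun θ =>
          norm_indicator_le_norm_self _ _) hi.norm ?_
      filter_upwards [ae_circleMap_ne T (Ioc 0 (2 * Real.pi))] with θ hθ
      refine tendsto_const_nhds.congr' ?_
      filter_upwards [mem_nhdsWithin_of_mem_nhds
        (Iio_mem_nhds (norm_pos_iff.2 (sub_ne_zero.2 hθ)))] with δ hδ
      rw [indicator_of_mem (by exact hδ)]
    refine (h1.const_mul (2 * Real.pi : ℂ)⁻¹).congr fun δ => ?_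
    rw [circleIntegral_eq_setIntegral, integral_congr_ae (hmul δ), mul_inv (2 * Real.pi : ℂ),
      mul_assoc _ Complex.I⁻¹, inv_mul_cancel_left₀ Complex.I_ne_zero]

theorem Setup.hasSingularIntegral_Ω₁ (h : Setup D σ X β α γ) {ψ : ℂ → ℝ}
    (hψ : WeightedClass X γ ψ) {T : ℂ} (hT : T ∈ Γ \ range X) :
    HasSingularIntegral (Ω₁ σ ψ) T (kerIntegral ψ (ker₁ σ) T) :=
  hasSingularIntegral_kerIntegral (X := X) (h.isKernel_ker₁.integrableOn_of_mem_Γ h hψ hT)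
    fun _ hS hST => Ω₁_div_eq hST (h.param.sub_ne_zero (Γ_subset hS.1) (Γ_subset hT.1) hST) ψ

theorem Setup.hasSingularIntegral_Ω₂ (h : Setup D σ X β α γ) {ψ : ℂ → ℝ}
    (hψ : WeightedClass X γ ψ) {T : ℂ} (hT : T ∈ Γ \ range X) :
    HasSingularIntegral (Ω₂ σ ψ) T (kerIntegral ψ (ker₂ σ) T) := by
  refine hasSingularIntegral_kerIntegral (X := X) ?_ fun S hS hST =>
    Ω₂_div_eq hS.1 (h.condA.exists_deriv S hS) hST
      (h.param.sub_ne_zero (Γ_subset hS.1) (Γ_subset hT.1) hST) ψ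
  have h1 := h.isKernel_ker₂'.integrableOn_of_mem_Γ h hψ hT
  simpa only [kerIntegrand, ker₂'_of_mem_Γ _ hT.1] using h1

theorem Setup.circleIntegrable_density_div (h : Setup D σ X β α γ) {ψ : ℂ → ℝ}
    (hψ : WeightedClass X γ ψ) : CircleIntegrable (fun S => (ψ S : ℂ) / S) 0 1 := by
  rw [circleIntegrable_iff_integrableOn]
  refine (integrableOn_mul_circle (h.integrableOn_density hψ).ofReal
    (Complex.continuous_conj.comp (continuous_circleMap 0 1))).congr
    (Eventually.of_forall fun θ => ?_)
  simp only [Function.comp_apply]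
  rw [div_eq_mul_inv, eq_inv_of_mul_eq_one_right (circleMap_mul_conj θ)]
  rfl

theorem constC_eq (ψ : ℂ → ℝ) : constC ψ = ((1 / 2 * circleMean ψ : ℝ) : ℂ) := by
  rw [constC, circleIntegral_eq_setIntegral, circleMean]
  have h1 : ∫ θ in Ioc 0 (2 * Real.pi), (ψ (circleMap 0 1 θ) : ℂ) / circleMap 0 1 θ *
      circleMap 0 1 θ = ((∫ θ in Ioc 0 (2 * Real.pi), ψ (circleMap 0 1 θ) : ℝ) : ℂ) := by
    rw [← integral_complex_ofReal]
    refine integral_congr_ae (Eventually.of_forall fun θ => ?_)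
    exact div_mul_cancel₀ _ (circleMap_ne_center one_ne_zero)
  rw [h1]
  push_cast
  field_simp
  ring

end Singular

/-! ### Calculus in the biharmonic algebra -/

namespace Biharm

theorem eq_smul_add_smul (z w : ℂ) : mk z w = z • e₁ + w • e₂ := by
  apply ext <;> simp [e₁, e₂]

theorem norm_c₁_le (a : Biharm) : ‖a.c₁‖ ≤ ‖a‖ := by
  rw [norm_eq]; exact Real.le_sqrt_of_sq_le (by nlinarith [sq_nonneg ‖a.c₂‖])

theorem norm_c₂_le (a : Biharm) : ‖a.c₂‖ ≤ ‖a‖ := by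
  rw [norm_eq]; exact Real.le_sqrt_of_sq_le (by nlinarith [sq_nonneg ‖a.c₁‖])

theorem norm_le_add (a : Biharm) : ‖a‖ ≤ ‖a.c₁‖ + ‖a.c₂‖ := by
  rw [norm_eq]
  refine Real.sqrt_le_iff.2 ⟨by positivity, ?_⟩
  nlinarith [mul_nonneg (norm_nonneg a.c₁) (norm_nonneg a.c₂)]

/-- The constant is `2 + 4`, the crude bounds of the two coordinates; any constant would do for
continuity of multiplication. -/
theorem norm_mul_le (a b : Biharm) : ‖a * b‖ ≤ 6 * ‖a‖ * ‖b‖ := by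
  have e : ∀ z w : ℂ, ‖z‖ ≤ ‖a‖ → ‖w‖ ≤ ‖b‖ → ‖z * w‖ ≤ ‖a‖ * ‖b‖ := fun z w hz hw => by
    rw [norm_mul]; exact mul_le_mul hz hw (norm_nonneg _) (norm_nonneg _)
  have h₁ : ‖(a * b).c₁‖ ≤ ‖a‖ * ‖b‖ + ‖a‖ * ‖b‖ :=
    (norm_add_le _ _).trans (add_le_add (e _ _ a.norm_c₁_le b.norm_c₁_le)
      (e _ _ a.norm_c₂_le b.norm_c₂_le))
  have h₂ : ‖(a * b).c₂‖ ≤ ‖a‖ * ‖b‖ + ‖a‖ * ‖b‖ + 2 * (‖a‖ * ‖b‖) := by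
    refine (norm_add₃_le).trans (add_le_add (add_le_add (e _ _ a.norm_c₁_le b.norm_c₂_le)
      (e _ _ a.norm_c₂_le b.norm_c₁_le)) ?_)
    rw [norm_mul, norm_mul, Complex.norm_I, Complex.norm_ofNat, mul_one]
    exact mul_le_mul_of_nonneg_left (e _ _ a.norm_c₂_le b.norm_c₂_le) zero_le_two
  linarith [norm_le_add (a * b)]

/-- Multiplication by a fixed element, as a continuous linear map. -/
def mulCLM (b : Biharm) : Biharm →L[ℂ] Biharm :=
  LinearMap.mkContinuous (LinearMap.mulRight ℂ b) (6 * ‖b‖) fun a =>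
    (norm_mul_le a b).trans (le_of_eq (by ring))

theorem mulCLM_apply (a b : Biharm) : mulCLM b a = a * b := rfl

theorem tendsto_mk {ι : Type*} {l : Filter ι} {f g : ι → ℂ} {z w : ℂ} (hf : Tendsto f l (𝓝 z))
    (hg : Tendsto g l (𝓝 w)) : Tendsto (fun i => mk (f i) (g i)) l (𝓝 (mk z w)) := by
  simp only [eq_smul_add_smul]
  exact (hf.smul_const e₁).add (hg.smul_const e₂)

theorem integrable_mk {ι : Type*} [MeasurableSpace ι] {ν : Measure ι} {f g : ι → ℂ}
    (hf : Integrable f ν) (hg : Integrable g ν) : Integrable (fun i => mk (f i) (g i)) ν := by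
  simp only [eq_smul_add_smul]
  exact (hf.smul_const e₁).add (hg.smul_const e₂)

theorem integral_mk {ι : Type*} [MeasurableSpace ι] {ν : Measure ι} {f g : ι → ℂ}
    (hf : Integrable f ν) (hg : Integrable g ν) :
    ∫ i, mk (f i) (g i) ∂ν = mk (∫ i, f i ∂ν) (∫ i, g i ∂ν) := by
  simp only [eq_smul_add_smul]
  rw [integral_add (hf.smul_const e₁) (hg.smul_const e₂), integral_smul_const,
    integral_smul_const]

end Biharm

/-! ### Inversion in the biharmonic plane. -/

/-- With `n = e₂ - i e₁` and `n² = 0`, the element is `w + (Im w) n`, whose inverse is `1/w - (Im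
w/w²) n`. -/
theorem emb_mul_eq_one {w : ℂ} (hw : w ≠ 0) :
    emb w * Biharm.mk (1 / w + Complex.I * w.im / w ^ 2) (-(w.im / w ^ 2)) = 1 := by
  have h1 : (w.re : ℂ) = w - w.im * Complex.I := by
    linear_combination Complex.re_add_im w
  generalize hv : (w.im : ℂ) = v at h1
  apply Biharm.ext
  · simp only [emb, Biharm.c₁_mul, Biharm.c₁_mk, Biharm.c₂_mk, Biharm.c₁_one, h1, hv]
    field_simp
    linear_combination (-v ^ 2) * Complex.I_sq
  · simp only [emb, Biharm.c₂_mul, Biharm.c₁_mk, Biharm.c₂_mk, Biharm.c₂_one, h1, hv]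
    field_simp
    ring

theorem isUnit_emb {w : ℂ} (hw : w ≠ 0) : IsUnit (emb w) :=
  IsUnit.of_mul_eq_one _ (emb_mul_eq_one hw)

theorem inverse_emb {w : ℂ} (hw : w ≠ 0) : Ring.inverse (emb w) =
    Biharm.mk (1 / w + Complex.I * w.im / w ^ 2) (-(w.im / w ^ 2)) :=
  Ring.inverse_unit (Units.mkOfMulEqOne _ _ (emb_mul_eq_one hw))

theorem norm_inverse_emb_le {w : ℂ} (hw : w ≠ 0) : ‖Ring.inverse (emb w)‖ ≤ 3 / ‖w‖ := by
  have hp := norm_pos_iff.2 hw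
  have h1 : ‖(w.im : ℂ) / w ^ 2‖ ≤ 1 / ‖w‖ := by
    rw [norm_div, norm_pow, Complex.norm_real, Real.norm_eq_abs, pow_two, div_mul_eq_div_div,
      div_le_div_iff_of_pos_right hp, div_le_one hp]
    exact Complex.abs_im_le_norm w
  have h2 : ‖1 / w‖ = 1 / ‖w‖ := by rw [norm_div, norm_one]
  rw [inverse_emb hw]
  refine (Biharm.norm_le_add _).trans ?_
  rw [Biharm.c₁_mk, Biharm.c₂_mk, norm_neg, mul_div_assoc]
  have h3 := norm_add_le (1 / w) (Complex.I * (w.im / w ^ 2))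
  rw [norm_mul, Complex.norm_I, one_mul] at h3
  rw [show 3 / ‖w‖ = 1 / ‖w‖ + 1 / ‖w‖ + 1 / ‖w‖ by ring]
  linarith

theorem tendsto_inverse_emb {w : ℂ} (hw : w ≠ 0) :
    Tendsto (fun z => Ring.inverse (emb z)) (𝓝 w) (𝓝 (Ring.inverse (emb w))) := by
  rw [inverse_emb hw]
  have him : ContinuousAt (fun z : ℂ => (z.im : ℂ)) w := by fun_prop
  have hsq : ContinuousAt (fun z : ℂ => z ^ 2) w := by fun_prop
  have h1 : ContinuousAt (fun z : ℂ => 1 / z + Complex.I * z.im / z ^ 2) w :=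
    (continuousAt_const.div continuousAt_id hw).add
      ((continuousAt_const.mul him).div hsq (pow_ne_zero 2 hw))
  have h2 : ContinuousAt (fun z : ℂ => -((z.im : ℂ) / z ^ 2)) w :=
    (him.div hsq (pow_ne_zero 2 hw)).neg
  refine (Biharm.tendsto_mk h1 h2).congr' ?_
  filter_upwards [isOpen_ne.mem_nhds hw] with z hz
  exact (inverse_emb hz).symm

theorem hasDerivAt_emb {f : ℝ → ℂ} {a : ℂ} {t : ℝ} (hf : HasDerivAt f a t) :
    HasDerivAt (fun s => emb (f s)) (emb a) t := by
  have h1 : HasDerivAt (fun s => ((f s).re : ℂ)) (a.re : ℂ) t :=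
    (Complex.reCLM.hasFDerivAt.comp_hasDerivAt t hf).ofReal_comp
  have h2 : HasDerivAt (fun s => ((f s).im : ℂ)) (a.im : ℂ) t :=
    (Complex.imCLM.hasFDerivAt.comp_hasDerivAt t hf).ofReal_comp
  simp only [emb, Biharm.eq_smul_add_smul]
  exact (h1.smul_const Biharm.e₁).add (h2.smul_const Biharm.e₂)

/-! ### The Cauchy integrand in coordinates on the circle. -/

section CauchyIntegral

variable {D : Set ℂ} {σ : ℂ → ℂ} {m : ℕ} {X : Fin m → ℂ} {β α γ : Fin m → ℝ}

theorem deriv_bdryParam {θ : ℝ} (hf : DifferentiableWithinAt ℂ σ Γ (circleMap 0 1 θ)) :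
    deriv (bdryParam σ) θ =
      emb (circleMap 0 1 θ * Complex.I * contourDeriv σ (circleMap 0 1 θ)) := by
  have h1 := hasDerivAt_comp_circleMap (T := 1) (f := σ) (u := θ) norm_one (by rwa [one_mul])
  simp only [one_mul] at h1
  exact (hasDerivAt_emb h1).deriv

/-- In the basis `1, n` with `n = e₂ - i e₁`, the product of the last two factors is `i (a S/w -
2Kn)`, where `K` is the recurring expression that becomes `ker₂` times `S`. Multiplying by `x e₁ + y
e₂` gives the coordinates; the opposite signs of the `2i` terms come from `n e₂ = i n`. -/
theorem mk_mul_inverse_mul_emb {S a w : ℂ} (x y : ℂ) (hS : S * conj S = 1) (hw : w ≠ 0) :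
    Biharm.mk x y * Ring.inverse (emb w) * emb (S * Complex.I * a) =
      Complex.I • Biharm.mk
        (x * (a / w * S) + 2 * Complex.I * (x * (Complex.I / 4 * ((a * conj w +
          conj a * conj S ^ 2 * w) / w ^ 2) * S)) - 2 * (y * (Complex.I / 4 * ((a * conj w +
          conj a * conj S ^ 2 * w) / w ^ 2) * S)))
        (y * (a / w * S) - 2 * Complex.I * (y * (Complex.I / 4 * ((a * conj w +
          conj a * conj S ^ 2 * w) / w ^ 2) * S)) - 2 * (x * (Complex.I / 4 * ((a * conj w +
          conj a * conj S ^ 2 * w) / w ^ 2) * S))) := by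
  have him : ∀ z : ℂ, (z.im : ℂ) = -(Complex.I / 2) * (z - conj z) := fun z => by
    rw [Complex.sub_conj]; push_cast
    linear_combination (z.im : ℂ) * Complex.I_sq
  have hre : ∀ z : ℂ, (z.re : ℂ) = (z + conj z) / 2 := fun z => by
    rw [Complex.add_conj]; push_cast; ring
  have hS0 : S ≠ 0 := left_ne_zero_of_mul_eq_one hS
  have hcS : conj S = 1 / S := by field_simp; linear_combination hS
  rw [inverse_emb hw]
  apply Biharm.ext
  · simp only [emb, Biharm.c₁_mul, Biharm.c₂_mul, Biharm.c₁_mk, Biharm.c₂_mk, Biharm.c₁_smul,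
      him, hre, map_mul, Complex.conj_I, hcS]
    generalize conj w = w'
    generalize conj a = a'
    field_simp
    ring_nf
    simp only [Complex.I_sq, Complex.I_pow_three]
    ring
  · simp only [emb, Biharm.c₁_mul, Biharm.c₂_mul, Biharm.c₁_mk, Biharm.c₂_mk, Biharm.c₂_smul,
      him, hre, map_mul, Complex.conj_I, hcS]
    generalize conj w = w'
    generalize conj a = a'
    field_simp
    ring_nf
    simp only [Complex.I_sq, Complex.I_pow_three, Complex.I_pow_four]
    ring

end CauchyIntegral

/-! ### The Cauchy-type integral -/

section CauchyTypeIntegral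

variable {D : Set ℂ} {σ : ℂ → ℂ} {m : ℕ} {X : Fin m → ℂ} {β α γ : Fin m → ℝ}

/-- The sum of the kernels whose integral is the coordinate of the Cauchy-type integral along the
basis vector with density `ψ`; the sign `s` distinguishes the two coordinates. -/
def coordIntegrand (σ : ℂ → ℂ) (s : ℂ) (ψ χ : ℂ → ℝ) (Z S : ℂ) : ℂ :=
  kerIntegrand ψ (ker₁ σ) Z S + kerIntegrand ψ cauchyKer Z S +
    2 * s * kerIntegrand ψ (ker₂ σ) Z S - 2 * kerIntegrand χ (ker₂ σ) Z S

/-- The integral of `coordIntegrand`. -/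
def coordIntegral (σ : ℂ → ℂ) (s : ℂ) (ψ χ : ℂ → ℝ) (Z : ℂ) : ℂ :=
  kerIntegral ψ (ker₁ σ) Z + kerIntegral ψ cauchyKer Z +
    2 * s * kerIntegral ψ (ker₂ σ) Z - 2 * kerIntegral χ (ker₂ σ) Z

theorem Setup.integrableOn_coordIntegrand (h : Setup D σ X β α γ) {ψ χ : ℂ → ℝ}
    (hψ : WeightedClass X γ ψ) (hχ : WeightedClass X γ χ) (s : ℂ) {Z : ℂ} (hZ : Z ∈ 𝒰) :
    IntegrableOn (fun θ => coordIntegrand σ s ψ χ Z (circleMap 0 1 θ)) (Ioc 0 (2 * Real.pi)) :=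
  (((h.isKernel_ker₁.integrableOn_of_mem_𝒰 h hψ hZ).add
    (integrableOn_kerIntegrand_of_continuous (h.integrableOn_density hψ)
      (continuous_cauchyKer_mul hZ))).add ((h.integrableOn_ker₂ hψ hZ).const_mul (2 * s))).sub
    ((h.integrableOn_ker₂ hχ hZ).const_mul 2)

theorem Setup.integral_coordIntegrand (h : Setup D σ X β α γ) {ψ χ : ℂ → ℝ}
    (hψ : WeightedClass X γ ψ) (hχ : WeightedClass X γ χ) (s : ℂ) {Z : ℂ} (hZ : Z ∈ 𝒰) :
    (2 * Real.pi : ℂ)⁻¹ * ∫ θ in Ioc 0 (2 * Real.pi), coordIntegrand σ s ψ χ Z (circleMap 0 1 θ) =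
      coordIntegral σ s ψ χ Z := by
  have i₁ := h.isKernel_ker₁.integrableOn_of_mem_𝒰 h hψ hZ
  have i₂ := integrableOn_kerIntegrand_of_continuous (h.integrableOn_density hψ)
      (continuous_cauchyKer_mul hZ)
  have i₃ := (h.integrableOn_ker₂ hψ hZ).const_mul (2 * s)
  have i₄ := (h.integrableOn_ker₂ hχ hZ).const_mul 2
  have e := integral_sub ((i₁.add i₂).add i₃) i₄
  have e' := integral_add (i₁.add i₂) i₃
  have e'' := integral_add i₁ i₂
  simp only [Pi.add_apply] at e e' e''
  simp only [coordIntegrand]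
  rw [e, e', e'', integral_const_mul, integral_const_mul]
  simp only [coordIntegral, kerIntegral]
  ring

theorem Setup.cauchyIntegrand_eq (h : Setup D σ X β α γ) (φ₁ φ₃ : Biharm → ℝ) {Z : ℂ}
    (hZ : Z ∈ 𝒰) {θ : ℝ} (hθ : circleMap 0 1 θ ∈ Γ \ range X) :
    cauchyIntegrand σ φ₁ φ₃ (emb (σ Z)) θ = Complex.I • Biharm.mk
      (coordIntegrand σ Complex.I (pull σ φ₁) (pull σ φ₃) Z (circleMap 0 1 θ))
      (coordIntegrand σ (-Complex.I) (pull σ φ₃) (pull σ φ₁) Z (circleMap 0 1 θ)) := by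
  have hw : σ (circleMap 0 1 θ) - σ Z ≠ 0 := h.param.sub_ne_zero (Γ_subset hθ.1) (𝒰_subset hZ)
    (sub_ne_zero.1 (sub_ne_zero_of_mem_𝒰 hZ θ))
  rw [cauchyIntegrand, deriv_bdryParam (h.condA.exists_deriv _ hθ), bdryParam, emb_sub,
    mk_mul_inverse_mul_emb _ _ (circleMap_mul_conj θ) hw]
  congr 2 <;> simp only [coordIntegrand, kerIntegrand, ker₁, ker₂, cauchyKer, pull] <;> ring

theorem Setup.cauchyIntegrand_ae_eq (h : Setup D σ X β α γ) (φ₁ φ₃ : Biharm → ℝ) {Z : ℂ}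
    (hZ : Z ∈ 𝒰) : cauchyIntegrand σ φ₁ φ₃ (emb (σ Z))
      =ᵐ[volume.restrict (Ioc 0 (2 * Real.pi))] fun θ => Complex.I • Biharm.mk
      (coordIntegrand σ Complex.I (pull σ φ₁) (pull σ φ₃) Z (circleMap 0 1 θ))
      (coordIntegrand σ (-Complex.I) (pull σ φ₃) (pull σ φ₁) Z (circleMap 0 1 θ)) :=
  (ae_circleMap_notMem X _).mono fun _ hθ => h.cauchyIntegrand_eq φ₁ φ₃ hZ hθ

theorem Setup.integrableOn_cauchyIntegrand (h : Setup D σ X β α γ) {φ₁ φ₃ : Biharm → ℝ}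
    (hφ₁ : WeightedClass X γ (pull σ φ₁)) (hφ₃ : WeightedClass X γ (pull σ φ₃)) {Z : ℂ}
    (hZ : Z ∈ 𝒰) :
    IntegrableOn (cauchyIntegrand σ φ₁ φ₃ (emb (σ Z))) (Ioc 0 (2 * Real.pi)) :=
  ((Biharm.integrable_mk (h.integrableOn_coordIntegrand hφ₁ hφ₃ Complex.I hZ)
    (h.integrableOn_coordIntegrand hφ₃ hφ₁ (-Complex.I) hZ)).smul Complex.I).congr
    (h.cauchyIntegrand_ae_eq φ₁ φ₃ hZ).symm

theorem Setup.cauchyIntegral_eq (h : Setup D σ X β α γ) {φ₁ φ₃ : Biharm → ℝ}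
    (hφ₁ : WeightedClass X γ (pull σ φ₁)) (hφ₃ : WeightedClass X γ (pull σ φ₃)) {Z : ℂ}
    (hZ : Z ∈ 𝒰) : cauchyIntegral σ φ₁ φ₃ (emb (σ Z)) = Biharm.mk
      (coordIntegral σ Complex.I (pull σ φ₁) (pull σ φ₃) Z)
      (coordIntegral σ (-Complex.I) (pull σ φ₃) (pull σ φ₁) Z) := by
  rw [cauchyIntegral, intervalIntegral.integral_of_le Real.two_pi_pos.le,
    integral_congr_ae (h.cauchyIntegrand_ae_eq φ₁ φ₃ hZ), integral_smul,
    Biharm.integral_mk (h.integrableOn_coordIntegrand hφ₁ hφ₃ Complex.I hZ)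
      (h.integrableOn_coordIntegrand hφ₃ hφ₁ (-Complex.I) hZ), smul_smul,
    mul_inv (2 * Real.pi : ℂ), inv_mul_cancel_right₀ Complex.I_ne_zero,
    ← h.integral_coordIntegrand hφ₁ hφ₃ _ hZ, ← h.integral_coordIntegrand hφ₃ hφ₁ _ hZ]
  rfl

/-- The boundary value of the real part of `coordIntegral`. -/
def boundaryValue (σ : ℂ → ℂ) (s : ℂ) (ψ χ : ℂ → ℝ) (Z : ℂ) : ℝ :=
  (kerIntegral ψ (ker₁ σ) Z).re + (1 / 2 * circleMean ψ + 1 / 2 * ψ Z) +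
    (2 * s * kerIntegral ψ (ker₂ σ) Z).re - (2 * kerIntegral χ (ker₂ σ) Z).re

theorem Setup.tendsto_coordIntegral (h : Setup D σ X β α γ) {ψ χ : ℂ → ℝ}
    (hψ : WeightedClass X γ ψ) (hχ : WeightedClass X γ χ) (s : ℂ) {Z₀ : ℂ}
    (hZ₀ : Z₀ ∈ Γ \ range X) : Tendsto (fun Z => (coordIntegral σ s ψ χ Z).re) (𝓝[𝒰] Z₀)
      (𝓝 (boundaryValue σ s ψ χ Z₀)) := by
  have hre : ∀ {f : ℂ → ℂ} {a : ℂ}, Tendsto f (𝓝[𝒰] Z₀) (𝓝 a) →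
      Tendsto (fun Z => (f Z).re) (𝓝[𝒰] Z₀) (𝓝 a.re) := fun hf =>
    (Complex.continuous_re.tendsto _).comp hf
  simp only [coordIntegral, Complex.sub_re, Complex.add_re]
  exact (((hre (h.isKernel_ker₁.tendsto_kerIntegral h hψ hZ₀)).add
    (h.tendsto_re_kerIntegral_cauchyKer hψ hZ₀)).add
    (hre ((h.tendsto_kerIntegral_ker₂ hψ hZ₀).const_mul (2 * s)))).sub
    (hre ((h.tendsto_kerIntegral_ker₂ hχ hZ₀).const_mul 2))

theorem Setup.exists_coordIntegral_growth (h : Setup D σ X β α γ) {ψ χ : ℂ → ℝ}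
    (hψ : WeightedClass X γ ψ) (hχ : WeightedClass X γ χ) {s : ℂ} (hs : ‖s‖ = 1) (j : Fin m) :
    ∃ C, ∀ᶠ Z in 𝓝[𝒰] (X j), |(coordIntegral σ s ψ χ Z).re| ≤ C * ‖Z - X j‖ ^ (-γ j) := by
  obtain ⟨C₁, h₁⟩ := h.isKernel_ker₁.exists_kerIntegral_growth h hψ j
  obtain ⟨C₂, h₂⟩ := h.exists_re_kerIntegral_cauchyKer_growth hψ j
  obtain ⟨C₃, h₃⟩ := h.exists_kerIntegral_ker₂_growth hψ j
  obtain ⟨C₄, h₄⟩ := h.exists_kerIntegral_ker₂_growth hχ j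
  refine ⟨C₁ + C₂ + 2 * C₃ + 2 * C₄, ?_⟩
  filter_upwards [h₁, h₂, h₃, h₄] with Z h₁ h₂ h₃ h₄
  have e₁ := (Complex.abs_re_le_norm _).trans h₁
  have e₃ := Complex.abs_re_le_norm (2 * s * kerIntegral ψ (ker₂ σ) Z)
  have e₄ := Complex.abs_re_le_norm (2 * kerIntegral χ (ker₂ σ) Z)
  rw [norm_mul, norm_mul, hs, Complex.norm_ofNat, mul_one] at e₃
  rw [norm_mul, Complex.norm_ofNat] at e₄
  simp only [coordIntegral, Complex.sub_re, Complex.add_re]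
  rw [abs_le] at *
  constructor <;> linarith

/-! ### Monogenicity -/

/-- The resolvent identity: the difference quotient of the inverse, without a singular factor. -/
theorem inverse_emb_sub_mul_inverse {p w : ℂ} (hp : p ≠ 0) (hw : w ≠ 0) (hpw : p - w ≠ 0) :
    (Ring.inverse (emb (p - w)) - Ring.inverse (emb p)) * Ring.inverse (emb w) =
      Ring.inverse (emb (p - w)) * Ring.inverse (emb p) := by
  have e₁ := Ring.mul_inverse_cancel _ (isUnit_emb hp)
  have e₂ := Ring.mul_inverse_cancel _ (isUnit_emb hw)
  have e₃ := Ring.mul_inverse_cancel _ (isUnit_emb hpw)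
  rw [← emb_sub] at e₃ ⊢
  generalize Ring.inverse (emb p - emb w) = a at *
  generalize Ring.inverse (emb p) = b at *
  generalize Ring.inverse (emb w) = c at *
  linear_combination (-a * c) * e₁ + (a * b) * e₂ + (b * c) * e₃

theorem emb_add (z w : ℂ) : emb (z + w) = emb z + emb w := by
  apply Biharm.ext <;> simp [emb]

theorem map_emb_nhdsWithin : map emb (𝓝[≠] 0) = 𝓝[biharmonicPlane \ {0}] 0 := by
  have h0 : emb 0 = 0 := by rw [← norm_eq_zero, norm_emb, norm_zero]
  have h1 : emb '' {0}ᶜ = biharmonicPlane \ {0} := by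
    rw [image_compl_eq_range_sdiff_image isometry_emb.injective, image_singleton, h0]
    rfl
  have h2 := isometry_emb.isEmbedding.map_nhdsWithin_eq {0}ᶜ 0
  rwa [h0, h1] at h2

theorem Setup.cauchyIntegrand_sub_mul_inverse (h : Setup D σ X β α γ) (φ₁ φ₃ : Biharm → ℝ)
    {z w : ℂ} {θ : ℝ} (hθ : circleMap 0 1 θ ∈ Γ \ range X) (hp : σ (circleMap 0 1 θ) - z ≠ 0)
    (hw : w ≠ 0) (hpw : σ (circleMap 0 1 θ) - z - w ≠ 0) :
    (cauchyIntegrand σ φ₁ φ₃ (emb (z + w)) θ - cauchyIntegrand σ φ₁ φ₃ (emb z) θ) *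
      Ring.inverse (emb w) =
    Biharm.mk (pull σ φ₁ (circleMap 0 1 θ)) (pull σ φ₃ (circleMap 0 1 θ)) *
      (Ring.inverse (emb (σ (circleMap 0 1 θ) - z - w)) *
        Ring.inverse (emb (σ (circleMap 0 1 θ) - z))) *
      emb (circleMap 0 1 θ * Complex.I * contourDeriv σ (circleMap 0 1 θ)) := by
  rw [← inverse_emb_sub_mul_inverse hp hw hpw, cauchyIntegrand, cauchyIntegrand,
    deriv_bdryParam (h.condA.exists_deriv _ hθ), bdryParam, emb_sub, emb_sub, ← sub_sub, pull, pull]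
  ring

/-- For small increments `p - w` keeps the distance `c/2` from zero, so the difference quotients are
dominated uniformly in `w`. -/
theorem norm_resolvent_le {p w x y a : ℂ} {c : ℝ} (hc : 0 < c) (hp : c ≤ ‖p‖) (hw : ‖w‖ ≤ c / 2) :
    p ≠ 0 ∧ p - w ≠ 0 ∧ ‖Biharm.mk x y * (Ring.inverse (emb (p - w)) * Ring.inverse (emb p)) *
      emb a‖ ≤ 6 * 6 * 6 * (6 / c) * (3 / c) * ((‖x‖ + ‖y‖) * ‖a‖) := by
  have hpw : c / 2 ≤ ‖p - w‖ := by linarith [norm_sub_norm_le p w]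
  have hp0 : p ≠ 0 := norm_pos_iff.1 (hc.trans_le hp)
  have hpw0 : p - w ≠ 0 := norm_pos_iff.1 ((half_pos hc).trans_le hpw)
  refine ⟨hp0, hpw0, ?_⟩
  have e₁ : ‖Ring.inverse (emb p)‖ ≤ 3 / c := (norm_inverse_emb_le hp0).trans (by gcongr)
  have e₂ : ‖Ring.inverse (emb (p - w))‖ ≤ 6 / c := by
    refine (norm_inverse_emb_le hpw0).trans ((div_le_div_of_nonneg_left (by norm_num)
      (half_pos hc) hpw).trans (le_of_eq ?_))
    field_simp; norm_num
  have e₃ : ‖Biharm.mk x y‖ ≤ ‖x‖ + ‖y‖ := Biharm.norm_le_add _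
  calc _ ≤ 6 * ‖Biharm.mk x y * (Ring.inverse (emb (p - w)) * Ring.inverse (emb p))‖ * ‖emb a‖ :=
        Biharm.norm_mul_le _ _
    _ ≤ 6 * (6 * ‖Biharm.mk x y‖ * (6 * ‖Ring.inverse (emb (p - w))‖ *
        ‖Ring.inverse (emb p)‖)) * ‖emb a‖ := by
        gcongr
        exact (Biharm.norm_mul_le _ _).trans
          (mul_le_mul_of_nonneg_left (Biharm.norm_mul_le _ _) (by positivity))
    _ ≤ 6 * (6 * (‖x‖ + ‖y‖) * (6 * (6 / c) * (3 / c))) * ‖a‖ := by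
        rw [norm_emb]; gcongr
    _ = _ := by ring

/-- Differentiation under the integral sign: `z` has positive distance from the boundary, and
dominated convergence applies to the resolvent form of the difference quotient. -/
theorem Setup.isMonogenicOn (h : Setup D σ X β α γ) {φ₁ φ₃ : Biharm → ℝ}
    (hφ₁ : WeightedClass X γ (pull σ φ₁)) (hφ₃ : WeightedClass X γ (pull σ φ₃))
    {Φ : Biharm → Biharm} (hΦ : EqOn Φ (cauchyIntegral σ φ₁ φ₃) (domZeta D)) :
    IsMonogenicOn Φ (domZeta D) := by
  rintro _ ⟨z, hz, rfl⟩
  have hD : ∀ z ∈ D, ∃ Z ∈ 𝒰, σ Z = z := fun z hz => by rwa [← h.param.image_disk] at hz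
  have hint : ∀ z ∈ D, IntegrableOn (cauchyIntegrand σ φ₁ φ₃ (emb z)) (Ioc 0 (2 * Real.pi)) :=
    fun z hz => by
      obtain ⟨Z, hZ, rfl⟩ := hD z hz
      exact h.integrableOn_cauchyIntegrand hφ₁ hφ₃ hZ
  obtain ⟨c, hc, hcS⟩ : ∃ c, 0 < c ∧ ∀ S ∈ Γ, c ≤ ‖σ S - z‖ := by
    obtain ⟨Z, hZ, rfl⟩ := hD z hz
    have h1 : 0 < 1 - ‖Z‖ := sub_pos.2 (mem_𝒰.1 hZ)
    obtain ⟨c, hc, hcS⟩ := h.param.exists_le_norm_sub h1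
    refine ⟨c, hc, fun S hS => hcS S (Γ_subset hS) Z (𝒰_subset hZ) ?_⟩
    rw [← mem_Γ.1 hS]; exact norm_sub_norm_le S Z
  set F : ℝ → Biharm := fun θ =>
    Biharm.mk (pull σ φ₁ (circleMap 0 1 θ)) (pull σ φ₃ (circleMap 0 1 θ)) *
      (Ring.inverse (emb (σ (circleMap 0 1 θ) - z)) *
        Ring.inverse (emb (σ (circleMap 0 1 θ) - z))) *
      emb (circleMap 0 1 θ * Complex.I * contourDeriv σ (circleMap 0 1 θ)) with hF
  refine ⟨(2 * (Real.pi : ℂ) * Complex.I)⁻¹ • ∫ θ in Ioc 0 (2 * Real.pi), F θ, ?_⟩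
  rw [← map_emb_nhdsWithin, tendsto_map'_iff]
  have hevD : ∀ᶠ w in 𝓝[≠] (0 : ℂ), z + w ∈ D := by
    refine mem_nhdsWithin_of_mem_nhds ?_
    have h1 : ContinuousAt (fun w : ℂ => z + w) 0 := by fun_prop
    exact h1 (h.param.isOpen.mem_nhds (by simpa using hz))
  have hevc : ∀ᶠ w in 𝓝[≠] (0 : ℂ), ‖w‖ ≤ c / 2 := by
    refine mem_nhdsWithin_of_mem_nhds ?_
    filter_upwards [Metric.ball_mem_nhds (0 : ℂ) (half_pos hc)] with w hw
    exact (mem_ball_zero_iff.1 hw).le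
  have hlim : Tendsto (fun w => ∫ θ in Ioc 0 (2 * Real.pi),
      Biharm.mulCLM (Ring.inverse (emb w)) (cauchyIntegrand σ φ₁ φ₃ (emb (z + w)) θ -
        cauchyIntegrand σ φ₁ φ₃ (emb z) θ)) (𝓝[≠] 0) (𝓝 (∫ θ in Ioc 0 (2 * Real.pi), F θ)) := by
    refine tendsto_integral_filter_of_dominated_convergence
      (fun θ => 6 * 6 * 6 * (6 / c) * (3 / c) *
        (|pull σ φ₁ (circleMap 0 1 θ)| * (‖contourDeriv σ (circleMap 0 1 θ)‖ + 1) +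
        |pull σ φ₃ (circleMap 0 1 θ)| * (‖contourDeriv σ (circleMap 0 1 θ)‖ + 1))) ?_ ?_
      (((h.integrableOn_weight hφ₁).add (h.integrableOn_weight hφ₃)).const_mul _) ?_
    · filter_upwards [hevD] with w hw
      exact (Biharm.mulCLM _).continuous.comp_aestronglyMeasurable
        ((hint _ hw).sub (hint z hz)).aestronglyMeasurable
    · filter_upwards [hevc, self_mem_nhdsWithin] with w hw hw0
      filter_upwards [ae_circleMap_notMem X (Ioc 0 (2 * Real.pi))] with θ hθ
      obtain ⟨hp, hpw, hle⟩ := norm_resolvent_le (x := pull σ φ₁ (circleMap 0 1 θ))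
        (y := pull σ φ₃ (circleMap 0 1 θ))
        (a := circleMap 0 1 θ * Complex.I * contourDeriv σ (circleMap 0 1 θ)) hc (hcS _ hθ.1) hw
      rw [Biharm.mulCLM_apply, h.cauchyIntegrand_sub_mul_inverse φ₁ φ₃ hθ hp hw0 hpw]
      refine hle.trans (mul_le_mul_of_nonneg_left ?_ (by positivity))
      rw [norm_mul, norm_mul, norm_circleMap_one, Complex.norm_I, one_mul, one_mul,
        Complex.norm_real, Complex.norm_real, Real.norm_eq_abs, Real.norm_eq_abs, ← add_mul]
      exact mul_le_mul_of_nonneg_left (by linarith) (by positivity)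
    · filter_upwards [ae_circleMap_notMem X (Ioc 0 (2 * Real.pi))] with θ hθ
      have hp : σ (circleMap 0 1 θ) - z ≠ 0 := norm_pos_iff.1 (hc.trans_le (hcS _ hθ.1))
      have h1 : Tendsto (fun w => Ring.inverse (emb (σ (circleMap 0 1 θ) - z - w))) (𝓝[≠] 0)
          (𝓝 (Ring.inverse (emb (σ (circleMap 0 1 θ) - z)))) := by
        refine (tendsto_inverse_emb hp).comp (tendsto_nhdsWithin_of_tendsto_nhds ?_)
        have h2 : ContinuousAt (fun w : ℂ => σ (circleMap 0 1 θ) - z - w) 0 := by fun_prop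
        simpa [ContinuousAt] using h2
      have h3 := ((Biharm.mulCLM (emb (circleMap 0 1 θ * Complex.I *
        contourDeriv σ (circleMap 0 1 θ)))).continuous.tendsto _).comp
        (((Biharm.mulCLM (Biharm.mk (pull σ φ₁ (circleMap 0 1 θ))
          (pull σ φ₃ (circleMap 0 1 θ)))).continuous.tendsto _).comp
        (((Biharm.mulCLM (Ring.inverse (emb (σ (circleMap 0 1 θ) - z)))).continuous.tendsto
          _).comp h1))
      simp only [Biharm.mulCLM_apply] at h3
      have hFθ : F θ = Ring.inverse (emb (σ (circleMap 0 1 θ) - z)) *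
          Ring.inverse (emb (σ (circleMap 0 1 θ) - z)) *
          Biharm.mk (pull σ φ₁ (circleMap 0 1 θ)) (pull σ φ₃ (circleMap 0 1 θ)) *
          emb (circleMap 0 1 θ * Complex.I * contourDeriv σ (circleMap 0 1 θ)) := by
        rw [hF]; ring
      rw [hFθ]
      refine h3.congr' ?_
      filter_upwards [hevc, self_mem_nhdsWithin] with w hw hw0
      obtain ⟨-, hpw, -⟩ := norm_resolvent_le (x := 0) (y := 0) (a := 0) hc (hcS _ hθ.1) hw
      rw [Biharm.mulCLM_apply, h.cauchyIntegrand_sub_mul_inverse φ₁ φ₃ hθ hp hw0 hpw]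
      simp only [Function.comp_apply, Biharm.mulCLM_apply]
      ring
  refine (hlim.const_smul (2 * (Real.pi : ℂ) * Complex.I)⁻¹).congr' ?_
  filter_upwards [hevD] with w hw
  have i₁ := hint _ hw
  have i₂ := hint z hz
  have e := (Biharm.mulCLM (Ring.inverse (emb w))).integral_comp_comm (i₁.sub i₂)
  simp only [Pi.sub_apply] at e
  rw [e, integral_sub i₁ i₂, ← map_smul, smul_sub, Biharm.mulCLM_apply, Function.comp_apply,
    ← emb_add, hΦ ⟨_, hw, rfl⟩, hΦ ⟨z, hz, rfl⟩,
    cauchyIntegral, cauchyIntegral, intervalIntegral.integral_of_le Real.two_pi_pos.le,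
    intervalIntegral.integral_of_le Real.two_pi_pos.le]

end CauchyTypeIntegral

/-! ### The boundary value problem and the system of integral equations -/

section BoundaryValueProblem

variable {D : Set ℂ} {σ : ℂ → ℂ} {m : ℕ} {X : Fin m → ℂ} {β α γ : Fin m → ℝ}

theorem Setup.map_nhdsWithin_disk (h : Setup D σ X β α γ) {Z : ℂ} (hZ : Z ∈ 𝒰c) :
    map (fun Z => emb (σ Z)) (𝓝[𝒰] Z) = 𝓝[domZeta D] (emb (σ Z)) := by
  rw [h.param.domZeta_eq, h.param.map_nhdsWithin 𝒰_subset hZ]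

theorem neBot_nhdsWithin_disk {Z : ℂ} (hZ : Z ∈ 𝒰c) : (𝓝[𝒰] Z).NeBot :=
  mem_closure_iff_nhdsWithin_neBot.1 (by rwa [closure_𝒰])

/-- The limit is already known to exist, and limits are unique, so prescribing it is an equation
between functions on the circle. -/
theorem Setup.forall_tendsto_iff (h : Setup D σ X β α γ) {V : Biharm → ℝ} {v : ℂ → ℝ}
    {u : Biharm → ℝ} (hV : ∀ Z ∈ 𝒰, V (emb (σ Z)) = v Z) {B : ℂ → ℝ}
    (hv : ∀ Z₀ ∈ Γ \ range X, Tendsto v (𝓝[𝒰] Z₀) (𝓝 (B Z₀))) :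
    (∀ ζ₀ ∈ regBdryZeta D σ X, Tendsto V (𝓝[domZeta D] ζ₀) (𝓝 (u ζ₀))) ↔
      ∀ Z₀ ∈ Γ \ range X, B Z₀ = pull σ u Z₀ := by
  rw [h.param.regBdryZeta_eq h.mem, forall_mem_image]
  refine forall₂_congr fun Z₀ hZ₀ => ?_
  have hZc := Γ_subset hZ₀.1
  have := neBot_nhdsWithin_disk hZc
  have h1 : Tendsto (V ∘ fun Z => emb (σ Z)) (𝓝[𝒰] Z₀) (𝓝 (B Z₀)) := by
    refine (hv Z₀ hZ₀).congr' ?_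
    filter_upwards [self_mem_nhdsWithin] with Z hZ using (hV Z hZ).symm
  rw [← h.map_nhdsWithin_disk hZc, tendsto_map'_iff]
  exact ⟨fun h2 => tendsto_nhds_unique h1 h2, fun h2 => by rw [h2] at h1; exact h1⟩

/-- Only the upper estimate of `|σ(Z) - σ(X_j)|` is needed to pass from `γ_j` to `α_j`, and it holds
in the whole disk. -/
theorem Setup.exists_growth (h : Setup D σ X β α γ) {V : Biharm → ℝ} {v : ℂ → ℝ}
    (hV : ∀ Z ∈ 𝒰, V (emb (σ Z)) = v Z) {j : Fin m}
    (hv : ∃ C, ∀ᶠ Z in 𝓝[𝒰] (X j), |v Z| ≤ C * ‖Z - X j‖ ^ (-γ j)) :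
    ∃ c, ∀ᶠ ζ in 𝓝[domZeta D] (corner σ X j), |V ζ| ≤ c * ‖ζ - corner σ X j‖ ^ (-α j) := by
  obtain ⟨C, hC⟩ := hv
  obtain ⟨-, b, -, hb, -, hup⟩ := h.exists_comparable j
  refine ⟨|C| * b ^ α j, ?_⟩
  have hX := Γ_subset (h.mem j)
  rw [corner, ← h.map_nhdsWithin_disk hX, eventually_map]
  filter_upwards [hC, self_mem_nhdsWithin] with Z hZ hZU
  have hne : Z ≠ X j := fun he => (mem_𝒰.1 hZU).ne (by rw [he]; exact mem_Γ.1 (h.mem j))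
  have h1 := mul_rpow_neg_le_of_le_mul_rpow hb (norm_pos_iff.2 (sub_ne_zero.2 hne))
    (norm_pos_iff.2 (h.param.sub_ne_zero (𝒰_subset hZU) hX hne)) (h.α_pos j).le
    (hup Z (𝒰_subset hZU))
  rw [← h.γ_eq] at h1
  rw [hV Z hZU, norm_emb_sub, mul_assoc]
  exact hZ.trans (mul_le_mul (le_abs_self C) h1 (by positivity) (abs_nonneg C))

theorem HasSingularIntegral.unique {Ω : ℂ → ℂ → ℂ} {T A B : ℂ} (hA : HasSingularIntegral Ω T A)
    (hB : HasSingularIntegral Ω T B) : A = B :=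
  tendsto_nhds_unique hA.2 hB.2

/-- The principal values exist for every admissible density and are unique, so the existential
quantifiers can be eliminated. The constants `C_ψ` are real, which reduces the complex equations to
real ones. -/
theorem Setup.solvesSystem_iff (h : Setup D σ X β α γ) {ψ₁ ψ₃ v₁ v₃ : ℂ → ℝ}
    (hψ₁ : WeightedClass X γ ψ₁) (hψ₃ : WeightedClass X γ ψ₃) :
    SolvesSystem σ X v₁ v₃ ψ₁ ψ₃ ↔
      (∀ Z₀ ∈ Γ \ range X, boundaryValue σ Complex.I ψ₁ ψ₃ Z₀ = v₁ Z₀) ∧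
      ∀ Z₀ ∈ Γ \ range X, boundaryValue σ (-Complex.I) ψ₃ ψ₁ Z₀ = v₃ Z₀ := by
  rw [← forall₂_and]
  refine forall₂_congr fun Z₀ hZ₀ => ?_
  have a₁ := h.hasSingularIntegral_Ω₁ hψ₁ hZ₀
  have a₃ := h.hasSingularIntegral_Ω₁ hψ₃ hZ₀
  have b₁ := h.hasSingularIntegral_Ω₂ hψ₁ hZ₀
  have b₃ := h.hasSingularIntegral_Ω₂ hψ₃ hZ₀
  have e₁ : ∀ x y : ℝ, ((x : ℝ) : ℂ) + constC ψ₁ = (y : ℂ) ↔ x + 1 / 2 * circleMean ψ₁ = y :=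
    fun x y => by rw [constC_eq, ← Complex.ofReal_add, Complex.ofReal_inj]
  have e₃ : ∀ x y : ℝ, ((x : ℝ) : ℂ) + constC ψ₃ = (y : ℂ) ↔ x + 1 / 2 * circleMean ψ₃ = y :=
    fun x y => by rw [constC_eq, ← Complex.ofReal_add, Complex.ofReal_inj]
  have hre : ∀ z : ℂ, (2 * Complex.I * z).re = -2 * z.im ∧ (2 * -Complex.I * z).re = 2 * z.im ∧
      (2 * z).re = 2 * z.re := fun z => by simp
  constructor
  · rintro ⟨A₁, A₃, B₁, B₃, hA₁, hA₃, hB₁, hB₃, q₁, q₃⟩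
    rw [hA₁.unique a₁, hB₁.unique b₁, hB₃.unique b₃, e₁] at q₁
    rw [hA₃.unique a₃, hB₁.unique b₁, hB₃.unique b₃, e₃] at q₃
    simp only [boundaryValue, hre]
    constructor <;> linarith
  · rintro ⟨q₁, q₃⟩
    refine ⟨_, _, _, _, a₁, a₃, b₁, b₃, ?_, ?_⟩
    · rw [e₁]; simp only [boundaryValue, hre] at q₁; linarith
    · rw [e₃]; simp only [boundaryValue, hre] at q₃; linarith

/-- Monogenicity and growth are automatic, so only the two limit conditions carry information. -/
theorem Setup.isSolution13_iff (h : Setup D σ X β α γ) {u₁ u₃ φ₁ φ₃ : Biharm → ℝ}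
    (hφ₁ : WeightedClass X γ (pull σ φ₁)) (hφ₃ : WeightedClass X γ (pull σ φ₃))
    {Φ : Biharm → Biharm} (hΦ : EqOn Φ (cauchyIntegral σ φ₁ φ₃) (domZeta D)) :
    IsSolution13 D σ X α u₁ u₃ Φ ↔
      SolvesSystem σ X (pull σ u₁) (pull σ u₃) (pull σ φ₁) (pull σ φ₃) := by
  have hΦZ : ∀ Z ∈ 𝒰, Φ (emb (σ Z)) = cauchyIntegral σ φ₁ φ₃ (emb (σ Z)) := fun Z hZ =>
    hΦ (by rw [h.param.domZeta_eq]; exact ⟨Z, hZ, rfl⟩)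
  have h₁ : ∀ Z ∈ 𝒰, U₁ (Φ (emb (σ Z))) =
      (coordIntegral σ Complex.I (pull σ φ₁) (pull σ φ₃) Z).re := fun Z hZ => by
    rw [hΦZ Z hZ, h.cauchyIntegral_eq hφ₁ hφ₃ hZ]; rfl
  have h₃ : ∀ Z ∈ 𝒰, U₃ (Φ (emb (σ Z))) =
      (coordIntegral σ (-Complex.I) (pull σ φ₃) (pull σ φ₁) Z).re := fun Z hZ => by
    rw [hΦZ Z hZ, h.cauchyIntegral_eq hφ₁ hφ₃ hZ]; rfl
  have l₁ := h.forall_tendsto_iff (V := fun ζ => U₁ (Φ ζ)) (u := u₁) h₁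
    fun Z₀ hZ₀ => h.tendsto_coordIntegral hφ₁ hφ₃ _ hZ₀
  have l₃ := h.forall_tendsto_iff (V := fun ζ => U₃ (Φ ζ)) (u := u₃) h₃
    fun Z₀ hZ₀ => h.tendsto_coordIntegral hφ₃ hφ₁ _ hZ₀
  rw [h.solvesSystem_iff hφ₁ hφ₃, ← l₁, ← l₃]
  refine ⟨fun hs => ⟨hs.limit₁, hs.limit₃⟩, fun hs => ⟨h.isMonogenicOn hφ₁ hφ₃ hΦ, hs.1, hs.2,
    fun j => ?_, fun j => ?_⟩⟩
  · exact h.exists_growth (V := fun ζ => U₁ (Φ ζ)) h₁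
      (h.exists_coordIntegral_growth hφ₁ hφ₃ Complex.norm_I j)
  · exact h.exists_growth (V := fun ζ => U₃ (Φ ζ)) h₃
      (h.exists_coordIntegral_growth hφ₃ hφ₁ (by rw [norm_neg, Complex.norm_I]) j)

end BoundaryValueProblem

end BiharmonicSchwarz

end

theorem mainTheorem1 {m : ℕ} (hm : 0 < m)
    (D : Set ℂ) (σ : ℂ → ℂ) (hσ : IsConformalParam σ D)
    (X : Fin m → ℂ) (hX : ∀ j, X j ∈ Γ) (hXinj : Function.Injective X)
    (β : Fin m → ℝ) (hβ : ∀ j, -1 < β j ∧ β j ≤ 1)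
    (hA : ConditionA σ X β) (hB : ConditionB σ X β)
    (α : Fin m → ℝ) (hα0 : ∀ j, 0 < α j)
    (hα1 : ∀ j, β j < 0 → α j < 1) (hα2 : ∀ j, 0 ≤ β j → α j < 1 / (β j + 1))
    (u₁ u₃ : Biharm → ℝ)
    (hu₁ : BoundaryClass D σ X α u₁) (hu₃ : BoundaryClass D σ X α u₃)
    (γ : Fin m → ℝ) (hγ : ∀ j, γ j = (β j + 1) * α j) :
    -- `φ ↦ φ ∘ σ̃` identifies the class of admissible densities with `𝒦{γ_j}`
    (∀ φ : Biharm → ℝ, BoundaryClass D σ X α φ ↔ WeightedClass X γ (pull σ φ)) ∧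
    (∀ ψ : ℂ → ℝ, WeightedClass X γ ψ →
      ∃ φ : Biharm → ℝ, BoundaryClass D σ X α φ ∧ EqOn (pull σ φ) ψ (Γ \ range X)) ∧
    -- the right-hand sides of the system belong to `𝒦{γ_j}`
    WeightedClass X γ (pull σ u₁) ∧ WeightedClass X γ (pull σ u₃) ∧
    -- all integrals that occur exist for every admissible density
    (∀ φ₁ φ₃ : Biharm → ℝ, BoundaryClass D σ X α φ₁ → BoundaryClass D σ X α φ₃ →
      ∀ ζ ∈ domZeta D,
        IntervalIntegrable (cauchyIntegrand σ φ₁ φ₃ ζ) volume 0 (2 * Real.pi)) ∧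
    (∀ ψ : ℂ → ℝ, WeightedClass X γ ψ →
      CircleIntegrable (fun S => (ψ S : ℂ) / S) 0 1 ∧
      ∀ Z₀ ∈ Γ \ range X,
        (∃ A, HasSingularIntegral (Ω₁ σ ψ) Z₀ A) ∧ ∃ B, HasSingularIntegral (Ω₂ σ ψ) Z₀ B) ∧
    -- the Cauchy-type integral solves the (1-3)-problem iff the density solves the system
    (∀ φ₁ φ₃ : Biharm → ℝ, BoundaryClass D σ X α φ₁ → BoundaryClass D σ X α φ₃ →
      ∀ Φ : Biharm → Biharm, EqOn Φ (cauchyIntegral σ φ₁ φ₃) (domZeta D) →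
        (IsSolution13 D σ X α u₁ u₃ Φ ↔
          SolvesSystem σ X (pull σ u₁) (pull σ u₃) (pull σ φ₁) (pull σ φ₃))) := by
  have h : Setup D σ X β α γ :=
    { card_pos := hm
      param := hσ
      mem := hX
      inj := hXinj
      neg_one_lt := fun j => (hβ j).1
      condA := hA
      condB := hB
      α_pos := hα0
      -- For `β_j ≥ 0` the bound `1/(β_j + 1)` is at most `1`, so `α_j < 1` in both cases.
      α_lt_one := fun j => by
        rcases lt_or_ge (β j) 0 with hj | hj
        · exact hα1 j hj
        · exact (hα2 j hj).trans_le ((div_le_one (by linarith)).2 (by linarith))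
      γ_eq := hγ
      γ_lt_one := fun j => by
        rw [hγ]
        rcases lt_or_ge (β j) 0 with hj | hj
        · nlinarith [hα0 j, hα1 j hj, (hβ j).1]
        · have := (lt_div_iff₀ (by linarith)).1 (hα2 j hj)
          linarith }
  have hw := fun φ => (h.boundaryClass_iff φ).1
  refine ⟨h.boundaryClass_iff, fun ψ => h.exists_pull_eq, hw u₁ hu₁, hw u₃ hu₃, ?_, ?_, ?_⟩
  · rintro φ₁ φ₃ h₁ h₃ _ ⟨z, hz, rfl⟩
    rw [← hσ.image_disk] at hz
    obtain ⟨Z, hZ, rfl⟩ := hz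
    rw [intervalIntegrable_iff_integrableOn_Ioc_of_le Real.two_pi_pos.le]
    exact h.integrableOn_cauchyIntegrand (hw φ₁ h₁) (hw φ₃ h₃) hZ
  · exact fun ψ hψ => ⟨h.circleIntegrable_density_div hψ, fun Z₀ hZ₀ =>
      ⟨⟨_, h.hasSingularIntegral_Ω₁ hψ hZ₀⟩, ⟨_, h.hasSingularIntegral_Ω₂ hψ hZ₀⟩⟩⟩
  · exact fun φ₁ φ₃ h₁ h₃ Φ hΦ => h.isSolution13_iff (hw φ₁ h₁) (hw φ₃ h₃) hΦ
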